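/- A pseudo-Kähler Lie algebra is a triple $(\mathfrak g,g,J)$ where $\mathfrak g$ is a real finite-dimensional Lie algebra, $g$ a non-degenerate scalar product, $J$ an endomorphism with $J^2=-\mathrm{id}$, $g(J\cdot,J\cdot)=g$, vanishing Nijenhuis tensor, and $\omega=g(J\cdot,\cdot)$ closed. For an endomorphism $f$ of $\mathfrak g$ write $f^s=\frac12(f+f^*)$, $f^a=\frac12(f-f^*)$, with $f^*$ the $g$-adjoint. A pseudo-Kähler extension of $(\mathfrak g,g,J_g)$ by $(\mathfrak h,h,J_h)$ is given by a representation $\varphi\colon\mathfrak h\to\mathrm{Der}(\mathfrak g)$ with $J_g\circ\varphi(A)^s=\varphi(J_hA)^s$ and $J_g\circ\varphi(A)^a=\varphi(A)^a\circ J_g$ for all $A\in\mathfrak h$ (equivalently, $\mathfrak g\rtimes_\varphi\mathfrak h$ with $g+h$ and $J_g+J_h$ is pseudo-Kähler). Extensions $\mathfrak g\rtimes_\varphi\mathfrak h$ and $\mathfrak g'\rtimes_{\varphi'}\mathfrak h'$ are AW-related if there are Lie algebra isomorphisms $f_g\colon\mathfrak g\to\mathfrak g'$, $f_h\colon\mathfrak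 h\to\mathfrak h'$ preserving metrics and complex structures with $(f_g\varphi(A)f_g^{-1}-\varphi'(f_h(A)))^s=0$ and $[f_g\varphi(A)f_g^{-1},\varphi'(A')]=0$ for all $A\in\mathfrak h$, $A'\in\mathfrak h'$. An extension is trivial if it is AW-related to one with $\varphi'=0$. Let $\mathbb R^2=\langle a_1,a_2\rangle$ be abelian with $h=a^1\otimes a^1+a^2\otimes a^2$, $J_ha_1=a_2$. **Theorem.** Every non-trivial pseudo-Kähler extension of a $4$-dimensional pseudo-Kähler Lie algebra by a $2$-dimensional abelian Lie algebra with a (positive definite) Kähler structure is AW-related to one of the following extensions by $\mathbb R^2$ (matrices act on columns in a basis $e_1,\dots,e_4$): 1. $\mathfrak g=\mathbb R^4$ abelian, $g=e^1\otimes e^1-e^2\otimes e^2+e^3\otimes e^3-e^4\otimes e^4$, $Je_1=e_3$, $Je_2=e_4$, with $$\varphi(a_1)=a\begin{pmatrix}1&2&-1&0\\0&1&0&1\\1&0&-1&0\\0&-1&2&-1\end{pmatrix},\quad \varphi(a_2)=a\begin{pmatrix}0&1&2&1\\1&0&-1&0\\0&1&0&1\\-1&2&1&0\end{pmatrix},\quad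 a>0;$$ 2. the same $(\mathfrak g,g,J)$, with $$\varphi(a_1)=\begin{pmatrix}a&-a+c&-b&b\\a+c&-a&-b&b\\b&-b&-a&a+c\\b&-b&-a+c&a\end{pmatrix},\quad \varphi(a_2)=\begin{pmatrix}0&0&a-c&-a\\0&0&a&-a-c\\a+c&-a&0&0\\a&-a+c&0&0\end{pmatrix},$$ where $a>0$ and either $b=c=0$ or $b,c\in\mathbb R$ with $c\neq0$; 3. $\mathfrak g=\mathfrak{rh}_3$, with non-zero bracket $[e_1,e_2]=e_3$, $Je_1=e_2$, $Je_3=e_4$, $g=e^1\odot e^3+e^2\odot e^4$ (where $e^i\odot e^j=e^i\otimes e^j+e^j\otimes e^i$), with $$\varphi(a_1)=\begin{pmatrix}0&0&0&0\\0&0&0&0\\a&0&0&0\\0&-a&0&0\end{pmatrix},\quad \varphi(a_2)=\begin{pmatrix}0&0&0&0\\0&0&0&0\\0&a&0&0\\a&0&0&0\end{pmatrix},\quad a>0;$$ 4. $\mathfrak g=\mathfrak r'_2$, with non-zero brackets $[e_1,e_3]=e_3$, $[e_1,e_4]=e_4$, $[e_2,e_3]=e_4$, $[e_2,e_4]=-e_3$,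 and, for parameters $p,q,r\in\mathbb R$ with $q^2+r^2\neq0$, $$J=\begin{pmatrix}0&1&0&0\\-1&0&0&0\\0&0&0&-1\\0&0&1&0\end{pmatrix},\quad g=\begin{pmatrix}p&0&-r&q\\0&p&q&r\\-r&q&0&0\\q&r&0&0\end{pmatrix},$$ $$\varphi(a_1)=\begin{pmatrix}0&0&0&0\\0&0&0&0\\a&0&0&0\\0&a&0&0\end{pmatrix},\quad \varphi(a_2)=\begin{pmatrix}0&0&0&0\\0&0&0&0\\0&-a&0&0\\a&0&0&0\end{pmatrix},\quad a>0.$$ Moreover all these are non-trivial pseudo-Kähler extensions; consequently a $4$-dimensional pseudo-Kähler Lie algebra admits a non-trivial extension by $\mathbb R^2$ if and only if it is isomorphic, as a pseudo-Kähler Lie algebra, to $\mathbb R^4$, to $\mathfrak{rh}_3$, or to $\mathfrak r'_2$ with one of the pseudo-Kähler structures above. -/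

import Mathlib

noncomputable section

namespace PK

/-! ## Pseudo-Hermitian and pseudo-Kähler Lie algebras -/

/-- A `U(p,q)`-structure `(g, J)` on a real Lie algebra: a non-degenerate scalar product and an
almost complex structure such that `g(J·,J·) = g`. -/
structure PseudoHermitian (L : Type*) [LieRing L] [LieAlgebra ℝ L] where
  metric : LinearMap.BilinForm ℝ L
  symm : metric.IsSymm
  nondeg : metric.Nondegenerate
  J : L →ₗ[ℝ] L
  J_sq : ∀ x, J (J x) = -x
  compat : ∀ x y, metric (J x) (J y) = metric x y

/-- The Nijenhuis tensor of `J` vanishes. -/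
def PseudoHermitian.Integrable {L : Type*} [LieRing L] [LieAlgebra ℝ L]
    (P : PseudoHermitian L) : Prop :=
  ∀ x y, ⁅P.J x, P.J y⁆ - ⁅x, y⁆ - P.J (⁅P.J x, y⁆ + ⁅x, P.J y⁆) = 0

/-- The 2-form `ω = g(J·,·)`. -/
def PseudoHermitian.omega {L : Type*} [LieRing L] [LieAlgebra ℝ L]
    (P : PseudoHermitian L) (x y : L) : ℝ := P.metric (P.J x) y

/-- The 2-form `ω` is closed in the Chevalley–Eilenberg complex. -/
def PseudoHermitian.OmegaClosed {L : Type*} [LieRing L] [LieAlgebra ℝ L]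
    (P : PseudoHermitian L) : Prop :=
  ∀ x y z, P.omega ⁅x, y⁆ z + P.omega ⁅y, z⁆ x + P.omega ⁅z, x⁆ y = 0

/-- A pseudo-Kähler structure on a real Lie algebra. -/
structure PseudoKahler (L : Type*) [LieRing L] [LieAlgebra ℝ L] extends PseudoHermitian L where
  integrable : toPseudoHermitian.Integrable
  closed : toPseudoHermitian.OmegaClosed

/-- Isomorphisms of Lie algebras respecting the pseudo-Kähler structures. -/
structure PseudoKahlerEquiv {L L' : Type*} [LieRing L] [LieAlgebra ℝ L] [LieRing L']
    [LieAlgebra ℝ L'] (P : PseudoKahler L) (P' : PseudoKahler L') extends L ≃ₗ⁅ℝ⁆ L' where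
  map_metric : ∀ x y, P'.metric (toLieEquiv x) (toLieEquiv y) = P.metric x y
  map_J : ∀ x, toLieEquiv (P.J x) = P'.J (toLieEquiv x)

/-! ## Symmetric and antisymmetric parts -/

namespace PseudoHermitian

theorem ext_metric {L : Type*} [LieRing L] [LieAlgebra ℝ L] (P : PseudoHermitian L) {x x' : L}
    (h : ∀ y, P.metric x y = P.metric x' y) : x = x' := by
  rw [← sub_eq_zero]
  exact P.nondeg.1 _ fun y => by rw [map_sub, LinearMap.sub_apply, h y, sub_self]

theorem metric_J_left {L : Type*} [LieRing L] [LieAlgebra ℝ L] (P : PseudoHermitian L) (x y : L) :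
    P.metric (P.J x) y = -P.metric x (P.J y) := by
  have h := P.compat x (P.J y)
  rw [P.J_sq, map_neg] at h
  linarith

section

variable {L : Type*} [LieRing L] [LieAlgebra ℝ L] [FiniteDimensional ℝ L] (P : PseudoHermitian L)

/-- The metric adjoint `f^*` of an endomorphism. -/
def adjoint (f : L →ₗ[ℝ] L) : L →ₗ[ℝ] L := P.metric.leftAdjointOfNondegenerate P.nondeg f

/-- The `g`-symmetric part `f^s = (f + f^*) / 2`. -/
def symPart (f : L →ₗ[ℝ] L) : L →ₗ[ℝ] L := (1 / 2 : ℝ) • (f + P.adjoint f)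

/-- The `g`-antisymmetric part `f^a = (f - f^*) / 2`. -/
def antiPart (f : L →ₗ[ℝ] L) : L →ₗ[ℝ] L := (1 / 2 : ℝ) • (f - P.adjoint f)

theorem metric_adjoint (f : L →ₗ[ℝ] L) (x y : L) :
    P.metric (P.adjoint f x) y = P.metric x (f y) :=
  LinearMap.BilinForm.isAdjointPairLeftAdjointOfNondegenerate P.metric P.nondeg f x y

theorem metric_symPart (f : L →ₗ[ℝ] L) (x y : L) :
    P.metric (P.symPart f x) y = (1 / 2) * (P.metric (f x) y + P.metric x (f y)) := by
  simp only [symPart, LinearMap.smul_apply, LinearMap.add_apply, map_smul, map_add,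
    metric_adjoint, smul_eq_mul]

theorem metric_antiPart (f : L →ₗ[ℝ] L) (x y : L) :
    P.metric (P.antiPart f x) y = (1 / 2) * (P.metric (f x) y - P.metric x (f y)) := by
  simp only [antiPart, LinearMap.smul_apply, LinearMap.sub_apply, map_smul, map_sub,
    metric_adjoint, smul_eq_mul]

theorem J_symPart_iff (f f' : L →ₗ[ℝ] L) : P.J ∘ₗ P.symPart f = P.symPart f' ↔
    ∀ x y, P.metric (f x) (P.J y) + P.metric x (f (P.J y)) +
      P.metric (f' x) y + P.metric x (f' y) = 0 := by
  constructor
  · intro h x y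
    have h1 := congrArg (fun z => P.metric z y) (LinearMap.congr_fun h x)
    simp only [LinearMap.comp_apply, metric_J_left, metric_symPart] at h1
    linarith
  · intro h
    refine LinearMap.ext fun x => P.ext_metric fun y => ?_
    simp only [LinearMap.comp_apply, metric_J_left, metric_symPart]
    linarith [h x y]

theorem J_antiPart_iff (f : L →ₗ[ℝ] L) : P.J ∘ₗ P.antiPart f = P.antiPart f ∘ₗ P.J ↔
    ∀ x y, P.metric (f (P.J x)) y - P.metric (P.J x) (f y) +
      P.metric (f x) (P.J y) - P.metric x (f (P.J y)) = 0 := by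
  constructor
  · intro h x y
    have h1 := congrArg (fun z => P.metric z y) (LinearMap.congr_fun h x)
    simp only [LinearMap.comp_apply, metric_J_left, metric_antiPart] at h1 ⊢
    linarith
  · intro h
    refine LinearMap.ext fun x => P.ext_metric fun y => ?_
    have h1 := h x y
    simp only [LinearMap.comp_apply, metric_J_left, metric_antiPart] at h1 ⊢
    linarith

end

/-! ## The semidirect product -/

section

variable {G H : Type*} [LieRing G] [LieAlgebra ℝ G] [LieRing H] [LieAlgebra ℝ H]

open LieAlgebra

/-- The metric `g + h` on the semidirect product of `G` and `H`. -/
def sdMetric (P : PseudoHermitian G) (Q : PseudoHermitian H)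
    (φ : H →ₗ⁅ℝ⁆ LieDerivation ℝ G G) : LinearMap.BilinForm ℝ (G ⋊⁅φ⁆ H) :=
  LinearMap.mk₂ ℝ (fun x y => P.metric x.left y.left + Q.metric x.right y.right)
    (by intros; simp; ring) (by intros; simp; ring) (by intros; simp; ring)
    (by intros; simp; ring)

/-- The almost complex structure `J_g + J_h` on the semidirect product of `G` and `H`. -/
def sdJ (P : PseudoHermitian G) (Q : PseudoHermitian H)
    (φ : H →ₗ⁅ℝ⁆ LieDerivation ℝ G G) : (G ⋊⁅φ⁆ H) →ₗ[ℝ] (G ⋊⁅φ⁆ H) where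
  toFun x := ⟨P.J x.left, Q.J x.right⟩
  map_add' := by intros; simp
  map_smul' := by intros; simp

theorem sdMetric_apply (P : PseudoHermitian G) (Q : PseudoHermitian H)
    (φ : H →ₗ⁅ℝ⁆ LieDerivation ℝ G G) (x y : G ⋊⁅φ⁆ H) :
    sdMetric P Q φ x y = P.metric x.left y.left + Q.metric x.right y.right := rfl

theorem sdJ_apply (P : PseudoHermitian G) (Q : PseudoHermitian H)
    (φ : H →ₗ⁅ℝ⁆ LieDerivation ℝ G G) (x : G ⋊⁅φ⁆ H) :
    sdJ P Q φ x = ⟨P.J x.left, Q.J x.right⟩ := rfl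

/-- The `U(p,q)`-structure on the semidirect product of `G` and `H`. -/
def semidirect (P : PseudoHermitian G) (Q : PseudoHermitian H)
    (φ : H →ₗ⁅ℝ⁆ LieDerivation ℝ G G) : PseudoHermitian (G ⋊⁅φ⁆ H) where
  metric := sdMetric P Q φ
  symm := ⟨fun x y => by
    simp [sdMetric_apply, P.symm.eq x.left y.left, Q.symm.eq x.right y.right]⟩
  nondeg := by
    refine ⟨fun x hx => ?_, fun x hx => ?_⟩
    · ext
      · exact P.nondeg.1 _ fun y => by simpa [sdMetric_apply] using hx ⟨y, 0⟩
      · exact Q.nondeg.1 _ fun y => by simpa [sdMetric_apply] using hx ⟨0, y⟩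
    · ext
      · exact P.nondeg.2 _ fun y => by simpa [sdMetric_apply] using hx ⟨y, 0⟩
      · exact Q.nondeg.2 _ fun y => by simpa [sdMetric_apply] using hx ⟨0, y⟩
  J := sdJ P Q φ
  J_sq := fun x => by simp [sdJ_apply, P.J_sq, Q.J_sq]
  compat := fun x y => by simp [sdJ_apply, sdMetric_apply, P.compat, Q.compat]

end

end PseudoHermitian

/-! ## Pseudo-Kähler extensions -/

section

variable {G H : Type*} [LieRing G] [LieAlgebra ℝ G] [LieRing H] [LieAlgebra ℝ H]

/-- The conditions on a representation `φ` of `H` on `G` by derivations that define pseudo-Kähler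
extensions. -/
def IsExtension [FiniteDimensional ℝ G] (P : PseudoKahler G) (Q : PseudoKahler H)
    (φ : H →ₗ⁅ℝ⁆ LieDerivation ℝ G G) : Prop :=
  (∀ A, P.J ∘ₗ P.symPart (φ A).toLinearMap = P.symPart (φ (Q.J A)).toLinearMap) ∧
  (∀ A, P.J ∘ₗ P.antiPart (φ A).toLinearMap = P.antiPart (φ A).toLinearMap ∘ₗ P.J)

theorem semidirect_integrable_iff (P : PseudoKahler G) (Q : PseudoKahler H)
    (φ : H →ₗ⁅ℝ⁆ LieDerivation ℝ G G) :
    (P.semidirect Q.toPseudoHermitian φ).Integrable ↔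
    ∀ A x, -φ (Q.J A) (P.J x) + φ A x + P.J (φ A (P.J x)) + P.J (φ (Q.J A) x) = 0 := by
  constructor
  · intro h A x
    have h1 := congrArg LieAlgebra.SemiDirectSum.left (h ⟨x, 0⟩ ⟨0, A⟩)
    simp [PseudoHermitian.semidirect, PseudoHermitian.sdJ_apply] at h1
    linear_combination (norm := module) h1
  · intro h x y
    have h1 := P.integrable x.left y.left
    have h2 := Q.integrable x.right y.right
    have h3 := h x.right y.left
    have h4 := h y.right x.left
    ext
    · simp [PseudoHermitian.semidirect, PseudoHermitian.sdJ_apply] at h1 ⊢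
      linear_combination (norm := module) h1 - h3 + h4
    · simpa [PseudoHermitian.semidirect, PseudoHermitian.sdJ_apply] using h2

theorem semidirect_omegaClosed_iff (P : PseudoKahler G) (Q : PseudoKahler H)
    (φ : H →ₗ⁅ℝ⁆ LieDerivation ℝ G G) :
    (P.semidirect Q.toPseudoHermitian φ).OmegaClosed ↔
    ∀ A x y, P.metric (P.J (φ A x)) y + P.metric (P.J x) (φ A y) = 0 := by
  constructor
  · intro h A x y
    have h1 := h ⟨x, 0⟩ ⟨y, 0⟩ ⟨0, A⟩
    simp [PseudoHermitian.semidirect, PseudoHermitian.sdJ_apply,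
      PseudoHermitian.sdMetric_apply, PseudoHermitian.omega] at h1
    have h2 := P.metric_J_left (φ A y) x
    rw [P.symm.eq (φ A y) (P.J x)] at h2
    linarith
  · intro h x y z
    have h1 := P.closed x.left y.left z.left
    have h2 := Q.closed x.right y.right z.right
    have e1 := h x.right y.left z.left
    have e2 := h y.right z.left x.left
    have e3 := h z.right x.left y.left
    have s1 := P.metric_J_left (φ x.right z.left) y.left
    have s2 := P.metric_J_left (φ y.right x.left) z.left
    have s3 := P.metric_J_left (φ z.right y.left) x.left
    rw [P.symm.eq _ (P.J _)] at s1 s2 s3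
    simp [PseudoHermitian.semidirect, PseudoHermitian.sdJ_apply,
      PseudoHermitian.sdMetric_apply, PseudoHermitian.omega] at h1 h2 ⊢
    linarith

theorem nijenhuis_of_parts (P : PseudoHermitian G) (f f' : G →ₗ[ℝ] G)
    (hs : ∀ x y, P.metric (f x) (P.J y) + P.metric x (f (P.J y)) +
      P.metric (f' x) y + P.metric x (f' y) = 0)
    (ha : ∀ x y, P.metric (f (P.J x)) y - P.metric (P.J x) (f y) +
      P.metric (f x) (P.J y) - P.metric x (f (P.J y)) = 0)
    (ha' : ∀ x y, P.metric (f' (P.J x)) y - P.metric (P.J x) (f' y) +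
      P.metric (f' x) (P.J y) - P.metric x (f' (P.J y)) = 0) (x : G) :
    -f' (P.J x) + f x + P.J (f (P.J x)) + P.J (f' x) = 0 := by
  refine P.ext_metric fun y => ?_
  have e1 := hs (P.J x) y
  have e2 := hs x (P.J y)
  have e3 := ha x (P.J y)
  have e4 := ha' x y
  simp only [P.J_sq, map_neg, LinearMap.neg_apply, map_add, LinearMap.add_apply, map_zero,
    LinearMap.zero_apply] at e1 e2 e3 e4 ⊢
  rw [P.metric_J_left (f (P.J x)) y, P.metric_J_left (f' x) y]
  linarith

theorem closed_of_parts (P : PseudoHermitian G) (f f' : G →ₗ[ℝ] G)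
    (hs : ∀ x y, P.metric (f x) (P.J y) + P.metric x (f (P.J y)) +
      P.metric (f' x) y + P.metric x (f' y) = 0)
    (ha : ∀ x y, P.metric (f (P.J x)) y - P.metric (P.J x) (f y) +
      P.metric (f x) (P.J y) - P.metric x (f (P.J y)) = 0) (x y : G) :
    P.metric (P.J (f x)) y + P.metric (P.J x) (f y) = 0 := by
  have e1 := hs x y
  have e2 := hs y x
  have e3 := ha x y
  rw [P.symm.eq _ (P.J x), P.symm.eq y, P.symm.eq _ x, P.symm.eq y] at e2
  rw [P.metric_J_left (f x) y]
  linarith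

theorem anti_of_closed (P : PseudoHermitian G) (f : G →ₗ[ℝ] G)
    (hc : ∀ x y, P.metric (P.J (f x)) y + P.metric (P.J x) (f y) = 0) (x y : G) :
    P.metric (f (P.J x)) y - P.metric (P.J x) (f y) +
      P.metric (f x) (P.J y) - P.metric x (f (P.J y)) = 0 := by
  have e1 := hc x y
  have e2 := hc (P.J x) (P.J y)
  rw [P.metric_J_left (f _)] at e1 e2
  simp only [P.J_sq, map_neg, LinearMap.neg_apply] at e1 e2 ⊢
  linarith

theorem sym_of_closed (P : PseudoHermitian G) (f f' : G →ₗ[ℝ] G)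
    (hn : ∀ x, -f' (P.J x) + f x + P.J (f (P.J x)) + P.J (f' x) = 0)
    (hc : ∀ x y, P.metric (P.J (f x)) y + P.metric (P.J x) (f y) = 0)
    (hc' : ∀ x y, P.metric (P.J (f' x)) y + P.metric (P.J x) (f' y) = 0) (x y : G) :
    P.metric (f x) (P.J y) + P.metric x (f (P.J y)) +
      P.metric (f' x) y + P.metric x (f' y) = 0 := by
  have e1 := congrArg (fun z => P.metric z (P.J y)) (hn x)
  have e2 := hc (P.J x) (P.J y)
  have e3 := hc' (P.J x) y
  rw [P.metric_J_left (f _)] at e2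
  rw [P.metric_J_left (f' _)] at e3
  simp only [map_add, LinearMap.add_apply, P.metric_J_left (f _), P.metric_J_left (f' _)] at e1
  simp only [P.J_sq, map_neg, LinearMap.neg_apply, map_zero, LinearMap.zero_apply] at e1 e2 e3 ⊢
  linarith

/-- The conditions `IsExtension` say precisely that the semidirect product, with the induced metric
and almost complex structure, is pseudo-Kähler. -/
theorem isExtension_iff [FiniteDimensional ℝ G] (P : PseudoKahler G) (Q : PseudoKahler H)
    (φ : H →ₗ⁅ℝ⁆ LieDerivation ℝ G G) :
    IsExtension P Q φ ↔
      (P.semidirect Q.toPseudoHermitian φ).Integrable ∧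
      (P.semidirect Q.toPseudoHermitian φ).OmegaClosed := by
  rw [semidirect_integrable_iff, semidirect_omegaClosed_iff]
  constructor
  · rintro ⟨hs, ha⟩
    have hs' := fun A => (P.J_symPart_iff _ _).1 (hs A)
    have ha' := fun A => (P.J_antiPart_iff _).1 (ha A)
    exact ⟨fun A x => nijenhuis_of_parts P.toPseudoHermitian (φ A).toLinearMap
        (φ (Q.J A)).toLinearMap (hs' A) (ha' A) (ha' (Q.J A)) x,
      fun A x y => closed_of_parts P.toPseudoHermitian (φ A).toLinearMap
        (φ (Q.J A)).toLinearMap (hs' A) (ha' A) x y⟩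
  · rintro ⟨hn, hc⟩
    exact ⟨fun A => (P.J_symPart_iff _ _).2 (sym_of_closed P.toPseudoHermitian
        (φ A).toLinearMap (φ (Q.J A)).toLinearMap (hn A) (hc A) (hc (Q.J A))),
      fun A => (P.J_antiPart_iff _).2
        (anti_of_closed P.toPseudoHermitian (φ A).toLinearMap (hc A))⟩

end

/-- A pseudo-Kähler extension of `(G, P)` by `(H, Q)`. -/
structure PKExtension {G H : Type*} [LieRing G] [LieAlgebra ℝ G] [FiniteDimensional ℝ G]
    [LieRing H] [LieAlgebra ℝ H] (P : PseudoKahler G) (Q : PseudoKahler H) where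
  φ : H →ₗ⁅ℝ⁆ LieDerivation ℝ G G
  isExtension : IsExtension P Q φ

/-- AW-relatedness of two pseudo-Kähler extensions. -/
def AWRelated {G H G' H' : Type*}
    [LieRing G] [LieAlgebra ℝ G] [FiniteDimensional ℝ G] [LieRing H] [LieAlgebra ℝ H]
    [LieRing G'] [LieAlgebra ℝ G'] [FiniteDimensional ℝ G'] [LieRing H'] [LieAlgebra ℝ H']
    {P : PseudoKahler G} {Q : PseudoKahler H} {P' : PseudoKahler G'} {Q' : PseudoKahler H'}
    (E : PKExtension P Q) (E' : PKExtension P' Q') : Prop :=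
  ∃ (f : PseudoKahlerEquiv P P') (k : PseudoKahlerEquiv Q Q'),
    (∀ A : H, P'.symPart (f.toLinearEquiv.conj (E.φ A).toLinearMap
      - (E'.φ (k.toLieEquiv A)).toLinearMap) = 0) ∧
    (∀ (A : H) (A' : H'), Commute (f.toLinearEquiv.conj (E.φ A).toLinearMap)
      ((E'.φ A').toLinearMap : Module.End ℝ G'))

/-- An extension is trivial if it is AW-related to one with `φ = 0`. -/
def PKExtension.IsTrivial.{u, v} {G : Type u} {H : Type v}
    [LieRing G] [LieAlgebra ℝ G] [FiniteDimensional ℝ G] [LieRing H] [LieAlgebra ℝ H]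
    {P : PseudoKahler G} {Q : PseudoKahler H} (E : PKExtension P Q) : Prop :=
  ∃ (G' : Type u) (_ : LieRing G') (_ : LieAlgebra ℝ G') (_ : FiniteDimensional ℝ G')
    (H' : Type v) (_ : LieRing H') (_ : LieAlgebra ℝ H')
    (P' : PseudoKahler G') (Q' : PseudoKahler H') (E' : PKExtension P' Q'),
    E'.φ = 0 ∧ AWRelated E E'

/-! ## Lie algebras and pseudo-Kähler structures in coordinates -/

/-- A Lie bracket on `ℝⁿ`. -/
structure LieModel (n : ℕ) where
  br : (Fin n → ℝ) → (Fin n → ℝ) → (Fin n → ℝ)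
  add_br : ∀ x y z, br (x + y) z = br x z + br y z
  br_add : ∀ x y z, br x (y + z) = br x y + br x z
  br_smul : ∀ (t : ℝ) x y, br x (t • y) = t • br x y
  br_self : ∀ x, br x x = 0
  jacobi : ∀ x y z, br x (br y z) = br (br x y) z + br y (br x z)

namespace LieModel

/-- The vector space `ℝⁿ` regarded as a Lie algebra with the given bracket. -/
def Alg {n : ℕ} (_ : LieModel n) : Type := Fin n → ℝ

section

variable {n : ℕ} (m : LieModel n)

instance : AddCommGroup m.Alg := inferInstanceAs (AddCommGroup (Fin n → ℝ))

instance : Module ℝ m.Alg := inferInstanceAs (Module ℝ (Fin n → ℝ))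

instance : FiniteDimensional ℝ m.Alg := inferInstanceAs (FiniteDimensional ℝ (Fin n → ℝ))

instance : LieRing m.Alg where
  bracket := m.br
  add_lie := m.add_br
  lie_add := m.br_add
  lie_self := m.br_self
  leibniz_lie := m.jacobi

instance : LieAlgebra ℝ m.Alg where
  lie_smul := m.br_smul

/-- The vector with the given coordinates. -/
def vec : (Fin n → ℝ) ≃ₗ[ℝ] m.Alg := LinearEquiv.refl ℝ (Fin n → ℝ)

/-- The endomorphism with the given matrix (acting on columns) in the standard basis. -/
def lin (M : Matrix (Fin n) (Fin n) ℝ) : m.Alg →ₗ[ℝ] m.Alg := m.vec.conj (Matrix.toLin' M)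

/-- The bilinear form with the given matrix in the standard basis. -/
def form (M : Matrix (Fin n) (Fin n) ℝ) : LinearMap.BilinForm ℝ m.Alg :=
  LinearMap.BilinForm.congr m.vec (Matrix.toBilin' M)

theorem lin_vec (M : Matrix (Fin n) (Fin n) ℝ) (x : Fin n → ℝ) :
    m.lin M (m.vec x) = m.vec (M.mulVec x) := rfl

theorem form_vec (M : Matrix (Fin n) (Fin n) ℝ) (x y : Fin n → ℝ) :
    m.form M (m.vec x) (m.vec y) = x ⬝ᵥ M.mulVec y :=
  Matrix.toBilin'_apply' M x y

theorem lie_vec (x y : Fin n → ℝ) : ⁅m.vec x, m.vec y⁆ = m.vec (m.br x y) := rfl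

/-- The pseudo-Kähler structure with the given matrices `g` and `J` in the standard basis; `g'` is
the inverse of `g`. -/
def pseudoKahler (g g' J : Matrix (Fin n) (Fin n) ℝ)
    (hsymm : ∀ x y, x ⬝ᵥ g.mulVec y = y ⬝ᵥ g.mulVec x)
    (hinv : ∀ x, g'.mulVec (g.mulVec x) = x)
    (hJ : ∀ x, J.mulVec (J.mulVec x) = -x)
    (hgJ : ∀ x y, J.mulVec x ⬝ᵥ g.mulVec (J.mulVec y) = x ⬝ᵥ g.mulVec y)
    (hN : ∀ x y, m.br (J.mulVec x) (J.mulVec y) - m.br x y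
      - J.mulVec (m.br (J.mulVec x) y + m.br x (J.mulVec y)) = 0)
    (hω : ∀ x y z, J.mulVec (m.br x y) ⬝ᵥ g.mulVec z + J.mulVec (m.br y z) ⬝ᵥ g.mulVec x
      + J.mulVec (m.br z x) ⬝ᵥ g.mulVec y = 0) : PseudoKahler m.Alg where
  metric := m.form g
  symm := ⟨fun x y => by
    obtain ⟨x, rfl⟩ := m.vec.surjective x
    obtain ⟨y, rfl⟩ := m.vec.surjective y
    rw [form_vec, form_vec, hsymm]⟩
  nondeg := by
    have key : ∀ y : m.Alg, (∀ x, m.form g x y = 0) → y = 0 := by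
      intro y hy
      obtain ⟨y, rfl⟩ := m.vec.surjective y
      have h0 : g.mulVec y = 0 := dotProduct_eq_zero _ fun x => by
        rw [dotProduct_comm, ← form_vec, hy]
      rw [← hinv y, h0, Matrix.mulVec_zero, map_zero]
    refine ⟨fun y hy => key y fun x => ?_, key⟩
    rw [← hy x]
    obtain ⟨x, rfl⟩ := m.vec.surjective x
    obtain ⟨y, rfl⟩ := m.vec.surjective y
    rw [form_vec, form_vec, hsymm]
  J := m.lin J
  J_sq x := by
    obtain ⟨x, rfl⟩ := m.vec.surjective x
    rw [lin_vec, lin_vec, hJ, map_neg]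
  compat x y := by
    obtain ⟨x, rfl⟩ := m.vec.surjective x
    obtain ⟨y, rfl⟩ := m.vec.surjective y
    rw [lin_vec, lin_vec, form_vec, form_vec, hgJ]
  integrable x y := by
    obtain ⟨x, rfl⟩ := m.vec.surjective x
    obtain ⟨y, rfl⟩ := m.vec.surjective y
    simp only [lin_vec, lie_vec, ← map_add, ← map_sub, hN, map_zero]
  closed x y z := by
    obtain ⟨x, rfl⟩ := m.vec.surjective x
    obtain ⟨y, rfl⟩ := m.vec.surjective y
    obtain ⟨z, rfl⟩ := m.vec.surjective z
    simpa only [PseudoHermitian.omega, lie_vec, lin_vec, form_vec] using hω x y z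

/-- The derivation with the given matrix in the standard basis. -/
def der (M : Matrix (Fin n) (Fin n) ℝ)
    (h : ∀ x y, M.mulVec (m.br x y) = m.br x (M.mulVec y) - m.br y (M.mulVec x)) :
    LieDerivation ℝ m.Alg m.Alg where
  toLinearMap := m.lin M
  leibniz' x y := by
    obtain ⟨x, rfl⟩ := m.vec.surjective x
    obtain ⟨y, rfl⟩ := m.vec.surjective y
    simp only [lin_vec, lie_vec, ← map_sub, h]

end

end LieModel

theorem mulVec_four (a₀ a₁ a₂ a₃ b₀ b₁ b₂ b₃ c₀ c₁ c₂ c₃ d₀ d₁ d₂ d₃ x₀ x₁ x₂ x₃ : ℝ) :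
    Matrix.mulVec !![a₀, a₁, a₂, a₃; b₀, b₁, b₂, b₃; c₀, c₁, c₂, c₃; d₀, d₁, d₂, d₃]
      ![x₀, x₁, x₂, x₃] =
    ![a₀ * x₀ + a₁ * x₁ + a₂ * x₂ + a₃ * x₃, b₀ * x₀ + b₁ * x₁ + b₂ * x₂ + b₃ * x₃,
      c₀ * x₀ + c₁ * x₁ + c₂ * x₂ + c₃ * x₃, d₀ * x₀ + d₁ * x₁ + d₂ * x₂ + d₃ * x₃] := by
  ext i; fin_cases i <;> simp [Matrix.mulVec, add_assoc]

theorem dotProduct_four (x₀ x₁ x₂ x₃ y₀ y₁ y₂ y₃ : ℝ) :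
    ![x₀, x₁, x₂, x₃] ⬝ᵥ ![y₀, y₁, y₂, y₃] = x₀ * y₀ + x₁ * y₁ + x₂ * y₂ + x₃ * y₃ := by
  simp [add_assoc]

theorem add_four (x₀ x₁ x₂ x₃ y₀ y₁ y₂ y₃ : ℝ) :
    ![x₀, x₁, x₂, x₃] + ![y₀, y₁, y₂, y₃] = ![x₀ + y₀, x₁ + y₁, x₂ + y₂, x₃ + y₃] := by
  simp

theorem sub_four (x₀ x₁ x₂ x₃ y₀ y₁ y₂ y₃ : ℝ) :
    ![x₀, x₁, x₂, x₃] - ![y₀, y₁, y₂, y₃] = ![x₀ - y₀, x₁ - y₁, x₂ - y₂, x₃ - y₃] := by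
  simp

theorem neg_four (x₀ x₁ x₂ x₃ : ℝ) : -![x₀, x₁, x₂, x₃] = ![-x₀, -x₁, -x₂, -x₃] := by
  simp

theorem smul_four (t x₀ x₁ x₂ x₃ : ℝ) :
    t • ![x₀, x₁, x₂, x₃] = ![t * x₀, t * x₁, t * x₂, t * x₃] := by
  simp

theorem ext_four {x₀ x₁ x₂ x₃ y₀ y₁ y₂ y₃ : ℝ} (h₀ : x₀ = y₀) (h₁ : x₁ = y₁) (h₂ : x₂ = y₂)
    (h₃ : x₃ = y₃) : ![x₀, x₁, x₂, x₃] = ![y₀, y₁, y₂, y₃] := by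
  rw [h₀, h₁, h₂, h₃]

theorem zero_four : (0 : Fin 4 → ℝ) = ![0, 0, 0, 0] := by
  ext i; fin_cases i <;> simp

theorem forall_four {p : (Fin 4 → ℝ) → Prop} (h : ∀ a b c d, p ![a, b, c, d]) (x : Fin 4 → ℝ) :
    p x := by
  have e : x = ![x 0, x 1, x 2, x 3] := by ext i; fin_cases i <;> simp
  rw [e]
  exact h _ _ _ _

/-! ## The Lie algebras in the classification -/

/-- The abelian Lie algebra `ℝⁿ`. -/
def abelian (n : ℕ) : LieModel n where
  br _ _ := 0
  add_br _ _ _ := (add_zero 0).symm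
  br_add _ _ _ := (add_zero 0).symm
  br_smul _ _ _ := (smul_zero _).symm
  br_self _ := rfl
  jacobi _ _ _ := (add_zero 0).symm

/-- The Lie algebra `rh₃`, with non-zero bracket `[e₁, e₂] = e₃`. -/
def rh3 : LieModel 4 where
  br x y := ![0, 0, x 0 * y 1 - x 1 * y 0, 0]
  add_br x y z := by ext i; fin_cases i <;> simp <;> ring
  br_add x y z := by ext i; fin_cases i <;> simp <;> ring
  br_smul t x y := by ext i; fin_cases i <;> simp <;> ring
  br_self x := by ext i; fin_cases i <;> simp <;> ring
  jacobi x y z := by ext i; fin_cases i <;> simp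

/-- The Lie algebra `r'₂`, with non-zero brackets
`[e₁, e₃] = e₃`, `[e₁, e₄] = e₄`, `[e₂, e₃] = e₄`, `[e₂, e₄] = -e₃`. -/
def rp2 : LieModel 4 where
  br x y := ![0, 0, (x 0 * y 2 - x 2 * y 0) - (x 1 * y 3 - x 3 * y 1),
    (x 0 * y 3 - x 3 * y 0) + (x 1 * y 2 - x 2 * y 1)]
  add_br x y z := by ext i; fin_cases i <;> simp <;> ring
  br_add x y z := by ext i; fin_cases i <;> simp <;> ring
  br_smul t x y := by ext i; fin_cases i <;> simp <;> ring
  br_self x := by ext i; fin_cases i <;> simp <;> ring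
  jacobi x y z := by ext i; fin_cases i <;> simp <;> ring

theorem rh3_br (x₀ x₁ x₂ x₃ y₀ y₁ y₂ y₃ : ℝ) : rh3.br ![x₀, x₁, x₂, x₃] ![y₀, y₁, y₂, y₃] =
    ![0, 0, x₀ * y₁ - x₁ * y₀, 0] := rfl

theorem rp2_br (x₀ x₁ x₂ x₃ y₀ y₁ y₂ y₃ : ℝ) : rp2.br ![x₀, x₁, x₂, x₃] ![y₀, y₁, y₂, y₃] =
    ![0, 0, (x₀ * y₂ - x₂ * y₀) - (x₁ * y₃ - x₃ * y₁),
      (x₀ * y₃ - x₃ * y₀) + (x₁ * y₂ - x₂ * y₁)] := rfl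

/-- The Kähler structure `J a₁ = a₂`, `h = a¹ ⊗ a¹ + a² ⊗ a²` on `ℝ²`. -/
def planeKahler : PseudoKahler (abelian 2).Alg :=
  (abelian 2).pseudoKahler 1 1 !![0, -1; 1, 0]
    (fun x y => by simp [dotProduct_comm x y]) (fun x => by simp)
    (fun x => by ext i; fin_cases i <;> simp [dotProduct])
    (fun x y => by simp [dotProduct]; ring)
    (fun _ _ => by simp [abelian]) (fun _ _ _ => by simp [abelian])

/-- The neutral structure `g = e¹ ⊗ e¹ - e² ⊗ e² + e³ ⊗ e³ - e⁴ ⊗ e⁴`, `J e₁ = e₃`, `J e₂ = e₄`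
on `ℝ⁴`. -/
def r4Kahler : PseudoKahler (abelian 4).Alg :=
  (abelian 4).pseudoKahler
    !![1, 0, 0, 0; 0, -1, 0, 0; 0, 0, 1, 0; 0, 0, 0, -1]
    !![1, 0, 0, 0; 0, -1, 0, 0; 0, 0, 1, 0; 0, 0, 0, -1]
    !![0, 0, -1, 0; 0, 0, 0, -1; 1, 0, 0, 0; 0, 1, 0, 0]
    (forall_four fun _ _ _ _ => forall_four fun _ _ _ _ => by
      simp only [mulVec_four, dotProduct_four]
      ring)
    (forall_four fun _ _ _ _ => by
      simp only [mulVec_four]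
      apply ext_four <;> ring)
    (forall_four fun _ _ _ _ => by
      simp only [mulVec_four, neg_four]
      apply ext_four <;> ring)
    (forall_four fun _ _ _ _ => forall_four fun _ _ _ _ => by
      simp only [mulVec_four, dotProduct_four]
      ring)
    (fun _ _ => by simp [abelian]) (fun _ _ _ => by simp [abelian])

/-- The structure `g = e¹ ⊙ e³ + e² ⊙ e⁴` (with `eⁱ ⊙ eʲ = eⁱ ⊗ eʲ + eʲ ⊗ eⁱ`), `J e₁ = e₂`,
`J e₃ = e₄` on `rh₃`. -/
def rh3Kahler : PseudoKahler rh3.Alg :=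
  rh3.pseudoKahler
    !![0, 0, 1, 0; 0, 0, 0, 1; 1, 0, 0, 0; 0, 1, 0, 0]
    !![0, 0, 1, 0; 0, 0, 0, 1; 1, 0, 0, 0; 0, 1, 0, 0]
    !![0, -1, 0, 0; 1, 0, 0, 0; 0, 0, 0, -1; 0, 0, 1, 0]
    (forall_four fun _ _ _ _ => forall_four fun _ _ _ _ => by
      simp only [mulVec_four, dotProduct_four]
      ring)
    (forall_four fun _ _ _ _ => by
      simp only [mulVec_four]
      apply ext_four <;> ring)
    (forall_four fun _ _ _ _ => by
      simp only [mulVec_four, neg_four]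
      apply ext_four <;> ring)
    (forall_four fun _ _ _ _ => forall_four fun _ _ _ _ => by
      simp only [mulVec_four, dotProduct_four]
      ring)
    (forall_four fun _ _ _ _ => forall_four fun _ _ _ _ => by
      simp only [mulVec_four, rh3_br, add_four, sub_four, zero_four]
      apply ext_four <;> ring)
    (forall_four fun _ _ _ _ => forall_four fun _ _ _ _ => forall_four fun _ _ _ _ => by
      simp only [mulVec_four, rh3_br, dotProduct_four]
      ring)

/-- The structures on `r'₂` depending on parameters `(p, q, r)` with `q² + r² ≠ 0`. -/
def rp2Kahler (p q r : ℝ) (h : q ^ 2 + r ^ 2 ≠ 0) : PseudoKahler rp2.Alg :=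
  rp2.pseudoKahler
    !![p, 0, -r, q; 0, p, q, r; -r, q, 0, 0; q, r, 0, 0]
    ((q ^ 2 + r ^ 2)⁻¹ • !![0, 0, -r, q; 0, 0, q, r; -r, q, -p, 0; q, r, 0, -p])
    !![0, 1, 0, 0; -1, 0, 0, 0; 0, 0, 0, -1; 0, 0, 1, 0]
    (forall_four fun _ _ _ _ => forall_four fun _ _ _ _ => by
      simp only [mulVec_four, dotProduct_four]
      ring)
    (forall_four fun _ _ _ _ => by
      rw [Matrix.smul_mulVec, inv_smul_eq_iff₀ h]
      simp only [mulVec_four, smul_four]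
      apply ext_four <;> ring)
    (forall_four fun _ _ _ _ => by
      simp only [mulVec_four, neg_four]
      apply ext_four <;> ring)
    (forall_four fun _ _ _ _ => forall_four fun _ _ _ _ => by
      simp only [mulVec_four, dotProduct_four]
      ring)
    (forall_four fun _ _ _ _ => forall_four fun _ _ _ _ => by
      simp only [mulVec_four, rp2_br, add_four, sub_four, zero_four]
      apply ext_four <;> ring)
    (forall_four fun _ _ _ _ => forall_four fun _ _ _ _ => forall_four fun _ _ _ _ => by
      simp only [mulVec_four, rp2_br, dotProduct_four]
      ring)

/-! ## The extensions in the classification -/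

section

variable {G : Type*} [LieRing G] [LieAlgebra ℝ G]

/-- The representation of `ℝ²` with `φ(a₁) = D₁`, `φ(a₂) = D₂`, for commuting derivations. -/
def pairHom (D₁ D₂ : LieDerivation ℝ G G) (hc : ⁅D₁, D₂⁆ = 0) :
    (abelian 2).Alg →ₗ⁅ℝ⁆ LieDerivation ℝ G G where
  toFun v := (abelian 2).vec.symm v 0 • D₁ + (abelian 2).vec.symm v 1 • D₂
  map_add' v w := by simp only [map_add, Pi.add_apply]; module
  map_smul' t v := by simp only [map_smul, Pi.smul_apply, smul_eq_mul, RingHom.id_apply]; module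
  map_lie' {v w} := by
    have h0 : ⁅v, w⁆ = 0 := rfl
    have hc' : ⁅D₂, D₁⁆ = 0 := by rw [← lie_skew, hc, neg_zero]
    simp [h0, hc, hc']

theorem pairHom_vec (D₁ D₂ : LieDerivation ℝ G G) (hc : ⁅D₁, D₂⁆ = 0) (v : Fin 2 → ℝ) :
    pairHom D₁ D₂ hc ((abelian 2).vec v) = v 0 • D₁ + v 1 • D₂ := rfl

/-- The pseudo-Kähler extension by the Kähler plane with `φ(a₁) = D₁`, `φ(a₂) = D₂`. -/
def pairExtension [FiniteDimensional ℝ G] (P : PseudoKahler G) (D₁ D₂ : LieDerivation ℝ G G)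
    (hc : ⁅D₁, D₂⁆ = 0)
    (hs : P.J ∘ₗ P.symPart D₁.toLinearMap = P.symPart D₂.toLinearMap)
    (h₁ : P.J ∘ₗ P.antiPart D₁.toLinearMap = P.antiPart D₁.toLinearMap ∘ₗ P.J)
    (h₂ : P.J ∘ₗ P.antiPart D₂.toLinearMap = P.antiPart D₂.toLinearMap ∘ₗ P.J) :
    PKExtension P planeKahler where
  φ := pairHom D₁ D₂ hc
  isExtension := by
    rw [PseudoHermitian.J_symPart_iff] at hs
    rw [PseudoHermitian.J_antiPart_iff] at h₁ h₂
    simp only [LieDerivation.coeFn_coe] at hs h₁ h₂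
    constructor
    · intro A
      obtain ⟨v, rfl⟩ := (abelian 2).vec.surjective A
      have hJ : planeKahler.J ((abelian 2).vec v) = (abelian 2).vec ![-v 1, v 0] := by
        change (abelian 2).lin !![0, -1; 1, 0] ((abelian 2).vec v) = _
        rw [LieModel.lin_vec]
        congr 1
        ext i
        fin_cases i <;> simp [Matrix.mulVec, dotProduct]
      rw [hJ, pairHom_vec, pairHom_vec, PseudoHermitian.J_symPart_iff]
      intro x y
      have e1 := hs x y
      have e2 := hs x (P.J y)
      simp only [P.J_sq, map_neg] at e2
      simp only [LieDerivation.coeFn_coe, LieDerivation.add_apply, LieDerivation.smul_apply,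
        map_add, map_smul, LinearMap.add_apply, LinearMap.smul_apply, smul_eq_mul,
        Matrix.cons_val_zero, Matrix.cons_val_one]
      linear_combination v 0 * e1 + v 1 * e2
    · intro A
      obtain ⟨v, rfl⟩ := (abelian 2).vec.surjective A
      rw [pairHom_vec, PseudoHermitian.J_antiPart_iff]
      intro x y
      simp only [LieDerivation.coeFn_coe, LieDerivation.add_apply, LieDerivation.smul_apply,
        map_add, map_smul, LinearMap.add_apply, LinearMap.smul_apply, smul_eq_mul]
      linear_combination v 0 * h₁ x y + v 1 * h₂ x y

end

/-- The pseudo-Kähler extension by the Kähler plane where `φ(a₁)`, `φ(a₂)` have matrices `M₁`,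
`M₂` in the standard basis; `g` and `J` are the matrices of the pseudo-Kähler structure. -/
def LieModel.extension {n : ℕ} (m : LieModel n) (P : PseudoKahler m.Alg)
    (g J M₁ M₂ : Matrix (Fin n) (Fin n) ℝ) (hg : P.metric = m.form g) (hJ : P.J = m.lin J)
    (hd₁ : ∀ x y, M₁.mulVec (m.br x y) = m.br x (M₁.mulVec y) - m.br y (M₁.mulVec x))
    (hd₂ : ∀ x y, M₂.mulVec (m.br x y) = m.br x (M₂.mulVec y) - m.br y (M₂.mulVec x))
    (hc : ∀ x, M₁.mulVec (M₂.mulVec x) = M₂.mulVec (M₁.mulVec x))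
    (hs : ∀ x y, M₁.mulVec x ⬝ᵥ g.mulVec (J.mulVec y) + x ⬝ᵥ g.mulVec (M₁.mulVec (J.mulVec y))
      + M₂.mulVec x ⬝ᵥ g.mulVec y + x ⬝ᵥ g.mulVec (M₂.mulVec y) = 0)
    (h₁ : ∀ x y, M₁.mulVec (J.mulVec x) ⬝ᵥ g.mulVec y - J.mulVec x ⬝ᵥ g.mulVec (M₁.mulVec y)
      + M₁.mulVec x ⬝ᵥ g.mulVec (J.mulVec y) - x ⬝ᵥ g.mulVec (M₁.mulVec (J.mulVec y)) = 0)
    (h₂ : ∀ x y, M₂.mulVec (J.mulVec x) ⬝ᵥ g.mulVec y - J.mulVec x ⬝ᵥ g.mulVec (M₂.mulVec y)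
      + M₂.mulVec x ⬝ᵥ g.mulVec (J.mulVec y) - x ⬝ᵥ g.mulVec (M₂.mulVec (J.mulVec y)) = 0) :
    PKExtension P planeKahler :=
  pairExtension P (m.der M₁ hd₁) (m.der M₂ hd₂)
    (by
      ext x
      rw [LieDerivation.lie_apply, LieDerivation.zero_apply]
      obtain ⟨x, rfl⟩ := m.vec.surjective x
      change m.lin M₁ (m.lin M₂ _) - m.lin M₂ (m.lin M₁ _) = 0
      simp only [lin_vec, hc x, sub_self])
    (by
      rw [PseudoHermitian.J_symPart_iff, hg, hJ]
      intro x y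
      obtain ⟨x, rfl⟩ := m.vec.surjective x
      obtain ⟨y, rfl⟩ := m.vec.surjective y
      change m.form g (m.lin M₁ _) _ + m.form g _ (m.lin M₁ _) + m.form g (m.lin M₂ _) _
        + m.form g _ (m.lin M₂ _) = 0
      simpa only [lin_vec, form_vec] using hs x y)
    (by
      rw [PseudoHermitian.J_antiPart_iff, hg, hJ]
      intro x y
      obtain ⟨x, rfl⟩ := m.vec.surjective x
      obtain ⟨y, rfl⟩ := m.vec.surjective y
      change m.form g (m.lin M₁ _) _ - m.form g _ (m.lin M₁ _) + m.form g (m.lin M₁ _) _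
        - m.form g _ (m.lin M₁ _) = 0
      simpa only [lin_vec, form_vec] using h₁ x y)
    (by
      rw [PseudoHermitian.J_antiPart_iff, hg, hJ]
      intro x y
      obtain ⟨x, rfl⟩ := m.vec.surjective x
      obtain ⟨y, rfl⟩ := m.vec.surjective y
      change m.form g (m.lin M₂ _) _ - m.form g _ (m.lin M₂ _) + m.form g (m.lin M₂ _) _
        - m.form g _ (m.lin M₂ _) = 0
      simpa only [lin_vec, form_vec] using h₂ x y)

/-- The first family of extensions of `ℝ⁴`. -/
def r4Semisimple (a : ℝ) : PKExtension r4Kahler planeKahler :=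
  (abelian 4).extension r4Kahler
    !![1, 0, 0, 0; 0, -1, 0, 0; 0, 0, 1, 0; 0, 0, 0, -1]
    !![0, 0, -1, 0; 0, 0, 0, -1; 1, 0, 0, 0; 0, 1, 0, 0]
    !![a, 2 * a, -a, 0; 0, a, 0, a; a, 0, -a, 0; 0, -a, 2 * a, -a]
    !![0, a, 2 * a, a; a, 0, -a, 0; 0, a, 0, a; -a, 2 * a, a, 0]
    rfl rfl (fun _ _ => by simp [abelian]) (fun _ _ => by simp [abelian])
    (forall_four fun _ _ _ _ => by
      simp only [mulVec_four]
      apply ext_four <;> ring)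
    (forall_four fun _ _ _ _ => forall_four fun _ _ _ _ => by
      simp only [mulVec_four, dotProduct_four]
      ring)
    (forall_four fun _ _ _ _ => forall_four fun _ _ _ _ => by
      simp only [mulVec_four, dotProduct_four]
      ring)
    (forall_four fun _ _ _ _ => forall_four fun _ _ _ _ => by
      simp only [mulVec_four, dotProduct_four]
      ring)

/-- The second family of extensions of `ℝ⁴`. -/
def r4NonSemisimple (a b c : ℝ) : PKExtension r4Kahler planeKahler :=
  (abelian 4).extension r4Kahler
    !![1, 0, 0, 0; 0, -1, 0, 0; 0, 0, 1, 0; 0, 0, 0, -1]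
    !![0, 0, -1, 0; 0, 0, 0, -1; 1, 0, 0, 0; 0, 1, 0, 0]
    !![a, -a + c, -b, b; a + c, -a, -b, b; b, -b, -a, a + c; b, -b, -a + c, a]
    !![0, 0, a - c, -a; 0, 0, a, -a - c; a + c, -a, 0, 0; a, -a + c, 0, 0]
    rfl rfl (fun _ _ => by simp [abelian]) (fun _ _ => by simp [abelian])
    (forall_four fun _ _ _ _ => by
      simp only [mulVec_four]
      apply ext_four <;> ring)
    (forall_four fun _ _ _ _ => forall_four fun _ _ _ _ => by
      simp only [mulVec_four, dotProduct_four]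
      ring)
    (forall_four fun _ _ _ _ => forall_four fun _ _ _ _ => by
      simp only [mulVec_four, dotProduct_four]
      ring)
    (forall_four fun _ _ _ _ => forall_four fun _ _ _ _ => by
      simp only [mulVec_four, dotProduct_four]
      ring)

/-- The family of extensions of `rh₃`. -/
def rh3Extension (a : ℝ) : PKExtension rh3Kahler planeKahler :=
  rh3.extension rh3Kahler
    !![0, 0, 1, 0; 0, 0, 0, 1; 1, 0, 0, 0; 0, 1, 0, 0]
    !![0, -1, 0, 0; 1, 0, 0, 0; 0, 0, 0, -1; 0, 0, 1, 0]
    !![0, 0, 0, 0; 0, 0, 0, 0; a, 0, 0, 0; 0, -a, 0, 0]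
    !![0, 0, 0, 0; 0, 0, 0, 0; 0, a, 0, 0; a, 0, 0, 0]
    rfl rfl
    (forall_four fun _ _ _ _ => forall_four fun _ _ _ _ => by
      simp only [mulVec_four, rh3_br, sub_four]
      apply ext_four <;> ring)
    (forall_four fun _ _ _ _ => forall_four fun _ _ _ _ => by
      simp only [mulVec_four, rh3_br, sub_four]
      apply ext_four <;> ring)
    (forall_four fun _ _ _ _ => by
      simp only [mulVec_four]
      apply ext_four <;> ring)
    (forall_four fun _ _ _ _ => forall_four fun _ _ _ _ => by
      simp only [mulVec_four, dotProduct_four]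
      ring)
    (forall_four fun _ _ _ _ => forall_four fun _ _ _ _ => by
      simp only [mulVec_four, dotProduct_four]
      ring)
    (forall_four fun _ _ _ _ => forall_four fun _ _ _ _ => by
      simp only [mulVec_four, dotProduct_four]
      ring)

/-- The family of extensions of `r'₂` with its structure of parameters `(p, q, r)`. -/
def rp2Extension (p q r : ℝ) (h : q ^ 2 + r ^ 2 ≠ 0) (a : ℝ) :
    PKExtension (rp2Kahler p q r h) planeKahler :=
  rp2.extension (rp2Kahler p q r h)
    !![p, 0, -r, q; 0, p, q, r; -r, q, 0, 0; q, r, 0, 0]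
    !![0, 1, 0, 0; -1, 0, 0, 0; 0, 0, 0, -1; 0, 0, 1, 0]
    !![0, 0, 0, 0; 0, 0, 0, 0; a, 0, 0, 0; 0, a, 0, 0]
    !![0, 0, 0, 0; 0, 0, 0, 0; 0, -a, 0, 0; a, 0, 0, 0]
    rfl rfl
    (forall_four fun _ _ _ _ => forall_four fun _ _ _ _ => by
      simp only [mulVec_four, rp2_br, sub_four]
      apply ext_four <;> ring)
    (forall_four fun _ _ _ _ => forall_four fun _ _ _ _ => by
      simp only [mulVec_four, rp2_br, sub_four]
      apply ext_four <;> ring)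
    (forall_four fun _ _ _ _ => by
      simp only [mulVec_four]
      apply ext_four <;> ring)
    (forall_four fun _ _ _ _ => forall_four fun _ _ _ _ => by
      simp only [mulVec_four, dotProduct_four]
      ring)
    (forall_four fun _ _ _ _ => forall_four fun _ _ _ _ => by
      simp only [mulVec_four, dotProduct_four]
      ring)
    (forall_four fun _ _ _ _ => forall_four fun _ _ _ _ => by
      simp only [mulVec_four, dotProduct_four]
      ring)

end PK

end

open PK

/-!
Let `a ∈ H` be a unit vector, `S` the symmetric part of `φ a`, and `A`, `B` the antisymmetric parts
of `φ a` and `φ (J a)`. Since `J S` is the symmetric part of `φ (J a)`, the map `S` is antilinear,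
`A` and `B` are complex linear, and commutativity of `φ` reads `[A, B] = 2 J S²`,
`[B, S] = J [A, S]`. Hence `S²` is complex linear with vanishing trace and, as `G` is a complex
plane, its square is a scalar. When `S ≠ 0` this yields a vector with `S² u = κ J u`, which is
isotropic, and hence a hyperbolic pair `v, w` with `S w = v` and `S v = κ J w`; the operators `A`
and `B` are then determined by few real parameters, which a rotation of `a` in `H` and a rotation
of the pair reduce further. If `κ ≠ 0`, or if `κ = 0` and `A`, `B` are not both nilpotent, then `G`
has too many derivations to be anything but abelian. In the remaining case the derivation property
leaves a four-parameter family of brackets, comprising the abelian algebra, `rh₃` and `r'₂`.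
-/

noncomputable section

namespace PK

/-! ## Antilinear maps on a complex plane -/

section Traceless

variable {K V : Type*} [Field K] [AddCommGroup V] [Module K V]

theorem mul_self_eq_neg_det_smul_one (hV : Module.finrank K V = 2) {T : Module.End K V}
    (hT : LinearMap.trace K V T = 0) : T * T = -LinearMap.det T • 1 := by
  have : FiniteDimensional K V := FiniteDimensional.of_finrank_pos (by omega)
  let b := Module.finBasisOfFinrankEq K V hV
  have hcharpoly := T.aeval_self_charpoly
  rw [← T.charpoly_toMatrix b, Matrix.charpoly_fin_two, ← LinearMap.trace_eq_matrix_trace, hT,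
    LinearMap.det_toMatrix] at hcharpoly
  simp only [map_zero, zero_mul, sub_zero, map_add, map_pow, Polynomial.aeval_X,
    Polynomial.aeval_C, Algebra.algebraMap_eq_smul_one] at hcharpoly
  rw [neg_smul, ← sq, eq_neg_of_add_eq_zero_left hcharpoly]

theorem hasEigenvalue_of_mul_self_eq_of_trace_eq_zero [CharZero K] [FiniteDimensional K V]
    [Nontrivial V] {T : Module.End K V} (hT : LinearMap.trace K V T = 0) {μ : K} (hμ : μ ≠ 0)
    (hsq : T * T = (μ * μ) • 1) : T.HasEigenvalue μ := by
  obtain ⟨x, hx⟩ : ∃ x, T x + μ • x ≠ 0 := by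
    by_contra! hneg
    have hscalar : T = -μ • (1 : Module.End K V) :=
      LinearMap.ext fun x => by simpa using eq_neg_of_add_eq_zero_left (hneg x)
    rw [hscalar, map_smul, LinearMap.trace_one, smul_eq_mul] at hT
    exact mul_ne_zero (neg_ne_zero.2 hμ) (Nat.cast_ne_zero.2 Module.finrank_pos.ne') hT
  refine Module.End.hasEigenvalue_of_hasEigenvector (x := T x + μ • x)
    ⟨Module.End.mem_eigenspace_iff.2 ?_, hx⟩
  have hsq_x : T (T x) = (μ * μ) • x := LinearMap.congr_fun hsq x
  rw [map_add, map_smul, hsq_x]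
  module

theorem exists_eq_smul_add_smul_of_linearIndependent (hV : Module.finrank K V = 2) {u v : V}
    (huv : LinearIndependent K ![u, v]) (x : V) : ∃ a b : K, x = a • u + b • v := by
  have : FiniteDimensional K V := FiniteDimensional.of_finrank_pos (by omega)
  have hspan := huv.span_eq_top_of_card_eq_finrank' (by simp [hV])
  rw [Matrix.range_cons_cons_empty] at hspan
  obtain ⟨a, b, h⟩ := Submodule.mem_span_pair.1 (hspan ▸ Submodule.mem_top : x ∈ _)
  exact ⟨a, b, h.symm⟩

end Traceless

section Antilinear

variable {E : Type*} [AddCommGroup E] [Module ℂ E] (S : E →ₛₗ[starRingEnd ℂ] E)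

open Complex
open scoped ComplexOrder

theorem linearIndependent_antilinear {u : E} {μ : ℂ} (hμ : ¬0 < μ) (hSu : S u ≠ 0)
    (hSSu : S (S u) = μ • u) : LinearIndependent ℂ ![u, S u] := by
  have hu : u ≠ 0 := fun h => hSu (by rw [h, map_zero])
  refine (LinearIndependent.pair_iff' hu).2 fun l hl => hμ ?_
  have hl0 : l ≠ 0 := fun h => hSu (by rw [← hl, h, zero_smul])
  have hμl : μ = normSq l := by
    refine smul_left_injective ℂ hu ?_
    simp only
    rw [← hSSu, ← hl, map_smulₛₗ, ← hl, smul_smul, mul_comm, mul_conj]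
  rw [hμl]
  exact zero_lt_real.2 (normSq_pos.2 hl0)

theorem conj_eq_self_of_antilinear_sq_mul_self {c : ℂ} (hS : S ≠ 0)
    (hc : ∀ x, S (S (S (S x))) = c • x) : (starRingEnd ℂ) c = c := by
  obtain ⟨x, hx⟩ := DFunLike.ne_iff.1 hS
  refine smul_left_injective ℂ hx ?_
  simp only
  rw [← map_smulₛₗ, ← hc x, hc]

/-- The spectrum of `S ∘ S` is symmetric about zero because its trace vanishes, whereas a negative
eigenvalue `μ` of `S ∘ S` has the independent eigenvectors `u` and `S u`. -/
theorem not_sq_antilinear_mul_self_pos (hE : Module.finrank ℂ E = 2)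
    (htr : LinearMap.trace ℂ E (S.comp S) = 0) {c : ℝ} (hc0 : 0 < c) :
    (S.comp S : Module.End ℂ E) * S.comp S ≠ (c : ℂ) • 1 := fun hc => by
  have := Module.nontrivial_of_finrank_pos (R := ℂ) (M := E) (by omega)
  have : FiniteDimensional ℂ E := FiniteDimensional.of_finrank_pos (by omega)
  have hμ : -(√c : ℂ) < 0 := neg_lt_zero.2 (zero_lt_real.2 (Real.sqrt_pos.2 hc0))
  have hsq : (c : ℂ) = -(√c : ℂ) * -(√c : ℂ) := by
    rw [neg_mul_neg, ← ofReal_mul, Real.mul_self_sqrt hc0.le]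
  obtain ⟨u, hu⟩ :=
    (hasEigenvalue_of_mul_self_eq_of_trace_eq_zero htr hμ.ne (hsq ▸ hc)).exists_hasEigenvector
  have hSSu : S (S u) = -(√c : ℂ) • u := hu.apply_eq_smul
  have hSu : S u ≠ 0 := fun h => by
    rw [h, map_zero] at hSSu
    exact smul_ne_zero hμ.ne hu.2 hSSu.symm
  have hind := linearIndependent_antilinear S hμ.not_gt hSu hSSu
  have hscalar : (S.comp S : Module.End ℂ E) = -(√c : ℂ) • 1 := LinearMap.ext fun x => by
    obtain ⟨a, b, rfl⟩ := exists_eq_smul_add_smul_of_linearIndependent hE hind x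
    simp only [LinearMap.comp_apply, map_add, map_smulₛₗ, hSSu, map_neg, conj_ofReal,
      RingHom.id_apply, LinearMap.smul_apply, Module.End.one_apply]
  rw [hscalar, map_smul, LinearMap.trace_one, hE, smul_eq_mul] at htr
  exact mul_ne_zero hμ.ne (by norm_num) htr

theorem exists_antilinear_eigenvector (hE : Module.finrank ℂ E = 2) (hS : S ≠ 0)
    (htr : LinearMap.trace ℂ E (S.comp S) = 0) :
    ∃ (u : E) (κ : ℝ), 0 ≤ κ ∧ S u ≠ 0 ∧ S (S u) = (κ * I) • u := by
  have := Module.nontrivial_of_finrank_pos (R := ℂ) (M := E) (by omega)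
  have : FiniteDimensional ℂ E := FiniteDimensional.of_finrank_pos (by omega)
  have hc := mul_self_eq_neg_det_smul_one hE htr
  generalize -LinearMap.det (S.comp S : Module.End ℂ E) = c at hc
  have hS4 : ∀ x, S (S (S (S x))) = c • x := LinearMap.congr_fun hc
  obtain ⟨c, rfl⟩ := conj_eq_iff_real.1 (conj_eq_self_of_antilinear_sq_mul_self S hS hS4)
  rcases lt_trichotomy c 0 with hneg | rfl | hpos
  · have hμ : (√(-c) : ℂ) * I ≠ 0 :=
      mul_ne_zero (ofReal_ne_zero.2 (Real.sqrt_ne_zero'.2 (neg_pos.2 hneg))) I_ne_zero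
    have hsq : (c : ℂ) = √(-c) * I * (√(-c) * I) := by
      rw [mul_mul_mul_comm, I_mul_I, ← ofReal_mul, Real.mul_self_sqrt (neg_pos.2 hneg).le]
      simp
    obtain ⟨u, hu⟩ :=
      (hasEigenvalue_of_mul_self_eq_of_trace_eq_zero htr hμ (hsq ▸ hc)).exists_hasEigenvector
    have hSSu : S (S u) = ((√(-c) : ℝ) * I) • u := hu.apply_eq_smul
    refine ⟨u, √(-c), Real.sqrt_nonneg _, fun h => ?_, hSSu⟩
    rw [h, map_zero] at hSSu
    exact smul_ne_zero hμ hu.2 hSSu.symm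
  · obtain ⟨x, hx⟩ := DFunLike.ne_iff.1 hS
    simp only [ofReal_zero, zero_smul] at hS4 ⊢
    by_cases h2 : S (S x) = 0
    · exact ⟨x, 0, le_rfl, hx, by simpa using h2⟩
    by_cases h3 : S (S (S x)) = 0
    · exact ⟨S x, 0, le_rfl, h2, by simpa using h3⟩
    · exact ⟨S (S x), 0, le_rfl, h3, by simpa using hS4 x⟩
  · exact absurd hc (not_sq_antilinear_mul_self_pos S hE htr hpos)

theorem exists_antilinear_cyclic_vector (hE : Module.finrank ℂ E = 2) (hS : S ≠ 0)
    (htr : LinearMap.trace ℂ E (S.comp S) = 0) :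
    ∃ (u : E) (κ : ℝ), 0 ≤ κ ∧ S u ≠ 0 ∧ S (S u) = (κ * I) • u ∧
      ∀ x, ∃ z z' : ℂ, x = z • u + z' • S u := by
  obtain ⟨u, κ, hκ, hSu, hSSu⟩ := exists_antilinear_eigenvector S hE hS htr
  have hnonpos : ¬0 < (κ * I : ℂ) := fun h => by
    have hre := (pos_iff.1 h).1
    simp at hre
  exact ⟨u, κ, hκ, hSu, hSSu, exists_eq_smul_add_smul_of_linearIndependent hE
    (linearIndependent_antilinear S hnonpos hSu hSSu)⟩

end Antilinear

/-! ## The operators attached to an extension -/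

section PseudoHermitian

variable {G : Type*} [LieRing G] [LieAlgebra ℝ G] (P : PseudoHermitian G)

namespace PseudoHermitian

theorem metric_comm (x y : G) : P.metric x y = P.metric y x := P.symm.eq x y

theorem metric_J_self (x : G) : P.metric x (P.J x) = 0 := by
  have h := P.metric_J_left x x
  rw [P.metric_comm] at h
  linarith

theorem metric_self_J (x : G) : P.metric (P.J x) x = 0 := by
  rw [P.metric_comm, metric_J_self]

theorem eq_zero_of_J_eq_neg {x : G} (h : P.J x = -P.J x) : x = 0 := by
  have := IsAddTorsionFree.of_isTorsionFree ℝ G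
  rw [← neg_eq_zero, ← P.J_sq, self_eq_neg.1 h, map_zero]

theorem self_eq_zero_of_commutes_of_anticommutes {f f' : G → G} (hff' : ∀ x, f x = f' x)
    (hf : ∀ x, f (P.J x) = P.J (f x)) (hf' : ∀ x, f' (P.J x) = -P.J (f' x)) (x : G) : f x = 0 :=
  P.eq_zero_of_J_eq_neg <| (hf x).symm.trans <| (hff' _).trans <| by rw [hf', hff']

/-- The complex vector space structure on `G` in which `i` acts as `J`. It is not an instance, as it
depends on the pseudo-Hermitian structure. -/
abbrev complexModule : Module ℂ G :=
  Module.compHom G (Complex.liftAux (P.J : Module.End ℝ G) (LinearMap.ext P.J_sq)).toRingHom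

theorem complex_smul_eq (z : ℂ) (x : G) :
    letI := P.complexModule
    z • x = z.re • x + z.im • P.J x :=
  LinearMap.congr_fun (Complex.liftAux_apply (P.J : Module.End ℝ G) (LinearMap.ext P.J_sq) z) x

theorem two_mul_finrank_complex :
    letI := P.complexModule
    2 * Module.finrank ℂ G = Module.finrank ℝ G := by
  let := P.complexModule
  have : IsScalarTower ℝ ℂ G := ⟨fun t z x => by
    simp only [P.complex_smul_eq, Complex.smul_re, Complex.smul_im, smul_eq_mul]
    module⟩
  rw [← Complex.finrank_real_complex, Module.finrank_mul_finrank]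

/-- A real endomorphism commuting with `J`, as an endomorphism of the complex vector space `G`. -/
def complexLinear (f : G →ₗ[ℝ] G) (hf : ∀ x, f (P.J x) = P.J (f x)) :
    letI := P.complexModule
    G →ₗ[ℂ] G :=
  letI := P.complexModule
  { toFun := f
    map_add' := map_add f
    map_smul' := fun z x => by
      simp only [P.complex_smul_eq, map_add, map_smul, hf, RingHom.id_apply] }

/-- A real endomorphism anticommuting with `J`, as an antilinear endomorphism of the complex vector
space `G`. -/
def complexAntilinear (f : G →ₗ[ℝ] G) (hf : ∀ x, f (P.J x) = -P.J (f x)) :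
    letI := P.complexModule
    G →ₛₗ[starRingEnd ℂ] G :=
  letI := P.complexModule
  { toFun := f
    map_add' := map_add f
    map_smul' := fun z x => by
      simp only [P.complex_smul_eq, map_add, map_smul, hf, Complex.conj_re, Complex.conj_im,
        smul_neg, neg_smul] }

variable [FiniteDimensional ℝ G]

theorem symPart_add_antiPart (f : G →ₗ[ℝ] G) (x : G) : P.symPart f x + P.antiPart f x = f x := by
  simp only [symPart, antiPart, LinearMap.smul_apply, LinearMap.add_apply, LinearMap.sub_apply]
  module

theorem symPart_add (f f' : G →ₗ[ℝ] G) : P.symPart (f + f') = P.symPart f + P.symPart f' := by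
  refine LinearMap.ext fun x => P.ext_metric fun y => ?_
  simp only [LinearMap.add_apply, map_add, metric_symPart]
  ring

theorem symPart_smul (c : ℝ) (f : G →ₗ[ℝ] G) : P.symPart (c • f) = c • P.symPart f := by
  refine LinearMap.ext fun x => P.ext_metric fun y => ?_
  simp only [LinearMap.smul_apply, map_smul, metric_symPart, smul_eq_mul]
  ring

theorem antiPart_add (f f' : G →ₗ[ℝ] G) : P.antiPart (f + f') = P.antiPart f + P.antiPart f' := by
  refine LinearMap.ext fun x => P.ext_metric fun y => ?_
  simp only [LinearMap.add_apply, map_add, metric_antiPart]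
  ring

theorem antiPart_smul (c : ℝ) (f : G →ₗ[ℝ] G) : P.antiPart (c • f) = c • P.antiPart f := by
  refine LinearMap.ext fun x => P.ext_metric fun y => ?_
  simp only [LinearMap.smul_apply, map_smul, metric_antiPart, smul_eq_mul]
  ring

theorem symPart_eq_zero_iff (f : G →ₗ[ℝ] G) :
    P.symPart f = 0 ↔ ∀ x y, P.metric (f x) y + P.metric x (f y) = 0 := by
  refine ⟨fun h x y => ?_, fun h => LinearMap.ext fun x => P.ext_metric fun y => ?_⟩
  · have hmetric := P.metric_symPart f x y
    rw [h, LinearMap.zero_apply, map_zero, LinearMap.zero_apply] at hmetric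
    linarith
  · rw [metric_symPart, h x y, mul_zero, LinearMap.zero_apply, map_zero, LinearMap.zero_apply]

end PseudoHermitian

/-- The algebraic properties of the symmetric part `S` of `φ(a)` and of the antisymmetric parts
`A`, `B` of `φ(a)`, `φ(J a)`, for a pseudo-Kähler extension `φ` by an abelian Lie algebra. -/
structure IsExtensionTriple (S A B : G →ₗ[ℝ] G) : Prop where
  S_symm : ∀ x y, P.metric (S x) y = P.metric x (S y)
  S_J : ∀ x, S (P.J x) = -P.J (S x)
  A_skew : ∀ x y, P.metric (A x) y = -P.metric x (A y)
  A_J : ∀ x, A (P.J x) = P.J (A x)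
  B_skew : ∀ x y, P.metric (B x) y = -P.metric x (B y)
  B_J : ∀ x, B (P.J x) = P.J (B x)
  lie_A_B : ∀ x, A (B x) - B (A x) = (2 : ℝ) • P.J (S (S x))
  lie_B_S : ∀ x, B (S x) - S (B x) = P.J (A (S x) - S (A x))

end PseudoHermitian

section Equiv

variable {L L' : Type*} [LieRing L] [LieAlgebra ℝ L] [LieRing L'] [LieAlgebra ℝ L']
  {P : PseudoKahler L} {P' : PseudoKahler L'} (f : PseudoKahlerEquiv P P')

namespace PseudoKahlerEquiv

theorem surjective (y : L') : ∃ x, f.toLieEquiv x = y := f.toLieEquiv.surjective y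

theorem conj_apply (T : L →ₗ[ℝ] L) (x : L) :
    f.toLinearEquiv.conj T (f.toLieEquiv x) = f.toLieEquiv (T x) :=
  congrArg (fun y => f.toLieEquiv (T y)) (f.toLinearEquiv.symm_apply_apply x)

end PseudoKahlerEquiv

end Equiv

section Extension

variable {G H : Type*} [LieRing G] [LieAlgebra ℝ G] [FiniteDimensional ℝ G] [LieRing H]
  [LieAlgebra ℝ H] {P : PseudoKahler G} {Q : PseudoKahler H} (E : PKExtension P Q)

namespace PKExtension

/-- The symmetric part `φ(a)ˢ`, as a linear function of `a`. -/
def sym : H →ₗ[ℝ] G →ₗ[ℝ] G where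
  toFun a := P.symPart (E.φ a).toLinearMap
  map_add' a b := by rw [map_add, ← P.symPart_add]; rfl
  map_smul' c a := by rw [map_smul, RingHom.id_apply, ← P.symPart_smul]; rfl

/-- The antisymmetric part `φ(a)ᵃ`, as a linear function of `a`. -/
def anti : H →ₗ[ℝ] G →ₗ[ℝ] G where
  toFun a := P.antiPart (E.φ a).toLinearMap
  map_add' a b := by rw [map_add, ← P.antiPart_add]; rfl
  map_smul' c a := by rw [map_smul, RingHom.id_apply, ← P.antiPart_smul]; rfl

theorem sym_apply (a : H) : E.sym a = P.symPart (E.φ a).toLinearMap := rfl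

theorem anti_apply (a : H) : E.anti a = P.antiPart (E.φ a).toLinearMap := rfl

theorem φ_apply (a : H) (x : G) : E.φ a x = E.sym a x + E.anti a x :=
  (P.symPart_add_antiPart _ x).symm

theorem sym_J (a : H) : E.sym (Q.J a) = P.J ∘ₗ E.sym a := (E.isExtension.1 a).symm

theorem sym_symm (a : H) (x y : G) : P.metric (E.sym a x) y = P.metric x (E.sym a y) := by
  rw [P.metric_comm x, sym_apply, P.metric_symPart, P.metric_symPart, P.metric_comm x,
    P.metric_comm y, add_comm]

theorem anti_skew (a : H) (x y : G) : P.metric (E.anti a x) y = -P.metric x (E.anti a y) := by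
  rw [P.metric_comm x, anti_apply, P.metric_antiPart, P.metric_antiPart, P.metric_comm x,
    P.metric_comm y]
  ring

theorem anti_J_right (a : H) (x : G) : E.anti a (P.J x) = P.J (E.anti a x) :=
  (LinearMap.congr_fun (E.isExtension.2 a) x).symm

theorem sym_J_right (a : H) (x : G) : E.sym a (P.J x) = -P.J (E.sym a x) := by
  refine P.ext_metric fun y => ?_
  have hsymm := E.sym_symm (Q.J a) x y
  rw [sym_J, LinearMap.comp_apply, LinearMap.comp_apply] at hsymm
  rw [map_neg, LinearMap.neg_apply, hsymm, sym_symm, P.metric_J_left]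

theorem φ_commute [IsLieAbelian H] (a b : H) (x : G) : E.φ a (E.φ b x) = E.φ b (E.φ a x) := by
  have hlie := E.φ.map_lie a b
  rw [trivial_lie_zero, map_zero] at hlie
  exact sub_eq_zero.1 (DFunLike.congr_fun hlie x).symm

/-- The identity `[φ(a), φ(J a)] = 0` splits into its parts commuting and anticommuting with `J`. -/
theorem isExtensionTriple [IsLieAbelian H] (a : H) :
    IsExtensionTriple P.toPseudoHermitian (E.sym a) (E.anti a) (E.anti (Q.J a)) := by
  have hsplit : ∀ x, E.anti a (E.anti (Q.J a) x) - E.anti (Q.J a) (E.anti a x)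
        - (2 : ℝ) • P.J (E.sym a (E.sym a x))
      = (E.anti (Q.J a) (E.sym a x) - E.sym a (E.anti (Q.J a) x))
        - P.J (E.anti a (E.sym a x) - E.sym a (E.anti a x)) := fun x => by
    have hcomm := E.φ_commute a (Q.J a) x
    simp only [φ_apply, sym_J, LinearMap.comp_apply, map_add, anti_J_right, sym_J_right] at hcomm
    simp only [map_sub]
    linear_combination (norm := module) hcomm
  have hlinear := P.self_eq_zero_of_commutes_of_anticommutes hsplit
    (fun x => by simp only [map_sub, map_smul, map_neg, anti_J_right, sym_J_right, neg_neg])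
    (fun x => by simp only [map_sub, map_neg, anti_J_right, sym_J_right]; module)
  exact
    { S_symm := E.sym_symm a
      S_J := E.sym_J_right a
      A_skew := E.anti_skew a
      A_J := E.anti_J_right a
      B_skew := E.anti_skew _
      B_J := E.anti_J_right _
      lie_A_B := fun x => sub_eq_zero.1 (hlinear x)
      lie_B_S := fun x => sub_eq_zero.1 ((hsplit x).symm.trans (hlinear x)) }

theorem isTrivial_of_sym_eq_zero (h : E.sym = 0) : E.IsTrivial := by
  refine ⟨G, _, _, _, H, _, _, P, Q, ⟨0, ?_⟩, rfl, ⟨LieEquiv.refl, fun _ _ => rfl, fun _ => rfl⟩,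
    ⟨LieEquiv.refl, fun _ _ => rfl, fun _ => rfl⟩, fun a => ?_, fun _ _ => Commute.zero_right _⟩
  · rw [isExtension_iff, semidirect_integrable_iff, semidirect_omegaClosed_iff]
    simp
  · refine Eq.trans (congrArg P.symPart ?_) (LinearMap.congr_fun h a)
    exact LinearMap.ext fun x => sub_zero _

theorem IsTrivial.sym_eq_zero {E : PKExtension P Q} (h : E.IsTrivial) : E.sym = 0 := by
  obtain ⟨G', _, _, _, H', _, _, P', Q', E', hE', f, k, hsym, -⟩ := h
  refine LinearMap.ext fun a => (P.symPart_eq_zero_iff _).2 fun x y => ?_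
  have hconj : ∀ z : G, (f.toLinearEquiv.conj (E.φ a).toLinearMap
      - (E'.φ (k.toLieEquiv a)).toLinearMap) (f.toLieEquiv z) = f.toLieEquiv (E.φ a z) :=
    fun z => by
      rw [LinearMap.sub_apply, f.conj_apply, hE']
      exact sub_zero _
  have hskew := (P'.symPart_eq_zero_iff _).1 (hsym a) (f.toLieEquiv x) (f.toLieEquiv y)
  rwa [hconj, hconj, f.map_metric, f.map_metric] at hskew

end PKExtension

end Extension

section NormalForm

variable {G : Type*} [LieRing G] [LieAlgebra ℝ G] {P : PseudoHermitian G} {S A B : G →ₗ[ℝ] G}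

theorem exists_re_im_of_complex_sqrt (p q : ℝ) : ∃ x y : ℝ, x ^ 2 - y ^ 2 = p ∧ 2 * x * y = q := by
  obtain ⟨z, hz⟩ := IsAlgClosed.exists_pow_nat_eq (⟨p, q⟩ : ℂ) (n := 2) (by norm_num)
  rw [Complex.ext_iff] at hz
  simp only [pow_two, Complex.mul_re, Complex.mul_im] at hz
  exact ⟨z.re, z.im, by linear_combination hz.1, by linear_combination hz.2⟩

namespace IsExtensionTriple

theorem exists_cyclic_vector (hT : IsExtensionTriple P S A B) (hG : Module.finrank ℝ G = 4)
    (hS : S ≠ 0) :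
    ∃ (u : G) (κ : ℝ), 0 ≤ κ ∧ S u ≠ 0 ∧ S (S u) = κ • P.J u ∧
      ∀ x, ∃ p q r s : ℝ, x = p • u + q • P.J u + r • S u + s • P.J (S u) := by
  let := P.complexModule
  have hE : Module.finrank ℂ G = 2 := by
    have h := P.two_mul_finrank_complex
    rw [hG] at h
    omega
  let S' := P.complexAntilinear S hT.S_J
  let A' : Module.End ℂ G := P.complexLinear A hT.A_J
  let B' : Module.End ℂ G := P.complexLinear B hT.B_J
  have hcomm : A' * B' - B' * A' = (2 * Complex.I) • S'.comp S' :=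
    LinearMap.ext fun x => (hT.lie_A_B x).trans <| by
      rw [LinearMap.smul_apply, P.complex_smul_eq]
      simp [S', PseudoHermitian.complexAntilinear]
  have htr : LinearMap.trace ℂ G (S'.comp S') = 0 := by
    have h := congrArg (LinearMap.trace ℂ G) hcomm
    rw [map_sub, LinearMap.trace_mul_comm, sub_self, map_smul, smul_eq_mul] at h
    exact (mul_eq_zero.1 h.symm).resolve_left (mul_ne_zero two_ne_zero Complex.I_ne_zero)
  have hS' : S' ≠ 0 := fun h => hS (LinearMap.ext fun x => LinearMap.congr_fun h x)
  obtain ⟨u, κ, hκ, hSu, hSSu, hspan⟩ := exists_antilinear_cyclic_vector S' hE hS' htr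
  refine ⟨u, κ, hκ, hSu, hSSu.trans (by rw [P.complex_smul_eq]; simp), fun x => ?_⟩
  obtain ⟨z, z', h⟩ := hspan x
  refine ⟨z.re, z.im, z'.re, z'.im, h.trans ?_⟩
  rw [P.complex_smul_eq, P.complex_smul_eq, ← add_assoc]
  rfl

theorem metric_S_S_eq_zero (hT : IsExtensionTriple P S A B) {u : G} {κ : ℝ}
    (hSSu : S (S u) = κ • P.J u) : P.metric (S u) (S u) = 0 := by
  rw [hT.S_symm, hSSu, map_smul, P.metric_J_self, smul_zero]

theorem metric_S_sq_add_metric_J_S_sq_ne_zero (hT : IsExtensionTriple P S A B) {u : G} {κ : ℝ}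
    (hSu : S u ≠ 0) (hSSu : S (S u) = κ • P.J u)
    (hspan : ∀ x, ∃ p q r s : ℝ, x = p • u + q • P.J u + r • S u + s • P.J (S u)) :
    P.metric u (S u) ^ 2 + P.metric u (P.J (S u)) ^ 2 ≠ 0 := fun h => by
  have hu : P.metric u (S u) = 0 := by nlinarith
  have hJu : P.metric u (P.J (S u)) = 0 := by nlinarith
  refine hSu (P.nondeg.2 _ fun x => ?_)
  obtain ⟨p, q, r, s, rfl⟩ := hspan x
  simp only [map_add, map_smul, LinearMap.add_apply, LinearMap.smul_apply, P.metric_J_left u,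
    P.metric_self_J, hT.metric_S_S_eq_zero hSSu, hu, hJu, smul_zero, neg_zero, add_zero]

theorem metric_self_eq_zero_of_pos (hT : IsExtensionTriple P S A B) {u : G} {κ : ℝ} (hκ : 0 < κ)
    (hSSu : S (S u) = κ • P.J u) : P.metric u u = 0 := by
  have hsymm := hT.S_symm (S u) (P.J u)
  rw [hSSu, hT.S_J, map_neg, P.metric_J_self, neg_zero, map_smul, LinearMap.smul_apply, P.compat,
    smul_eq_mul] at hsymm
  exact (mul_eq_zero.1 hsymm).resolve_left hκ.ne'

theorem exists_isotropic_add_of_sq_eq_zero (hT : IsExtensionTriple P S A B) {u : G}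
    (hSSu : S (S u) = 0)
    (hne : P.metric u (S u) ^ 2 + P.metric u (P.J (S u)) ^ 2 ≠ 0) :
    ∃ r s : ℝ, P.metric (u + r • S u + s • P.J (S u)) (u + r • S u + s • P.J (S u)) = 0 := by
  have hSS := hT.metric_S_S_eq_zero (κ := 0) (hSSu.trans (zero_smul ℝ _).symm)
  set p := P.metric u (S u)
  set q := P.metric u (P.J (S u))
  refine ⟨-P.metric u u / (2 * (p ^ 2 + q ^ 2)) * p, -P.metric u u / (2 * (p ^ 2 + q ^ 2)) * q, ?_⟩
  simp only [map_add, map_smul, LinearMap.add_apply, LinearMap.smul_apply, smul_eq_mul,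
    P.compat, P.metric_J_self, P.metric_self_J, hSS, P.metric_comm (S u) u,
    P.metric_comm (P.J (S u)) u]
  field_simp
  ring

theorem exists_isotropic_cyclic_vector (hT : IsExtensionTriple P S A B)
    (hG : Module.finrank ℝ G = 4) (hS : S ≠ 0) :
    ∃ (u : G) (κ : ℝ), 0 ≤ κ ∧ S (S u) = κ • P.J u ∧ P.metric u u = 0 ∧
      P.metric u (S u) ^ 2 + P.metric u (P.J (S u)) ^ 2 ≠ 0 := by
  obtain ⟨u, κ, hκ, hSu, hSSu, hspan⟩ := hT.exists_cyclic_vector hG hS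
  have hne := hT.metric_S_sq_add_metric_J_S_sq_ne_zero hSu hSSu hspan
  rcases hκ.eq_or_lt with rfl | hpos
  · have hSS := hT.metric_S_S_eq_zero hSSu
    rw [zero_smul] at hSSu
    obtain ⟨r, s, hisotropic⟩ := hT.exists_isotropic_add_of_sq_eq_zero hSSu hne
    have hS_add : S (u + r • S u + s • P.J (S u)) = S u := by
      simp only [map_add, map_smul, hT.S_J, hSSu, map_zero, smul_zero, neg_zero, add_zero]
    refine ⟨u + r • S u + s • P.J (S u), 0, le_rfl, ?_, hisotropic, ?_⟩
    · rw [hS_add, hSSu, zero_smul]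
    · simpa only [hS_add, map_add, map_smul, LinearMap.add_apply, LinearMap.smul_apply, smul_eq_mul,
        P.compat, P.metric_J_self, P.metric_self_J, hSS, mul_zero, add_zero] using hne
  · exact ⟨u, κ, hκ, hSSu, hT.metric_self_eq_zero_of_pos hpos hSSu, hne⟩

end IsExtensionTriple

/-- Two vectors spanning complementary isotropic complex lines, dual to each other. -/
structure IsHyperbolicPair (P : PseudoHermitian G) (v w : G) : Prop where
  vv : P.metric v v = 0
  ww : P.metric w w = 0
  vw : P.metric v w = 1
  v_Jw : P.metric v (P.J w) = 0

namespace IsHyperbolicPair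

variable {v w : G}

theorem wv (h : IsHyperbolicPair P v w) : P.metric w v = 1 := by rw [P.metric_comm, h.vw]

theorem Jv_w (h : IsHyperbolicPair P v w) : P.metric (P.J v) w = 0 := by
  rw [P.metric_J_left, h.v_Jw, neg_zero]

theorem Jw_v (h : IsHyperbolicPair P v w) : P.metric (P.J w) v = 0 := by
  rw [P.metric_comm, h.v_Jw]

theorem w_Jv (h : IsHyperbolicPair P v w) : P.metric w (P.J v) = 0 := by
  rw [P.metric_comm, h.Jv_w]

theorem metric_comb (h : IsHyperbolicPair P v w) (p q r s : ℝ) :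
    P.metric (p • v + q • P.J v + r • w + s • P.J w) w = p ∧
    P.metric (p • v + q • P.J v + r • w + s • P.J w) (P.J w) = q ∧
    P.metric (p • v + q • P.J v + r • w + s • P.J w) v = r ∧
    P.metric (p • v + q • P.J v + r • w + s • P.J w) (P.J v) = s := by
  simp [P.compat, P.metric_J_self, P.metric_self_J, h.vv, h.ww, h.vw, h.v_Jw, h.wv, h.Jv_w,
    h.Jw_v, h.w_Jv]

theorem comb_eq_zero (h : IsHyperbolicPair P v w) {p q r s : ℝ}
    (hcomb : p • v + q • P.J v + r • w + s • P.J w = 0) : p = 0 ∧ q = 0 ∧ r = 0 ∧ s = 0 := by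
  simpa only [hcomb, map_zero, LinearMap.zero_apply, eq_comm] using h.metric_comb p q r s

theorem linearIndependent (h : IsHyperbolicPair P v w) :
    LinearIndependent ℝ ![v, P.J v, w, P.J w] := by
  refine Fintype.linearIndependent_iff.2 fun c hc => ?_
  simp only [Fin.sum_univ_four, Matrix.cons_val] at hc
  exact Fin.forall_fin_succ.2 (by simpa [Fin.forall_fin_succ] using h.comb_eq_zero hc)

theorem exists_eq_comb (h : IsHyperbolicPair P v w) (hG : Module.finrank ℝ G = 4) (x : G) :
    ∃ p q r s : ℝ, x = p • v + q • P.J v + r • w + s • P.J w := by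
  have : FiniteDimensional ℝ G := FiniteDimensional.of_finrank_pos (by omega)
  have hspan := h.linearIndependent.span_eq_top_of_card_eq_finrank' (by simp [hG])
  obtain ⟨c, hc⟩ := (Submodule.mem_span_range_iff_exists_fun ℝ).1
    (hspan ▸ Submodule.mem_top : x ∈ _)
  simp only [Fin.sum_univ_four, Matrix.cons_val] at hc
  exact ⟨_, _, _, _, hc.symm⟩

theorem eq_comb (h : IsHyperbolicPair P v w) (hG : Module.finrank ℝ G = 4) (x : G) :
    x = P.metric x w • v + P.metric x (P.J w) • P.J v + P.metric x v • w
      + P.metric x (P.J v) • P.J w := by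
  obtain ⟨p, q, r, s, rfl⟩ := h.exists_eq_comb hG x
  obtain ⟨hw, hJw, hv, hJv⟩ := h.metric_comb p q r s
  rw [hw, hJw, hv, hJv]

theorem rotate (h : IsHyperbolicPair P v w) {x y : ℝ} (hxy : x ^ 2 + y ^ 2 = 1) :
    IsHyperbolicPair P (x • v + y • P.J v) (x • w + y • P.J w) := by
  constructor <;> simp only [map_add, map_smul, LinearMap.add_apply, LinearMap.smul_apply,
    smul_eq_mul, P.compat, P.J_sq, map_neg, P.metric_J_self, P.metric_self_J, h.vv, h.ww, h.vw,
    h.v_Jw, h.Jv_w] <;> first | linear_combination hxy | ring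

theorem skew_eq (h : IsHyperbolicPair P v w) (hG : Module.finrank ℝ G = 4)
    (hA : ∀ x y, P.metric (A x) y = -P.metric x (A y)) (hJ : ∀ x, A (P.J x) = P.J (A x)) :
    ∃ α₁ α₂ β γ : ℝ, A v = α₁ • v + α₂ • P.J v + γ • P.J w ∧
      A w = β • P.J v - α₁ • w + α₂ • P.J w := by
  have hself : ∀ x, P.metric (A x) x = 0 := fun x => by
    have h := hA x x
    rw [P.metric_comm x] at h
    linarith
  have hAwv : P.metric (A w) v = -P.metric (A v) w := by rw [hA w v, P.metric_comm]
  have hAwJv : P.metric (A w) (P.J v) = P.metric (A v) (P.J w) := by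
    rw [hA w, hJ, P.metric_comm, P.metric_J_left, neg_neg]
  refine ⟨P.metric (A v) w, P.metric (A v) (P.J w), P.metric (A w) (P.J w),
    P.metric (A v) (P.J v), ?_, ?_⟩
  · conv_lhs => rw [h.eq_comb hG (A v)]
    rw [hself, zero_smul, add_zero]
  · conv_lhs => rw [h.eq_comb hG (A w)]
    rw [hself, hAwv, hAwJv]
    module

end IsHyperbolicPair

/-- The normal form `S w = v`, `S v = κ J w` of the symmetric part of `φ(a)`, in a hyperbolic
pair. -/
structure IsNormalForm (P : PseudoHermitian G) (S : G →ₗ[ℝ] G) (κ : ℝ) (v w : G) : Prop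
    extends IsHyperbolicPair P v w where
  S_w : S w = v
  S_v : S v = κ • P.J w

/-- The pair `x • v + y • J v`, `x • w + y • J w` realises the rotation of `S` by the angle of
`(x + i y) ^ 2`, as `S` is antilinear. -/
theorem IsNormalForm.rotate {κ : ℝ} {v w : G} (h : IsNormalForm P S κ v w)
    (hSJ : ∀ x, S (P.J x) = -P.J (S x)) {x y : ℝ} (hxy : x ^ 2 + y ^ 2 = 1) :
    IsNormalForm P ((x ^ 2 - y ^ 2) • S + (2 * x * y) • P.J ∘ₗ S) κ
      (x • v + y • P.J v) (x • w + y • P.J w) where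
  toIsHyperbolicPair := h.toIsHyperbolicPair.rotate hxy
  S_w := by
    simp only [LinearMap.add_apply, LinearMap.smul_apply, LinearMap.comp_apply, map_add, map_smul,
      hSJ, h.S_w, map_neg, P.J_sq]
    linear_combination (norm := module) hxy • (x • v + y • P.J v)
  S_v := by
    simp only [LinearMap.add_apply, LinearMap.smul_apply, LinearMap.comp_apply, map_add, map_smul,
      hSJ, h.S_v, map_neg, P.J_sq]
    linear_combination (norm := module) hxy • (κ • x • P.J w - κ • y • w)

theorem IsExtensionTriple.exists_isNormalForm (hT : IsExtensionTriple P S A B)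
    (hG : Module.finrank ℝ G = 4) (hS : S ≠ 0) :
    ∃ (κ : ℝ) (v w : G), 0 ≤ κ ∧ IsNormalForm P S κ v w := by
  obtain ⟨u, κ, hκ, hSSu, huu, hne⟩ := hT.exists_isotropic_cyclic_vector hG hS
  have hSS := hT.metric_S_S_eq_zero hSSu
  set p := P.metric u (S u)
  set q := P.metric u (P.J (S u))
  obtain ⟨x, y, hre, him⟩ :=
    exists_re_im_of_complex_sqrt (p / (p ^ 2 + q ^ 2)) (-q / (p ^ 2 + q ^ 2))
  have hpair_re : (x ^ 2 - y ^ 2) * p - 2 * x * y * q = 1 := by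
    rw [hre, him]
    field_simp
    ring
  have hpair_im : (x ^ 2 - y ^ 2) * q + 2 * x * y * p = 0 := by
    rw [hre, him]
    field_simp
    ring
  have hSu_u : P.metric (S u) u = p := P.metric_comm _ _
  have hJSu_u : P.metric (P.J (S u)) u = q := P.metric_comm _ _
  have hSu_Ju : P.metric (S u) (P.J u) = -q := by rw [P.metric_comm, P.metric_J_left]
  refine ⟨κ, x • S u - y • P.J (S u), x • u + y • P.J u, hκ, ⟨?_, ?_, ?_, ?_⟩, ?_, ?_⟩
  all_goals simp only [map_add, map_sub, map_smul, LinearMap.add_apply, LinearMap.sub_apply,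
    LinearMap.smul_apply, smul_eq_mul, map_neg, P.compat, P.J_sq, P.metric_J_self,
    P.metric_self_J, hT.S_J, hSSu, hSS, huu, hSu_u, hJSu_u, hSu_Ju]
  · ring
  · ring
  · linear_combination hpair_re
  · linear_combination -hpair_im
  · module
  · module

/-- The normal form of an extension triple in a hyperbolic pair; `α₁`, `α₂`, `β`, `β'` parametrise
the antisymmetric operators, and the last four equations are `[A, B] = 2 J S²`, `[B, S] = J [A, S]`
in these parameters. -/
structure IsTripleNormalForm (P : PseudoHermitian G) (S A B : G →ₗ[ℝ] G) (v w : G)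
    (κ α₁ α₂ β β' : ℝ) : Prop extends IsNormalForm P S κ v w where
  κ_nonneg : 0 ≤ κ
  A_v : A v = α₁ • v + α₂ • P.J v + (κ * β') • P.J w
  A_w : A w = β • P.J v - α₁ • w + α₂ • P.J w
  B_v : B v = -α₂ • v + α₁ • P.J v - (κ * β) • P.J w
  B_w : B w = β' • P.J v + α₂ • w + α₁ • P.J w
  κ_α₁ : κ * α₁ = 0
  κ_α₂ : κ * α₂ = 0
  α_β : β' * α₁ + β * α₂ = 0
  κ_β : κ * (β ^ 2 + β' ^ 2) = 2 * κ

theorem IsExtensionTriple.exists_isTripleNormalForm (hT : IsExtensionTriple P S A B)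
    (hG : Module.finrank ℝ G = 4) (hS : S ≠ 0) :
    ∃ (v w : G) (κ α₁ α₂ β β' : ℝ), IsTripleNormalForm P S A B v w κ α₁ α₂ β β' := by
  obtain ⟨κ, v, w, hκ, h⟩ := hT.exists_isNormalForm hG hS
  obtain ⟨α₁, α₂, β, γ, hAv, hAw⟩ := h.toIsHyperbolicPair.skew_eq hG hT.A_skew hT.A_J
  obtain ⟨δ₁, δ₂, β', γ', hBv, hBw⟩ := h.toIsHyperbolicPair.skew_eq hG hT.B_skew hT.B_J
  have hBS_w := hT.lie_B_S w
  have hBS_v := hT.lie_B_S v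
  have hAB_w := hT.lie_A_B w
  simp only [h.S_v, h.S_w, hAv, hAw, hBv, hBw, map_add, map_sub, map_smul, map_neg, hT.S_J, hT.A_J,
    hT.B_J, P.J_sq] at hBS_w hBS_v hAB_w
  obtain ⟨hδ₁, hδ₂, hγ, hγ'⟩ := h.comb_eq_zero (p := 2 * δ₁ + 2 * α₂) (q := 2 * δ₂ - 2 * α₁)
    (r := γ - κ * β') (s := γ' + κ * β)
    (by linear_combination (norm := module) hBS_w)
  obtain ⟨-, -, hκδ₂, hκδ₁⟩ := h.comb_eq_zero (p := γ - κ * β') (q := γ' + κ * β)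
    (r := -(2 * κ * δ₂) - 2 * κ * α₁) (s := 2 * κ * α₂ - 2 * κ * δ₁)
    (by linear_combination (norm := module) hBS_v)
  obtain rfl : δ₁ = -α₂ := by linarith
  obtain rfl : δ₂ = α₁ := by linarith
  obtain rfl : γ = κ * β' := by linarith
  obtain rfl : γ' = -(κ * β) := by linarith
  obtain ⟨-, hα_β, hκ_β, -⟩ := h.comb_eq_zero (p := 0) (q := 2 * (β' * δ₂ + β * α₂))
    (r := 2 * κ - κ * (β ^ 2 + β' ^ 2)) (s := 0)
    (by linear_combination (norm := module) hAB_w)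
  refine ⟨v, w, κ, δ₂, α₂, β, β', h, hκ, hAv, hAw, ?_, ?_, ?_, ?_, ?_, ?_⟩
  · rw [hBv]; module
  · rw [hBw]; module
  all_goals linarith

theorem IsTripleNormalForm.rotate {v w : G} {κ α₁ α₂ β β' : ℝ}
    (h : IsTripleNormalForm P S A B v w κ α₁ α₂ β β') (hSJ : ∀ x, S (P.J x) = -P.J (S x))
    (hAJ : ∀ x, A (P.J x) = P.J (A x)) (hBJ : ∀ x, B (P.J x) = P.J (B x)) {x y : ℝ}
    (hxy : x ^ 2 + y ^ 2 = 1) {c s : ℝ} (hc : x ^ 2 - y ^ 2 = c) (hs : 2 * x * y = s) :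
    IsTripleNormalForm P (c • S + s • P.J ∘ₗ S) (c • A + s • B) (c • B - s • A)
      (x • v + y • P.J v) (x • w + y • P.J w) κ
      (c * α₁ - s * α₂) (c * α₂ + s * α₁) (c * β + s * β') (c * β' - s * β) := by
  have hcs : c ^ 2 + s ^ 2 = 1 := by
    rw [← hc, ← hs]
    linear_combination (x ^ 2 + y ^ 2 + 1) * hxy
  refine ⟨hc ▸ hs ▸ h.toIsNormalForm.rotate hSJ hxy, h.κ_nonneg, ?_, ?_, ?_, ?_, ?_, ?_, ?_, ?_⟩
  · simp only [LinearMap.add_apply, LinearMap.smul_apply, map_add, map_smul, hAJ, hBJ, h.A_v, h.B_v,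
      map_sub, P.J_sq]
    module
  · simp only [LinearMap.add_apply, LinearMap.smul_apply, map_add, map_smul, hAJ, hBJ, h.A_w, h.B_w,
      map_sub, P.J_sq]
    module
  · simp only [LinearMap.sub_apply, LinearMap.smul_apply, map_add, map_smul, hAJ, hBJ, h.A_v, h.B_v,
      map_sub, P.J_sq]
    module
  · simp only [LinearMap.sub_apply, LinearMap.smul_apply, map_add, map_smul, hAJ, hBJ, h.A_w, h.B_w,
      map_sub, P.J_sq]
    module
  · linear_combination c * h.κ_α₁ - s * h.κ_α₂
  · linear_combination c * h.κ_α₂ + s * h.κ_α₁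
  · linear_combination (c ^ 2 + s ^ 2) * h.α_β
  · linear_combination (c ^ 2 + s ^ 2) * h.κ_β + 2 * κ * hcs

end NormalForm

section ExtensionNormalForm

variable {G H : Type*} [LieRing G] [LieAlgebra ℝ G] [FiniteDimensional ℝ G] [LieRing H]
  [LieAlgebra ℝ H] {P : PseudoKahler G} {Q : PseudoKahler H}

/-- The normal form of an extension `φ` of a four-dimensional pseudo-Kähler Lie algebra by a plane
with orthonormal basis `a, J a`. -/
structure IsExtensionNormalForm (E : PKExtension P Q) (a : H) (v w : G) (κ α₁ α₂ β β' : ℝ) : Prop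
    extends IsTripleNormalForm P.toPseudoHermitian (E.sym a) (E.anti a) (E.anti (Q.J a)) v w
      κ α₁ α₂ β β' where
  unit : Q.metric a a = 1

theorem exists_isExtensionNormalForm [IsLieAbelian H] (E : PKExtension P Q)
    (hG : Module.finrank ℝ G = 4) {a : H} (ha : Q.metric a a = 1) (hS : E.sym a ≠ 0) :
    ∃ (v w : G) (κ α₁ α₂ β β' : ℝ), IsExtensionNormalForm E a v w κ α₁ α₂ β β' := by
  obtain ⟨v, w, κ, α₁, α₂, β, β', h⟩ := (E.isExtensionTriple a).exists_isTripleNormalForm hG hS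
  exact ⟨v, w, κ, α₁, α₂, β, β', h, ha⟩

theorem IsExtensionNormalForm.rotate {E : PKExtension P Q} {a : H} {v w : G}
    {κ α₁ α₂ β β' : ℝ} (h : IsExtensionNormalForm E a v w κ α₁ α₂ β β') {x y : ℝ}
    (hxy : x ^ 2 + y ^ 2 = 1) {c s : ℝ} (hc : x ^ 2 - y ^ 2 = c) (hs : 2 * x * y = s) :
    IsExtensionNormalForm E (c • a + s • Q.J a) (x • v + y • P.J v) (x • w + y • P.J w) κ
      (c * α₁ - s * α₂) (c * α₂ + s * α₁) (c * β + s * β') (c * β' - s * β) where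
  toIsTripleNormalForm := by
    have hrotate := h.toIsTripleNormalForm.rotate (E.sym_J_right a) (E.anti_J_right a)
      (E.anti_J_right (Q.J a)) hxy hc hs
    have hJ : Q.J (c • a + s • Q.J a) = c • Q.J a - s • a := by
      rw [map_add, map_smul, map_smul, Q.J_sq, smul_neg, sub_eq_add_neg]
    rwa [hJ, map_sub, map_add, map_add, map_smul, map_smul, map_smul, map_smul, map_smul, map_smul,
      E.sym_J]
  unit := by
    simp only [map_add, map_smul, LinearMap.add_apply, LinearMap.smul_apply, smul_eq_mul, Q.compat,
      Q.metric_J_self, Q.metric_self_J, h.unit, ← hc, ← hs]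
    linear_combination (x ^ 2 + y ^ 2 + 1) * hxy

theorem IsExtensionNormalForm.exists_rotate {E : PKExtension P Q} {a : H} {v w : G}
    {κ α₁ α₂ β β' : ℝ} (h : IsExtensionNormalForm E a v w κ α₁ α₂ β β') {c s : ℝ}
    (hcs : c ^ 2 + s ^ 2 = 1) : ∃ v' w' : G, IsExtensionNormalForm E (c • a + s • Q.J a) v' w' κ
      (c * α₁ - s * α₂) (c * α₂ + s * α₁) (c * β + s * β') (c * β' - s * β) := by
  obtain ⟨x, y, hc, hs⟩ := exists_re_im_of_complex_sqrt c s
  have hxy : x ^ 2 + y ^ 2 = 1 := by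
    rw [← hc, ← hs] at hcs
    nlinarith [sq_nonneg x, sq_nonneg y]
  exact ⟨_, _, h.rotate hxy hc hs⟩

end ExtensionNormalForm

/-! ## Criteria for AW-relatedness -/

section Equiv

variable {L L' : Type*} [LieRing L] [LieAlgebra ℝ L] [LieRing L'] [LieAlgebra ℝ L']
  {P : PseudoKahler L} {P' : PseudoKahler L'}

namespace PseudoKahlerEquiv

/-- The inverse of an isomorphism of pseudo-Kähler Lie algebras. -/
def symm (f : PseudoKahlerEquiv P P') : PseudoKahlerEquiv P' P where
  toLieEquiv := f.toLieEquiv.symm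
  map_metric x y := by
    rw [← f.map_metric, LieEquiv.apply_symm_apply, LieEquiv.apply_symm_apply]
  map_J x := f.toLieEquiv.injective <| by
    exact (f.toLieEquiv.apply_symm_apply _).trans <|
      (congrArg P'.J (f.toLieEquiv.apply_symm_apply x).symm).trans (f.map_J _).symm

theorem symm_apply_apply (f : PseudoKahlerEquiv P P') (x : L) :
    f.symm.toLieEquiv (f.toLieEquiv x) = x :=
  f.toLieEquiv.symm_apply_apply x

/-- A linear map between pseudo-Kähler Lie algebras of equal dimension that preserves brackets,
metrics and complex structures, as an isomorphism. -/
def ofLinearMap [FiniteDimensional ℝ L] [FiniteDimensional ℝ L'] (ψ : L →ₗ[ℝ] L')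
    (hfin : Module.finrank ℝ L = Module.finrank ℝ L') (hlie : ∀ x y, ψ ⁅x, y⁆ = ⁅ψ x, ψ y⁆)
    (hmetric : ∀ x y, P'.metric (ψ x) (ψ y) = P.metric x y) (hJ : ∀ x, ψ (P.J x) = P'.J (ψ x)) :
    PseudoKahlerEquiv P P' where
  toLieEquiv :=
    { LinearMap.linearEquivOfInjective ψ
        ((injective_iff_map_eq_zero ψ).2 fun x hx => P.nondeg.1 x fun y => by
          rw [← hmetric, hx, map_zero, LinearMap.zero_apply]) hfin with
      map_lie' := fun {x y} => hlie x y }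
  map_metric := hmetric
  map_J := hJ

end PseudoKahlerEquiv

end Equiv

section AWRelated

variable {G G' H H' : Type*} [LieRing G] [LieAlgebra ℝ G] [FiniteDimensional ℝ G]
  [LieRing G'] [LieAlgebra ℝ G'] [FiniteDimensional ℝ G'] [LieRing H] [LieAlgebra ℝ H]
  [LieRing H'] [LieAlgebra ℝ H'] {P : PseudoKahler G} {P' : PseudoKahler G'}
  {Q : PseudoKahler H} {Q' : PseudoKahler H'}

theorem awRelated_of_conj (E : PKExtension P Q) (E' : PKExtension P' Q')
    (f : PseudoKahlerEquiv P P') (k : PseudoKahlerEquiv Q Q') (D : H → G →ₗ[ℝ] G)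
    (hD : ∀ b x, E'.φ (k.toLieEquiv b) (f.toLieEquiv x) = f.toLieEquiv (D b x))
    (hsym : ∀ b, P.symPart ((E.φ b).toLinearMap - D b) = 0)
    (hcomm : ∀ b b' x, E.φ b (D b' x) = D b' (E.φ b x)) : AWRelated E E' := by
  refine ⟨f, k, fun b => ?_, fun b b' => LinearMap.ext fun y => ?_⟩
  · rw [PseudoHermitian.symPart_eq_zero_iff]
    intro y y'
    obtain ⟨x, rfl⟩ := f.surjective y
    obtain ⟨x', rfl⟩ := f.surjective y'
    have hdiff : ∀ z, (f.toLinearEquiv.conj (E.φ b).toLinearMap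
        - (E'.φ (k.toLieEquiv b)).toLinearMap) (f.toLieEquiv z)
        = f.toLieEquiv (((E.φ b).toLinearMap - D b) z) := fun z => by
      rw [LinearMap.sub_apply, f.conj_apply, LinearMap.sub_apply, map_sub, ← hD]
      rfl
    rw [hdiff, hdiff, f.map_metric, f.map_metric]
    exact (P.symPart_eq_zero_iff _).1 (hsym b) x x'
  · obtain ⟨x, rfl⟩ := f.surjective y
    obtain ⟨b', rfl⟩ := k.surjective b'
    change f.toLinearEquiv.conj _ (E'.φ _ (f.toLieEquiv x))
      = E'.φ _ (f.toLinearEquiv.conj _ (f.toLieEquiv x))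
    rw [hD, f.conj_apply, f.conj_apply, LieDerivation.coeFn_coe, hD, hcomm]

end AWRelated

section LieModel

variable {L : Type*} [LieRing L] [LieAlgebra ℝ L] {P : PseudoKahler L} {n : ℕ}

namespace LieModel

variable (m : LieModel n)

/-- The linear map from a coordinate Lie algebra sending the standard basis to `e`. -/
def frame (e : Fin n → L) : m.Alg →ₗ[ℝ] L :=
  Fintype.linearCombination ℝ e ∘ₗ m.vec.symm.toLinearMap

theorem frame_vec (e : Fin n → L) (x : Fin n → ℝ) :
    m.frame e (m.vec x) = ∑ i, x i • e i := rfl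

theorem finrank_alg : Module.finrank ℝ m.Alg = n :=
  m.vec.finrank_eq.symm.trans (Module.finrank_fin_fun ℝ)

/-- The family `e` has the structure constants of the coordinate Lie algebra `m`, and the
matrices `g` and `J` describe the metric and the complex structure in it. -/
structure IsAdaptedFrame (P : PseudoKahler L) (g J : Matrix (Fin n) (Fin n) ℝ) (e : Fin n → L) :
    Prop where
  lie : ∀ x y, m.frame e (m.vec (m.br x y)) = ⁅m.frame e (m.vec x), m.frame e (m.vec y)⁆
  metric : ∀ x y, P.metric (m.frame e (m.vec x)) (m.frame e (m.vec y)) = x ⬝ᵥ g.mulVec y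
  J : ∀ x, m.frame e (m.vec (J.mulVec x)) = P.J (m.frame e (m.vec x))

variable {m} [FiniteDimensional ℝ L]

/-- The isomorphism with a coordinate pseudo-Kähler Lie algebra given by an adapted frame. -/
def IsAdaptedFrame.equiv {P' : PseudoKahler m.Alg} {g J : Matrix (Fin n) (Fin n) ℝ}
    {e : Fin n → L} (h : m.IsAdaptedFrame P g J e) (hL : Module.finrank ℝ L = n)
    (hg : P'.metric = m.form g) (hJ : P'.J = m.lin J) : PseudoKahlerEquiv P' P :=
  PseudoKahlerEquiv.ofLinearMap (m.frame e) (m.finrank_alg.trans hL.symm) h.lie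
    (fun x y => (h.metric x y).trans (by rw [hg]; exact (m.form_vec g x y).symm))
    (fun x => (congrArg _ (by rw [hJ]; exact m.lin_vec J x)).trans (h.J x))

end LieModel

/-- A unit vector in a Kähler plane gives an isomorphism with the standard plane. -/
def planeKahlerEquiv [FiniteDimensional ℝ L] [IsLieAbelian L] (hL : Module.finrank ℝ L = 2) {a : L}
    (ha : P.metric a a = 1) : PseudoKahlerEquiv planeKahler P :=
  LieModel.IsAdaptedFrame.equiv (m := abelian 2) (g := 1) (J := !![0, -1; 1, 0]) (e := ![a, P.J a])
    { lie := fun x y => (map_zero _).trans (trivial_lie_zero _ _ _ _).symm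
      metric := fun x y => by
        simp only [LieModel.frame_vec, Fin.sum_univ_two, Matrix.cons_val_zero, Matrix.cons_val_one,
          map_add, map_smul, LinearMap.add_apply, LinearMap.smul_apply, smul_eq_mul, P.compat,
          P.metric_J_self, P.metric_self_J, ha, Matrix.one_mulVec, dotProduct]
        ring
      J := fun x => by
        simp [LieModel.frame_vec, Fin.sum_univ_two, P.J_sq, add_comm, dotProduct] }
    hL rfl rfl

theorem planeKahlerEquiv_vec [FiniteDimensional ℝ L] [IsLieAbelian L]
    (hL : Module.finrank ℝ L = 2) {a : L} (ha : P.metric a a = 1) (v : Fin 2 → ℝ) :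
    (planeKahlerEquiv hL ha).toLieEquiv ((abelian 2).vec v) = v 0 • a + v 1 • P.J a :=
  Fin.sum_univ_two fun i => v i • ![a, P.J a] i

end LieModel

section Extension

variable {G H : Type*} [LieRing G] [LieAlgebra ℝ G] [FiniteDimensional ℝ G] [LieRing H]
  [LieAlgebra ℝ H] [FiniteDimensional ℝ H] [IsLieAbelian H] {P : PseudoKahler G}
  {Q : PseudoKahler H} {n : ℕ} {m : LieModel n} {P' : PseudoKahler m.Alg}
  {g J M₁ M₂ : Matrix (Fin n) (Fin n) ℝ} {hg hJ hd₁ hd₂ hc hs h₁ h₂}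

theorem LieModel.extension_φ_vec (v : Fin 2 → ℝ) (x : Fin n → ℝ) :
    (m.extension P' g J M₁ M₂ hg hJ hd₁ hd₂ hc hs h₁ h₂).φ ((abelian 2).vec v) (m.vec x)
      = m.vec (v 0 • M₁.mulVec x + v 1 • M₂.mulVec x) := rfl

variable (E : PKExtension P Q) {e : Fin n → G} (hG : Module.finrank ℝ G = n)
  (hH : Module.finrank ℝ H = 2) (he : m.IsAdaptedFrame P g J e) {a : H} (ha : Q.metric a a = 1)

include hG hH he ha

theorem awRelated_extension (D : H →ₗ[ℝ] G →ₗ[ℝ] G)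
    (hD₁ : ∀ x, m.frame e (m.vec (M₁.mulVec x)) = D a (m.frame e (m.vec x)))
    (hD₂ : ∀ x, m.frame e (m.vec (M₂.mulVec x)) = D (Q.J a) (m.frame e (m.vec x)))
    (hsym : ∀ b, P.symPart ((E.φ b).toLinearMap - D b) = 0)
    (hcomm : ∀ b b' x, E.φ b (D b' x) = D b' (E.φ b x)) :
    AWRelated E (m.extension P' g J M₁ M₂ hg hJ hd₁ hd₂ hc hs h₁ h₂) := by
  let f := he.equiv hG hg hJ
  let k := planeKahlerEquiv hH ha
  refine awRelated_of_conj E _ f.symm k.symm D (fun b x => ?_) hsym hcomm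
  obtain ⟨c, rfl⟩ := k.surjective b
  obtain ⟨y, rfl⟩ := f.surjective x
  obtain ⟨v, rfl⟩ := (abelian 2).vec.surjective c
  obtain ⟨z, rfl⟩ := m.vec.surjective y
  have hD : m.frame e (m.vec (v 0 • M₁.mulVec z + v 1 • M₂.mulVec z))
      = D (k.toLieEquiv ((abelian 2).vec v)) (m.frame e (m.vec z)) := by
    rw [planeKahlerEquiv_vec hH ha]
    simp only [map_add, map_smul, LinearMap.add_apply, LinearMap.smul_apply, hD₁, hD₂]
  rw [f.symm_apply_apply, k.symm_apply_apply, LieModel.extension_φ_vec]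
  exact (f.symm_apply_apply _).symm.trans (congrArg f.symm.toLieEquiv hD)

theorem awRelated_extension_of_φ_eq
    (hφ₁ : ∀ x, m.frame e (m.vec (M₁.mulVec x)) = E.φ a (m.frame e (m.vec x)))
    (hφ₂ : ∀ x, m.frame e (m.vec (M₂.mulVec x)) = E.φ (Q.J a) (m.frame e (m.vec x))) :
    AWRelated E (m.extension P' g J M₁ M₂ hg hJ hd₁ hd₂ hc hs h₁ h₂) := by
  have hφ : ∀ b x, (E.sym + E.anti) b x = E.φ b x := fun b x => (E.φ_apply b x).symm
  refine awRelated_extension E hG hH he ha (E.sym + E.anti) (fun x => ?_) (fun x => ?_)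
    (fun b => ?_) (fun b b' x => ?_)
  · rw [hφ₁, hφ]
  · rw [hφ₂, hφ]
  · rw [PseudoHermitian.symPart_eq_zero_iff]
    intro x y
    simp [E.φ_apply]
  · rw [hφ, hφ, E.φ_commute]

theorem awRelated_extension_of_sym_eq
    (hS₁ : ∀ x, m.frame e (m.vec (M₁.mulVec x)) = E.sym a (m.frame e (m.vec x)))
    (hS₂ : ∀ x, m.frame e (m.vec (M₂.mulVec x)) = E.sym (Q.J a) (m.frame e (m.vec x)))
    (hSS : ∀ x, E.sym a (E.sym a x) = 0)
    (hSA : ∀ x, E.sym a (E.anti a x) = 0) (hSB : ∀ x, E.sym a (E.anti (Q.J a) x) = 0)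
    (hAS : ∀ x, E.anti a (E.sym a x) = 0) (hBS : ∀ x, E.anti (Q.J a) (E.sym a x) = 0) :
    AWRelated E (m.extension P' g J M₁ M₂ hg hJ hd₁ hd₂ hc hs h₁ h₂) := by
  refine awRelated_extension E hG hH he ha E.sym hS₁ hS₂ (fun b => ?_) (fun b b' x => ?_)
  · rw [PseudoHermitian.symPart_eq_zero_iff]
    intro x y
    simp [E.φ_apply, E.anti_skew]
  · obtain ⟨v, hv⟩ := (planeKahlerEquiv hH ha).surjective b
    obtain ⟨v', hv'⟩ := (planeKahlerEquiv hH ha).surjective b'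
    obtain ⟨v, rfl⟩ := (abelian 2).vec.surjective v
    obtain ⟨v', rfl⟩ := (abelian 2).vec.surjective v'
    rw [E.φ_apply, E.φ_apply]
    simp only [← hv, ← hv', planeKahlerEquiv_vec, map_add, map_smul, E.sym_J,
      E.sym_J_right, E.anti_J_right, LinearMap.add_apply, LinearMap.smul_apply,
      LinearMap.comp_apply, hSS, hSA, hSB, hAS, hBS, map_zero, neg_zero, add_zero, smul_zero]

end Extension

/-! ## Extensions forcing the Lie algebra to be abelian -/

section Derivation

variable {K L : Type*} [Field K] [CharZero K] [LieRing L] [LieAlgebra K L]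

theorem lie_eq_zero_of_derivation_sq (D : LieDerivation K L L) {c : K} (hc : c ≠ 0)
    (hD : ∀ x, D (D x) = c • x) (x y : L) : ⁅x, y⁆ = 0 := by
  have hlie : ∀ x y : L, ⁅D x, D y⁆ = (-c / 2) • ⁅x, y⁆ := fun x y => by
    have h := hD ⁅x, y⁆
    simp only [LieDerivation.apply_lie_eq_add, map_add, hD, smul_lie, lie_smul] at h
    linear_combination (norm := module) (1 / 2 : K) • h
  have h := hlie (D x) (D y)
  rw [hD, hD, hlie, smul_lie, lie_smul] at h
  have hzero : (c ^ 2 * (3 / 4)) • ⁅x, y⁆ = 0 := by linear_combination (norm := module) h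
  exact (smul_eq_zero.1 hzero).resolve_left (mul_ne_zero (pow_ne_zero 2 hc) (by norm_num))

theorem lie_eq_zero_of_derivation_mul (X Y : LieDerivation K L L) {c : K} (hc : c ≠ 0)
    (hXX : ∀ x, X (X x) = Y (Y x)) (hXY : ∀ x, X (Y x) = c • x) (hYX : ∀ x, Y (X x) = c • x)
    (x y : L) : ⁅x, y⁆ = 0 := by
  have hmixed : ∀ x y : L, ⁅X x, Y y⁆ + ⁅Y x, X y⁆ = -c • ⁅x, y⁆ := fun x y => by
    have h := hXY ⁅x, y⁆
    simp only [LieDerivation.apply_lie_eq_add, map_add, hXY, smul_lie, lie_smul] at h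
    linear_combination (norm := module) h
  have hsq : ∀ x y : L, ⁅X (X x), X (X y)⁆ = (-c ^ 2 / 2) • ⁅x, y⁆ := fun x y => by
    have hXY_mixed := hmixed (X x) (Y y)
    have hYX_mixed := hmixed (Y x) (X y)
    rw [hYX, hXY, ← hXX, smul_lie, lie_smul] at hXY_mixed hYX_mixed
    linear_combination (norm := module)
      (1 / 2 : K) • hXY_mixed + (1 / 2 : K) • hYX_mixed - (c / 2) • hmixed x y
  have hpow : ∀ x, X (X (X (X x))) = c ^ 2 • x := fun x => by
    rw [hXX x, hXY, map_smul, hXY, smul_smul, sq]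
  have h := hsq (X (X x)) (X (X y))
  rw [hpow, hpow, hsq, smul_lie, lie_smul] at h
  have hzero : (c ^ 4 * (3 / 4)) • ⁅x, y⁆ = 0 := by linear_combination (norm := module) h
  exact (smul_eq_zero.1 hzero).resolve_left (mul_ne_zero (pow_ne_zero 4 hc) (by norm_num))

end Derivation

section Frame

variable {G : Type*} [LieRing G] [LieAlgebra ℝ G] {P : PseudoKahler G}

theorem LieModel.frame_vec_four (m : LieModel 4) (e₁ e₂ e₃ e₄ : G) (x₁ x₂ x₃ x₄ : ℝ) :
    m.frame ![e₁, e₂, e₃, e₄] (m.vec ![x₁, x₂, x₃, x₄])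
      = x₁ • e₁ + x₂ • e₂ + x₃ • e₃ + x₄ • e₄ :=
  (m.frame_vec _ _).trans (Fin.sum_univ_four _)

theorem isAdaptedFrame_r4Kahler (hab : ∀ x y : G, ⁅x, y⁆ = 0) {e₁ e₂ : G}
    (h₁ : P.metric e₁ e₁ = 1) (h₂ : P.metric e₂ e₂ = -1) (h₁₂ : P.metric e₁ e₂ = 0)
    (h₁J : P.metric e₁ (P.J e₂) = 0) :
    (abelian 4).IsAdaptedFrame P !![1, 0, 0, 0; 0, -1, 0, 0; 0, 0, 1, 0; 0, 0, 0, -1]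
      !![0, 0, -1, 0; 0, 0, 0, -1; 1, 0, 0, 0; 0, 1, 0, 0] ![e₁, e₂, P.J e₁, P.J e₂] where
  lie x y := (map_zero _).trans (hab _ _).symm
  metric := forall_four fun x₁ x₂ x₃ x₄ => forall_four fun y₁ y₂ y₃ y₄ => by
    have h₂₁ : P.metric e₂ e₁ = 0 := by rw [P.metric_comm, h₁₂]
    have hJ₂₁ : P.metric (P.J e₂) e₁ = 0 := by rw [P.metric_comm, h₁J]
    have hJ₁₂ : P.metric (P.J e₁) e₂ = 0 := by rw [P.metric_J_left, h₁J, neg_zero]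
    have h₂J : P.metric e₂ (P.J e₁) = 0 := by rw [P.metric_comm, hJ₁₂]
    simp only [LieModel.frame_vec_four, mulVec_four, dotProduct_four, map_add, map_smul,
      LinearMap.add_apply, LinearMap.smul_apply, smul_eq_mul, P.compat, P.metric_J_self,
      P.metric_self_J, h₁, h₂, h₁₂, h₁J, h₂₁, hJ₂₁, hJ₁₂, h₂J]
    ring
  J := forall_four fun _ _ _ _ => by
    simp only [LieModel.frame_vec_four, mulVec_four, map_add, map_smul, P.J_sq]
    module

namespace IsHyperbolicPair

variable {v w : G} (h : IsHyperbolicPair P.toPseudoHermitian v w)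

include h

theorem smul {s : ℝ} (hs : s ≠ 0) :
    IsHyperbolicPair P.toPseudoHermitian (s • v) (s⁻¹ • w) := by
  constructor <;> simp [h.vv, h.ww, h.vw, h.v_Jw, hs]

theorem metric_half_add : P.metric ((1 / 2 : ℝ) • v + w) ((1 / 2 : ℝ) • v + w) = 1 := by
  simp only [map_add, map_smul, LinearMap.add_apply, LinearMap.smul_apply, smul_eq_mul, h.vv,
    h.ww, h.vw, h.wv]
  norm_num

theorem metric_half_sub : P.metric ((1 / 2 : ℝ) • v - w) ((1 / 2 : ℝ) • v - w) = -1 := by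
  simp only [map_sub, map_smul, LinearMap.sub_apply, LinearMap.smul_apply, smul_eq_mul, h.vv,
    h.ww, h.vw, h.wv]
  norm_num

theorem metric_half_add_half_sub :
    P.metric ((1 / 2 : ℝ) • v + w) ((1 / 2 : ℝ) • v - w) = 0 := by
  simp only [map_add, map_sub, map_smul, LinearMap.add_apply, LinearMap.smul_apply, smul_eq_mul,
    h.vv, h.ww, h.vw, h.wv]
  norm_num

theorem metric_half_add_J_half_sub :
    P.metric ((1 / 2 : ℝ) • v + w) (P.J ((1 / 2 : ℝ) • v - w)) = 0 := by
  simp only [map_add, map_sub, map_smul, LinearMap.add_apply, LinearMap.smul_apply, smul_eq_mul,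
    P.metric_J_self, h.v_Jw, h.w_Jv]
  norm_num

end IsHyperbolicPair

end Frame

theorem exists_rotation_onto_ray (p q : ℝ) : ∃ x y : ℝ, x ^ 2 + y ^ 2 = 1 ∧
    x * p + y * q = √(p ^ 2 + q ^ 2) ∧ x * q - y * p = 0 := by
  by_cases hpq : p ^ 2 + q ^ 2 = 0
  · obtain ⟨hp, hq⟩ : p = 0 ∧ q = 0 :=
      mul_self_add_mul_self_eq_zero.1 (by linear_combination hpq)
    exact ⟨1, 0, by norm_num, by simp [hp, hq], by simp [hq]⟩
  · have hn : √(p ^ 2 + q ^ 2) ^ 2 = p ^ 2 + q ^ 2 := Real.sq_sqrt (by positivity)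
    have hn0 : √(p ^ 2 + q ^ 2) ≠ 0 := fun h => hpq (by rw [← hn, h, zero_pow two_ne_zero])
    refine ⟨p / √(p ^ 2 + q ^ 2), q / √(p ^ 2 + q ^ 2), ?_, ?_, by ring⟩
    · rw [div_pow, div_pow, hn, ← add_div, div_self hpq]
    · field_simp
      exact hn.symm

section ExtensionNormalForm

variable {G H : Type*} [LieRing G] [LieAlgebra ℝ G] [FiniteDimensional ℝ G] [LieRing H]
  [LieAlgebra ℝ H] {P : PseudoKahler G} {Q : PseudoKahler H}
  {E : PKExtension P Q} {a : H} {v w : G} {κ α₁ α₂ β β' : ℝ}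

namespace IsExtensionNormalForm

section Formulas

variable (h : IsExtensionNormalForm E a v w κ α₁ α₂ β β')

include h

theorem φ_v : E.φ a v = α₁ • v + α₂ • P.J v + (κ + κ * β') • P.J w := by
  rw [E.φ_apply, h.S_v, h.A_v]
  module

theorem φ_Jv : E.φ a (P.J v) = -α₂ • v + α₁ • P.J v + (κ - κ * β') • w := by
  rw [E.φ_apply, E.sym_J_right, E.anti_J_right, h.S_v, h.A_v]
  simp only [map_add, map_smul, P.J_sq]
  module

theorem φ_w : E.φ a w = v + β • P.J v - α₁ • w + α₂ • P.J w := by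
  rw [E.φ_apply, h.S_w, h.A_w]
  module

theorem φ_Jw : E.φ a (P.J w) = -β • v - P.J v - α₂ • w - α₁ • P.J w := by
  rw [E.φ_apply, E.sym_J_right, E.anti_J_right, h.S_w, h.A_w]
  simp only [map_add, map_sub, map_smul, P.J_sq]
  module

theorem φ_J_v : E.φ (Q.J a) v = -α₂ • v + α₁ • P.J v - κ • w - (κ * β) • P.J w := by
  rw [E.φ_apply, E.sym_J, LinearMap.comp_apply, h.S_v, h.B_v]
  simp only [map_smul, P.J_sq]
  module

theorem φ_J_Jv : E.φ (Q.J a) (P.J v) = -α₁ • v - α₂ • P.J v + (κ * β) • w + κ • P.J w := by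
  rw [E.φ_apply, E.sym_J, LinearMap.comp_apply, E.sym_J_right, E.anti_J_right, h.S_v, h.B_v]
  simp only [map_add, map_sub, map_neg, map_smul, P.J_sq]
  module

theorem φ_J_w : E.φ (Q.J a) w = (1 + β') • P.J v + α₂ • w + α₁ • P.J w := by
  rw [E.φ_apply, E.sym_J, LinearMap.comp_apply, h.S_w, h.B_w]
  module

theorem φ_J_Jw : E.φ (Q.J a) (P.J w) = (1 - β') • v - α₁ • w + α₂ • P.J w := by
  rw [E.φ_apply, E.sym_J, LinearMap.comp_apply, E.sym_J_right, E.anti_J_right, h.S_w, h.B_w]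
  simp only [map_add, map_neg, map_smul, P.J_sq]
  module

end Formulas

end IsExtensionNormalForm

end ExtensionNormalForm

section AbelianCase

variable {G H : Type*} [LieRing G] [LieAlgebra ℝ G] [FiniteDimensional ℝ G] [LieRing H]
  [LieAlgebra ℝ H] {P : PseudoKahler G} {Q : PseudoKahler H} {E : PKExtension P Q} {a : H} {v w : G}

/-- The action of a unit vector `a` and of `Q.J a` in a hyperbolic pair when the square of the
symmetric part of `E.φ a` is non-zero; `t` is the parameter of `r4Semisimple`. -/
structure IsSemisimpleForm (E : PKExtension P Q) (a : H) (v w : G) (t : ℝ) : Prop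
    extends IsHyperbolicPair P.toPseudoHermitian v w where
  pos : 0 < t
  unit : Q.metric a a = 1
  φ_v : E.φ a v = (2 * t) • (w + P.J w)
  φ_Jv : E.φ a (P.J v) = (2 * t) • (w - P.J w)
  φ_w : E.φ a w = (t / 2) • (v + P.J v)
  φ_Jw : E.φ a (P.J w) = -(t / 2) • ((3 : ℝ) • v + P.J v)
  φ_J_v : E.φ (Q.J a) v = -(2 * t) • (w + P.J w)
  φ_J_Jv : E.φ (Q.J a) (P.J v) = (2 * t) • ((3 : ℝ) • w + P.J w)
  φ_J_w : E.φ (Q.J a) w = (t / 2) • (v + P.J v)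
  φ_J_Jw : E.φ (Q.J a) (P.J w) = (t / 2) • (v - P.J v)

theorem IsExtensionNormalForm.isSemisimpleForm {t ρ s : ℝ} (ht : 0 < t) (hρ : 2 * ρ ^ 2 = 1)
    (hs₀ : s ≠ 0) (hs : s ^ 2 * t = 2 * ρ)
    (h : IsExtensionNormalForm E a v w (2 * t ^ 2) 0 0 1 (-1)) :
    IsSemisimpleForm E (ρ • a - ρ • Q.J a) (s • v) (s⁻¹ • w) t := by
  have hJ : Q.J (ρ • a - ρ • Q.J a) = ρ • a + ρ • Q.J a := by
    rw [map_sub, map_smul, map_smul, Q.J_sq]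
    module
  have hφ : ∀ x, E.φ (ρ • a - ρ • Q.J a) x = ρ • (E.φ a x - E.φ (Q.J a) x) := fun x => by
    simp only [map_sub, map_smul, LieDerivation.sub_apply, LieDerivation.smul_apply, smul_sub]
  have hφJ : ∀ x, E.φ (ρ • a + ρ • Q.J a) x = ρ • (E.φ a x + E.φ (Q.J a) x) := fun x => by
    simp only [map_add, map_smul, LieDerivation.add_apply, LieDerivation.smul_apply, smul_add]
  have hv : ρ * t * s = s⁻¹ := by
    field_simp
    linear_combination ρ * hs + hρ
  have hw : ρ * s⁻¹ = t / 2 * s := by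
    field_simp
    linear_combination -hs
  refine ⟨h.toIsHyperbolicPair.smul hs₀, ht, ?_, ?_, ?_, ?_, ?_, ?_, ?_, ?_, ?_⟩
  · simp only [map_sub, map_smul, LinearMap.sub_apply, LinearMap.smul_apply, smul_eq_mul,
      Q.compat, Q.metric_J_self, Q.metric_self_J, h.unit]
    linear_combination hρ
  all_goals
    simp only [hJ, hφ, hφJ, map_smul, h.φ_v, h.φ_Jv, h.φ_w, h.φ_Jw, h.φ_J_v, h.φ_J_Jv, h.φ_J_w,
      h.φ_J_Jw]
  · linear_combination (norm := module) (2 * t * hv) • (w + P.J w)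
  · linear_combination (norm := module) (2 * t * hv) • (w - P.J w)
  · linear_combination (norm := module) hw • (v + P.J v)
  · linear_combination (norm := module) -hw • ((3 : ℝ) • v + P.J v)
  · linear_combination (norm := module) -(2 * t * hv) • (w + P.J w)
  · linear_combination (norm := module) (2 * t * hv) • ((3 : ℝ) • w + P.J w)
  · linear_combination (norm := module) hw • (v + P.J v)
  · linear_combination (norm := module) hw • (v - P.J v)

theorem IsExtensionNormalForm.exists_isSemisimpleForm {κ α₁ α₂ β β' : ℝ}
    (h : IsExtensionNormalForm E a v w κ α₁ α₂ β β') (hκ : κ ≠ 0) :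
    ∃ (a' : H) (v' w' : G) (t : ℝ), IsSemisimpleForm E a' v' w' t := by
  obtain rfl : α₁ = 0 := (mul_eq_zero.1 h.κ_α₁).resolve_left hκ
  obtain rfl : α₂ = 0 := (mul_eq_zero.1 h.κ_α₂).resolve_left hκ
  have hβ : β ^ 2 + β' ^ 2 = 2 := mul_left_cancel₀ hκ (by rw [h.κ_β]; ring)
  have hκ_pos : 0 < κ := lt_of_le_of_ne h.κ_nonneg hκ.symm
  have ht : 0 < √(κ / 2) := by positivity
  have hκt : κ = 2 * √(κ / 2) ^ 2 := by rw [Real.sq_sqrt (by positivity)]; ring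
  obtain ⟨v', w', h'⟩ := h.exists_rotate (c := (β - β') / 2) (s := (β + β') / 2)
    (by linear_combination (1 / 2 : ℝ) * hβ)
  rw [show (β - β') / 2 * β + (β + β') / 2 * β' = 1 by linear_combination (1 / 2 : ℝ) * hβ,
    show (β - β') / 2 * β' - (β + β') / 2 * β = -1 by linear_combination -(1 / 2 : ℝ) * hβ,
    hκt] at h'
  simp only [mul_zero, sub_zero, add_zero] at h'
  have hρ : 2 * (√2 / 2) ^ 2 = 1 := by
    rw [div_pow, Real.sq_sqrt two_pos.le]
    norm_num
  have hs : √(√2 / √(κ / 2)) ^ 2 * √(κ / 2) = 2 * (√2 / 2) := by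
    rw [Real.sq_sqrt (by positivity)]
    field_simp
  exact ⟨_, _, _, _, h'.isSemisimpleForm ht hρ (by positivity) hs⟩

namespace IsSemisimpleForm

variable {t : ℝ} (h : IsSemisimpleForm E a v w t) (hG : Module.finrank ℝ G = 4)

include h hG

theorem lie_eq_zero (x y : G) : ⁅x, y⁆ = 0 := by
  have hc : 2 * t ^ 2 ≠ 0 := mul_ne_zero two_ne_zero (pow_ne_zero 2 h.pos.ne')
  refine lie_eq_zero_of_derivation_mul (E.φ a) (E.φ (Q.J a)) hc (fun z => ?_) (fun z => ?_)
    (fun z => ?_) x y <;>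
  obtain ⟨p, q, r, s, rfl⟩ := h.exists_eq_comb hG z <;>
  simp only [map_add, map_sub, map_smul, h.φ_v, h.φ_Jv, h.φ_w, h.φ_Jw, h.φ_J_v, h.φ_J_Jv,
    h.φ_J_w, h.φ_J_Jw] <;>
  module

theorem awRelated [FiniteDimensional ℝ H] [IsLieAbelian H] (hH : Module.finrank ℝ H = 2) :
    AWRelated E (r4Semisimple t) := by
  have h₁ := h.metric_half_add
  have h₂ := h.metric_half_sub
  have h₁₂ := h.metric_half_add_half_sub
  have h₁J := h.metric_half_add_J_half_sub
  refine awRelated_extension_of_φ_eq E hG hH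
    (isAdaptedFrame_r4Kahler (h.lie_eq_zero hG) (e₁ := (1 / 2 : ℝ) • v + w)
      (e₂ := P.J ((1 / 2 : ℝ) • v - w)) h₁ ((P.compat _ _).trans h₂) h₁J
      (by rw [P.J_sq, map_neg, h₁₂, neg_zero]))
    h.unit (forall_four fun _ _ _ _ => ?_) (forall_four fun _ _ _ _ => ?_)
  all_goals
    simp only [LieModel.frame_vec_four, mulVec_four, map_add, map_sub, map_smul, map_neg, P.J_sq,
      h.φ_v, h.φ_Jv, h.φ_w, h.φ_Jw, h.φ_J_v, h.φ_J_Jv, h.φ_J_w, h.φ_J_Jw]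
    module

end IsSemisimpleForm

namespace IsExtensionNormalForm

variable {c β : ℝ}

theorem lie_eq_zero (h : IsExtensionNormalForm E a v w 0 c 0 β 0) (hc : c ≠ 0)
    (hG : Module.finrank ℝ G = 4) (x y : G) : ⁅x, y⁆ = 0 := by
  refine lie_eq_zero_of_derivation_sq (E.φ a) (pow_ne_zero 2 hc) (fun z => ?_) x y
  obtain ⟨p, q, r, s, rfl⟩ := h.exists_eq_comb hG z
  simp only [map_add, map_sub, map_smul, h.φ_v, h.φ_Jv, h.φ_w, h.φ_Jw]
  module

theorem exists_rotate_of_α_ne_zero {α₁ α₂ β β' : ℝ}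
    (h : IsExtensionNormalForm E a v w 0 α₁ α₂ β β') (hα : α₁ ^ 2 + α₂ ^ 2 ≠ 0) :
    ∃ (a' : H) (v' w' : G) (c b : ℝ), c ≠ 0 ∧ IsExtensionNormalForm E a' v' w' 0 c 0 b 0 := by
  obtain ⟨x, y, hxy, hre, him⟩ := exists_rotation_onto_ray α₁ α₂
  obtain ⟨v', w', h'⟩ := h.exists_rotate (c := x) (s := -y) (by rw [neg_sq, hxy])
  have hc : x * α₁ - -y * α₂ = √(α₁ ^ 2 + α₂ ^ 2) := by linear_combination hre
  have hc_ne : √(α₁ ^ 2 + α₂ ^ 2) ≠ 0 := (Real.sqrt_ne_zero (by positivity)).2 hα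
  rw [hc, show x * α₂ + -y * α₁ = 0 by linear_combination him] at h'
  have hβ' := h'.α_β
  rw [mul_zero, add_zero] at hβ'
  rw [(mul_eq_zero.1 hβ').resolve_right hc_ne] at h'
  exact ⟨_, _, _, _, _, hc_ne, h'⟩

variable [FiniteDimensional ℝ H] [IsLieAbelian H] (hG : Module.finrank ℝ G = 4)
  (hH : Module.finrank ℝ H = 2)

include hG hH

theorem awRelated_r4NonSemisimple (h : IsExtensionNormalForm E a v w 0 c 0 β 0) (hc : c ≠ 0) :
    AWRelated E (r4NonSemisimple 1 β c) := by
  refine awRelated_extension_of_φ_eq E hG hH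
    (isAdaptedFrame_r4Kahler (h.lie_eq_zero hc hG) h.metric_half_add h.metric_half_sub
      h.metric_half_add_half_sub h.metric_half_add_J_half_sub)
    h.unit (forall_four fun _ _ _ _ => ?_) (forall_four fun _ _ _ _ => ?_)
  all_goals
    simp only [LieModel.frame_vec_four, mulVec_four, map_add, map_sub, map_smul, h.φ_v, h.φ_Jv,
      h.φ_w, h.φ_Jw, h.φ_J_v, h.φ_J_Jv, h.φ_J_w, h.φ_J_Jw]
    module

end IsExtensionNormalForm

end AbelianCase

/-! ## Brackets in the nilpotent case -/

section Bracket

variable {G : Type*} [LieRing G] [LieAlgebra ℝ G] {P : PseudoKahler G} {v w : G}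

/-- The structure constants of a Lie algebra in the basis `v, J v, w, J w` attached to a hyperbolic
pair whose complex line `⟨v, J v⟩` is an abelian ideal. -/
structure HasStructureConstants (P : PseudoKahler G) (v w : G)
    (p₁ p₂ p₃ p₄ q₁ q₂ q₃ q₄ ζ₁ ζ₂ η₁ η₂ : ℝ) : Prop
    extends IsHyperbolicPair P.toPseudoHermitian v w where
  lie_v_Jv : ⁅v, P.J v⁆ = 0
  lie_w_v : ⁅w, v⁆ = p₁ • v + p₂ • P.J v
  lie_w_Jv : ⁅w, P.J v⁆ = p₃ • v + p₄ • P.J v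
  lie_Jw_v : ⁅P.J w, v⁆ = q₁ • v + q₂ • P.J v
  lie_Jw_Jv : ⁅P.J w, P.J v⁆ = q₃ • v + q₄ • P.J v
  lie_w_Jw : ⁅w, P.J w⁆ = ζ₁ • v + ζ₂ • P.J v + η₁ • w + η₂ • P.J w

/-- The shape that the brackets in a hyperbolic pair take when `E.φ` is nilpotent. The complex line
`⟨v, J v⟩` is an abelian ideal on which `w` acts as the complex number `m₁ + i m₂` and `J w` acts
as `-i (m₁ + i m₂)`. -/
structure IsBracketNormalForm (P : PseudoKahler G) (v w : G) (m₁ m₂ ζ₁ ζ₂ : ℝ) : Prop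
    extends IsHyperbolicPair P.toPseudoHermitian v w where
  lie_v_Jv : ⁅v, P.J v⁆ = 0
  lie_w_v : ⁅w, v⁆ = m₁ • v + m₂ • P.J v
  lie_w_Jv : ⁅w, P.J v⁆ = -m₂ • v + m₁ • P.J v
  lie_Jw_v : ⁅P.J w, v⁆ = m₂ • v - m₁ • P.J v
  lie_Jw_Jv : ⁅P.J w, P.J v⁆ = m₁ • v + m₂ • P.J v
  lie_w_Jw : ⁅w, P.J w⁆ = ζ₁ • v + ζ₂ • P.J v

namespace HasStructureConstants

variable {p₁ p₂ p₃ p₄ q₁ q₂ q₃ q₄ ζ₁ ζ₂ η₁ η₂ : ℝ}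
  (h : HasStructureConstants P v w p₁ p₂ p₃ p₄ q₁ q₂ q₃ q₄ ζ₁ ζ₂ η₁ η₂)

include h

theorem integrable_eq : q₃ - p₁ + (q₂ + p₄) = 0 ∧ q₄ - p₂ - (q₁ + p₃) = 0 := by
  have hN := P.integrable w v
  rw [h.lie_Jw_Jv, h.lie_w_v, h.lie_Jw_v, h.lie_w_Jv] at hN
  simp only [map_add, map_smul, P.J_sq] at hN
  obtain ⟨h₁, h₂, -, -⟩ := h.comb_eq_zero (p := q₃ - p₁ + (q₂ + p₄)) (q := q₄ - p₂ - (q₁ + p₃))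
    (r := 0) (s := 0) (by linear_combination (norm := module) hN)
  exact ⟨h₁, h₂⟩

theorem closed_eq : -η₂ - q₂ - p₁ = 0 ∧ η₁ - q₄ - p₃ = 0 := by
  have hv := P.closed w (P.J w) v
  have hJv := P.closed w (P.J w) (P.J v)
  rw [h.lie_w_Jw, h.lie_Jw_v, ← lie_skew, h.lie_w_v] at hv
  rw [h.lie_w_Jw, h.lie_Jw_Jv, ← lie_skew, h.lie_w_Jv] at hJv
  simp only [PseudoHermitian.omega, map_add, map_neg, map_smul, LinearMap.add_apply,
    LinearMap.neg_apply, LinearMap.smul_apply, smul_eq_mul, P.J_sq, P.compat, P.metric_J_self,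
    P.metric_self_J, h.vv, h.vw, h.v_Jw, h.wv, h.Jv_w, h.Jw_v, h.w_Jv] at hv hJv
  constructor <;> linarith

theorem jacobi_eq :
    η₁ * p₁ + η₂ * q₁ = q₂ * p₃ - p₂ * q₃ ∧
      η₁ * p₂ + η₂ * q₂ = q₁ * p₂ + q₂ * p₄ - p₁ * q₂ - p₂ * q₄ ∧
      η₁ * p₃ + η₂ * q₃ = q₃ * p₁ + q₄ * p₃ - p₃ * q₁ - p₄ * q₃ ∧
      η₁ * p₄ + η₂ * q₄ = q₃ * p₂ - p₃ * q₂ := by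
  have hv := lie_lie w (P.J w) v
  have hJv := lie_lie w (P.J w) (P.J v)
  have hJvv : ⁅P.J v, v⁆ = 0 := by rw [← lie_skew, h.lie_v_Jv, neg_zero]
  simp only [h.lie_w_Jw, add_lie, smul_lie, lie_add, lie_smul, h.lie_w_v, h.lie_w_Jv, h.lie_Jw_v,
    h.lie_Jw_Jv, h.lie_v_Jv, hJvv, lie_self] at hv hJv
  obtain ⟨h₁, h₂, -, -⟩ := h.comb_eq_zero
    (p := η₁ * p₁ + η₂ * q₁ - (q₂ * p₃ - p₂ * q₃))
    (q := η₁ * p₂ + η₂ * q₂ - (q₁ * p₂ + q₂ * p₄ - p₁ * q₂ - p₂ * q₄)) (r := 0)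
    (s := 0) (by linear_combination (norm := module) hv)
  obtain ⟨h₃, h₄, -, -⟩ := h.comb_eq_zero
    (p := η₁ * p₃ + η₂ * q₃ - (q₃ * p₁ + q₄ * p₃ - p₃ * q₁ - p₄ * q₃))
    (q := η₁ * p₄ + η₂ * q₄ - (q₃ * p₂ - p₃ * q₂)) (r := 0)
    (s := 0) (by linear_combination (norm := module) hJv)
  exact ⟨sub_eq_zero.1 h₁, sub_eq_zero.1 h₂, sub_eq_zero.1 h₃, sub_eq_zero.1 h₄⟩

theorem η_eq_zero (hη₁ : η₁ = p₂ - q₄) (hη₂ : η₂ = p₁ - q₃) : η₁ = 0 ∧ η₂ = 0 := by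
  obtain ⟨n₁, n₂⟩ := h.integrable_eq
  obtain ⟨c₁, c₂⟩ := h.closed_eq
  obtain ⟨j₁, j₂, j₃, j₄⟩ := h.jacobi_eq
  obtain rfl : p₁ = η₂ + q₃ := by linarith
  obtain rfl : p₂ = η₁ + q₄ := by linarith
  obtain rfl : p₃ = η₁ - q₄ := by linarith
  obtain rfl : q₁ = q₄ - 2 * η₁ := by linarith
  obtain rfl : q₂ = -2 * η₂ - q₃ := by linarith
  obtain rfl : p₄ = 3 * η₂ + q₃ := by linarith
  have hL : η₁ * q₄ - η₂ * q₃ - η₂ ^ 2 + 2 * (η₁ ^ 2 + η₂ ^ 2) = 0 := by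
    linear_combination (j₂ - j₃) / 2
  have hM₁ : -η₁ * (η₂ + 2 * q₃) + η₂ * (2 * q₄ + η₁) = 0 := by
    linear_combination -(j₁ - j₄) / 2
  have hM₂ : η₂ * (η₂ + 2 * q₃) + η₁ * (2 * q₄ + η₁) = 0 := by
    linear_combination (j₂ + j₃) / 2
  have hN₁ : (η₁ ^ 2 + η₂ ^ 2) * (η₂ + 2 * q₃) = 0 := by
    linear_combination η₂ * hM₂ - η₁ * hM₁
  have hN₂ : (η₁ ^ 2 + η₂ ^ 2) * (2 * q₄ + η₁) = 0 := by
    linear_combination η₂ * hM₁ + η₁ * hM₂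
  have hN : (η₁ ^ 2 + η₂ ^ 2) ^ 2 = 0 := by
    linear_combination (2 / 3) * (η₁ ^ 2 + η₂ ^ 2) * hL - (1 / 3) * η₁ * hN₂ + (1 / 3) * η₂ * hN₁
  have hη : η₁ ^ 2 + η₂ ^ 2 = 0 := pow_eq_zero_iff two_ne_zero |>.1 hN
  exact mul_self_add_mul_self_eq_zero.1 (by linear_combination hη)

theorem isBracketNormalForm (hη₁ : η₁ = p₂ - q₄) (hη₂ : η₂ = p₁ - q₃) :
    IsBracketNormalForm P v w p₁ p₂ ζ₁ ζ₂ := by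
  obtain ⟨rfl, rfl⟩ := h.η_eq_zero hη₁ hη₂
  obtain ⟨n₁, n₂⟩ := h.integrable_eq
  obtain ⟨c₁, c₂⟩ := h.closed_eq
  obtain rfl : q₃ = p₁ := by linarith
  obtain rfl : q₄ = p₂ := by linarith
  obtain rfl : p₃ = -q₄ := by linarith
  obtain rfl : q₂ = -q₃ := by linarith
  obtain rfl : p₄ = q₃ := by linarith
  obtain rfl : q₁ = q₄ := by linarith
  exact ⟨h.toIsHyperbolicPair, h.lie_v_Jv, h.lie_w_v, h.lie_w_Jv,
    h.lie_Jw_v.trans (by module), h.lie_Jw_Jv, h.lie_w_Jw.trans (by module)⟩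

end HasStructureConstants

namespace IsBracketNormalForm

variable {m₁ m₂ ζ₁ ζ₂ : ℝ} (h : IsBracketNormalForm P v w m₁ m₂ ζ₁ ζ₂)

include h

theorem lie_Jv_v : ⁅P.J v, v⁆ = 0 := by rw [← lie_skew, h.lie_v_Jv, neg_zero]

theorem lie_v_w : ⁅v, w⁆ = -(m₁ • v + m₂ • P.J v) := by rw [← h.lie_w_v, lie_skew]

theorem lie_Jv_w : ⁅P.J v, w⁆ = m₂ • v - m₁ • P.J v := by
  rw [← lie_skew, h.lie_w_Jv]
  module

theorem lie_v_Jw : ⁅v, P.J w⁆ = -(m₂ • v - m₁ • P.J v) := by rw [← h.lie_Jw_v, lie_skew]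

theorem lie_Jv_Jw : ⁅P.J v, P.J w⁆ = -(m₁ • v + m₂ • P.J v) := by rw [← h.lie_Jw_Jv, lie_skew]

theorem lie_Jw_w : ⁅P.J w, w⁆ = -(ζ₁ • v + ζ₂ • P.J v) := by rw [← h.lie_w_Jw, lie_skew]

theorem rotate {x y : ℝ} (hxy : x ^ 2 + y ^ 2 = 1) :
    IsBracketNormalForm P (x • v + y • P.J v) (x • w + y • P.J w) (x * m₁ + y * m₂)
      (x * m₂ - y * m₁) (x * ζ₁ + y * ζ₂) (x * ζ₂ - y * ζ₁) := by
  refine ⟨h.toIsHyperbolicPair.rotate hxy, ?_, ?_, ?_, ?_, ?_, ?_⟩ <;>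
  simp only [map_add, map_smul, P.J_sq, add_lie, lie_add, smul_lie, lie_smul, neg_lie, lie_neg,
    lie_self, h.lie_v_Jv, h.lie_w_v, h.lie_w_Jv, h.lie_Jw_v, h.lie_Jw_Jv, h.lie_w_Jw, h.lie_Jv_v,
    h.lie_Jw_w] <;>
  module

omit h in
theorem lie_eq_zero (h : IsBracketNormalForm P v w 0 0 0 0) (hG : Module.finrank ℝ G = 4)
    (x y : G) : ⁅x, y⁆ = 0 := by
  obtain ⟨p, q, r, s, rfl⟩ := h.exists_eq_comb hG x
  obtain ⟨p', q', r', s', rfl⟩ := h.exists_eq_comb hG y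
  simp only [add_lie, lie_add, smul_lie, lie_smul, lie_self, h.lie_v_Jv, h.lie_w_v, h.lie_w_Jv,
    h.lie_Jw_v, h.lie_Jw_Jv, h.lie_w_Jw, h.lie_Jv_v, h.lie_v_w, h.lie_Jv_w, h.lie_v_Jw,
    h.lie_Jv_Jw, h.lie_Jw_w]
  module

end IsBracketNormalForm

end Bracket

section NilpotentFrame

variable {G : Type*} [LieRing G] [LieAlgebra ℝ G] {P : PseudoKahler G} {e₁ e₃ : G}

theorem isAdaptedFrame_rh3Kahler (h₁₁ : P.metric e₁ e₁ = 0) (h₁₃ : P.metric e₁ e₃ = 1)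
    (h₃₃ : P.metric e₃ e₃ = 0) (h₁J : P.metric e₁ (P.J e₃) = 0) (l₁J : ⁅e₁, P.J e₁⁆ = e₃)
    (l₁₃ : ⁅e₁, e₃⁆ = 0) (l₁₄ : ⁅e₁, P.J e₃⁆ = 0) (l₂₃ : ⁅P.J e₁, e₃⁆ = 0)
    (l₂₄ : ⁅P.J e₁, P.J e₃⁆ = 0) (l₃J : ⁅e₃, P.J e₃⁆ = 0) :
    rh3.IsAdaptedFrame P !![0, 0, 1, 0; 0, 0, 0, 1; 1, 0, 0, 0; 0, 1, 0, 0]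
      !![0, -1, 0, 0; 1, 0, 0, 0; 0, 0, 0, -1; 0, 0, 1, 0] ![e₁, P.J e₁, e₃, P.J e₃] where
  lie := forall_four fun _ _ _ _ => forall_four fun _ _ _ _ => by
    have lie_swap {x y z : G} (h : ⁅x, y⁆ = z) : ⁅y, x⁆ = -z := by rw [← h, lie_skew]
    simp only [rh3_br, LieModel.frame_vec_four, add_lie, lie_add, smul_lie, lie_smul, lie_self,
      l₁J, l₁₃, l₁₄, l₂₃, l₂₄, l₃J, lie_swap l₁J, lie_swap l₁₃, lie_swap l₁₄, lie_swap l₂₃,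
      lie_swap l₂₄, lie_swap l₃J]
    module
  metric := forall_four fun _ _ _ _ => forall_four fun _ _ _ _ => by
    have h₃₁ : P.metric e₃ e₁ = 1 := by rw [P.metric_comm, h₁₃]
    have hJ₃₁ : P.metric (P.J e₃) e₁ = 0 := by rw [P.metric_comm, h₁J]
    have hJ₁₃ : P.metric (P.J e₁) e₃ = 0 := by rw [P.metric_J_left, h₁J, neg_zero]
    have h₃J : P.metric e₃ (P.J e₁) = 0 := by rw [P.metric_comm, hJ₁₃]
    simp only [LieModel.frame_vec_four, mulVec_four, dotProduct_four, map_add, map_smul,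
      LinearMap.add_apply, LinearMap.smul_apply, smul_eq_mul, P.compat, P.metric_J_self,
      P.metric_self_J, h₁₁, h₁₃, h₃₃, h₁J, h₃₁, hJ₃₁, hJ₁₃, h₃J]
    ring
  J := forall_four fun _ _ _ _ => by
    simp only [LieModel.frame_vec_four, mulVec_four, map_add, map_smul, P.J_sq]
    module

theorem isAdaptedFrame_rp2Kahler {p q r : ℝ} (h₁₁ : P.metric e₁ e₁ = p)
    (h₁₃ : P.metric e₁ e₃ = -r) (h₃₃ : P.metric e₃ e₃ = 0) (h₁J : P.metric e₁ (P.J e₃) = q)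
    (l₁J : ⁅e₁, P.J e₁⁆ = 0) (l₁₃ : ⁅e₁, e₃⁆ = e₃) (l₁₄ : ⁅e₁, P.J e₃⁆ = P.J e₃)
    (l₂₃ : ⁅P.J e₁, e₃⁆ = -P.J e₃) (l₂₄ : ⁅P.J e₁, P.J e₃⁆ = e₃) (l₃J : ⁅e₃, P.J e₃⁆ = 0) :
    rp2.IsAdaptedFrame P !![p, 0, -r, q; 0, p, q, r; -r, q, 0, 0; q, r, 0, 0]
      !![0, 1, 0, 0; -1, 0, 0, 0; 0, 0, 0, -1; 0, 0, 1, 0] ![e₁, -P.J e₁, e₃, P.J e₃] where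
  lie := forall_four fun _ _ _ _ => forall_four fun _ _ _ _ => by
    have lie_swap {x y z : G} (h : ⁅x, y⁆ = z) : ⁅y, x⁆ = -z := by rw [← h, lie_skew]
    simp only [rp2_br, LieModel.frame_vec_four, add_lie, lie_add, smul_lie, lie_smul, neg_lie,
      lie_neg, lie_self, l₁J, l₁₃, l₁₄, l₂₃, l₂₄, l₃J, lie_swap l₁J, lie_swap l₁₃, lie_swap l₁₄,
      lie_swap l₂₃, lie_swap l₂₄, lie_swap l₃J]
    module
  metric := forall_four fun _ _ _ _ => forall_four fun _ _ _ _ => by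
    have h₃₁ : P.metric e₃ e₁ = -r := by rw [P.metric_comm, h₁₃]
    have hJ₃₁ : P.metric (P.J e₃) e₁ = q := by rw [P.metric_comm, h₁J]
    have hJ₁₃ : P.metric (P.J e₁) e₃ = -q := by rw [P.metric_J_left, h₁J]
    have h₃J : P.metric e₃ (P.J e₁) = -q := by rw [P.metric_comm, hJ₁₃]
    simp only [LieModel.frame_vec_four, mulVec_four, dotProduct_four, map_add, map_neg, map_smul,
      LinearMap.add_apply, LinearMap.neg_apply, LinearMap.smul_apply, smul_eq_mul, P.compat,
      P.metric_J_self, P.metric_self_J, h₁₁, h₁₃, h₃₃, h₁J, h₃₁, hJ₃₁, hJ₁₃, h₃J]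
    ring
  J := forall_four fun _ _ _ _ => by
    simp only [LieModel.frame_vec_four, mulVec_four, map_add, map_neg, map_smul, P.J_sq]
    module

namespace IsBracketNormalForm

variable {v w : G}

theorem isAdaptedFrame_rh3Kahler {ζ s : ℝ} (h : IsBracketNormalForm P v w 0 0 ζ 0) (hs : s ≠ 0)
    (hsζ : s ^ 3 * ζ = 1) :
    rh3.IsAdaptedFrame P !![0, 0, 1, 0; 0, 0, 0, 1; 1, 0, 0, 0; 0, 1, 0, 0]
      !![0, -1, 0, 0; 1, 0, 0, 0; 0, 0, 0, -1; 0, 0, 1, 0]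
      ![s • w, P.J (s • w), s⁻¹ • v, P.J (s⁻¹ • v)] := by
  have hs' : s ^ 2 * ζ = s⁻¹ := eq_inv_of_mul_eq_one_left (by linear_combination hsζ)
  apply PK.isAdaptedFrame_rh3Kahler
  case l₁J =>
    simp only [map_smul, smul_lie, lie_smul, h.lie_w_Jw]
    linear_combination (norm := module) hs' • v
  all_goals
    simp [h.ww, h.wv, h.vv, h.w_Jv, hs, h.lie_w_v, h.lie_w_Jv, h.lie_Jw_v, h.lie_Jw_Jv, h.lie_v_Jv]

/-- The multiple `μ w` acts on `⟨v, J v⟩` as the identity; adding a suitable combination of `v` and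
`J v` makes it commute with its image under `J`. -/
theorem isAdaptedFrame_rp2Kahler {m ζ₁ ζ₂ μ : ℝ} (h : IsBracketNormalForm P v w m 0 ζ₁ ζ₂)
    (hμ : μ * m = 1) :
    let e := μ • w + (-(μ ^ 2 * ζ₂) / 2) • v + (μ ^ 2 * ζ₁ / 2) • P.J v
    rp2.IsAdaptedFrame P !![-(μ ^ 3 * ζ₂), 0, - -μ ^ 2, 0; 0, -(μ ^ 3 * ζ₂), 0, -μ ^ 2;
      - -μ ^ 2, 0, 0, 0; 0, -μ ^ 2, 0, 0]
      !![0, 1, 0, 0; -1, 0, 0, 0; 0, 0, 0, -1; 0, 0, 1, 0] ![e, -P.J e, μ • v, P.J (μ • v)] := by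
  intro e
  apply PK.isAdaptedFrame_rp2Kahler
  all_goals
    simp only [e, map_add, map_smul, P.J_sq, LinearMap.add_apply, LinearMap.smul_apply,
      smul_eq_mul, P.metric_self_J, P.metric_J_self, P.compat, h.ww, h.wv, h.vw, h.vv, h.w_Jv,
      h.Jv_w, add_lie, lie_add, smul_lie, lie_smul, lie_neg, neg_lie, lie_self, h.lie_w_Jw,
      h.lie_w_v, h.lie_w_Jv, h.lie_Jw_v, h.lie_Jw_Jv, h.lie_v_Jv, h.lie_Jv_v, h.lie_v_Jw,
      h.lie_Jv_Jw]
  case l₁J =>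
    linear_combination (norm := module) -hμ • ((μ ^ 2 * ζ₁) • v + (μ ^ 2 * ζ₂) • P.J v)
  case l₁₃ => linear_combination (norm := module) hμ • (μ • v)
  case l₁₄ => linear_combination (norm := module) hμ • (μ • P.J v)
  case l₂₃ => linear_combination (norm := module) -hμ • (μ • P.J v)
  case l₂₄ => linear_combination (norm := module) hμ • (μ • v)
  case l₃J => module
  all_goals ring

end IsBracketNormalForm

end NilpotentFrame

section NilpotentCase

variable {G H : Type*} [LieRing G] [LieAlgebra ℝ G] [FiniteDimensional ℝ G] [LieRing H]
  [LieAlgebra ℝ H] {P : PseudoKahler G} {Q : PseudoKahler H}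
  {E : PKExtension P Q} {a : H} {v w : G}

namespace IsExtensionNormalForm

section Brackets

variable {β : ℝ} (h : IsExtensionNormalForm E a v w 0 0 0 β 0)

include h

theorem φ_J_comb (p q r s : ℝ) :
    E.φ (Q.J a) (p • v + q • P.J v + r • w + s • P.J w) = s • v + r • P.J v := by
  simp only [map_add, map_smul, h.φ_J_v, h.φ_J_Jv, h.φ_J_w, h.φ_J_Jw]
  module

theorem φ_J_eq_zero_iff (hG : Module.finrank ℝ G = 4) {x : G} :
    E.φ (Q.J a) x = 0 ↔ ∃ p q : ℝ, x = p • v + q • P.J v := by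
  obtain ⟨p, q, r, s, rfl⟩ := h.exists_eq_comb hG x
  rw [h.φ_J_comb]
  constructor
  · intro hx
    obtain ⟨rfl, rfl, -, -⟩ := h.comb_eq_zero (p := s) (q := r) (r := 0) (s := 0)
      (by rw [← hx]; module)
    exact ⟨p, q, by module⟩
  · rintro ⟨p', q', hx⟩
    obtain ⟨-, -, rfl, rfl⟩ := h.comb_eq_zero (p := p - p') (q := q - q') (r := r) (s := s)
      (by linear_combination (norm := module) hx)
    module

theorem exists_hasStructureConstants (hG : Module.finrank ℝ G = 4) :
    ∃ p₁ p₂ p₃ p₄ q₁ q₂ q₃ q₄ ζ₁ ζ₂ η₁ η₂ : ℝ,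
      HasStructureConstants P v w p₁ p₂ p₃ p₄ q₁ q₂ q₃ q₄ ζ₁ ζ₂ η₁ η₂ := by
  have hv : E.φ (Q.J a) v = 0 := by rw [h.φ_J_v]; module
  have hJv : E.φ (Q.J a) (P.J v) = 0 := by rw [h.φ_J_Jv]; module
  have hw : E.φ (Q.J a) w = P.J v := by rw [h.φ_J_w]; module
  have hJw : E.φ (Q.J a) (P.J w) = v := by rw [h.φ_J_Jw]; module
  have hsq (x : G) : E.φ (Q.J a) (E.φ (Q.J a) x) = 0 := by
    obtain ⟨p, q, r, s, rfl⟩ := h.exists_eq_comb hG x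
    rw [h.φ_J_comb, h.φ_J_eq_zero_iff hG]
    exact ⟨s, r, rfl⟩
  have lie_v_Jv : ⁅v, P.J v⁆ = 0 := by
    have hlie := hsq ⁅P.J w, w⁆
    simp only [LieDerivation.apply_lie_eq_add, map_add, hJw, hw, hv, hJv, lie_zero, zero_lie]
      at hlie
    have htwo : (2 : ℝ) • ⁅v, P.J v⁆ = 0 := by linear_combination (norm := module) hlie
    exact (smul_eq_zero.1 htwo).resolve_left two_ne_zero
  obtain ⟨p₁, p₂, lie_w_v⟩ := (h.φ_J_eq_zero_iff hG (x := ⁅w, v⁆)).1 (by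
    rw [LieDerivation.apply_lie_eq_add, hv, hw, ← lie_skew (P.J v) v, lie_v_Jv, lie_zero, zero_add,
      neg_zero])
  obtain ⟨p₃, p₄, lie_w_Jv⟩ := (h.φ_J_eq_zero_iff hG (x := ⁅w, P.J v⁆)).1 (by
    rw [LieDerivation.apply_lie_eq_add, hJv, hw, lie_self, lie_zero, zero_add])
  obtain ⟨q₁, q₂, lie_Jw_v⟩ := (h.φ_J_eq_zero_iff hG (x := ⁅P.J w, v⁆)).1 (by
    rw [LieDerivation.apply_lie_eq_add, hv, hJw, lie_self, lie_zero, zero_add])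
  obtain ⟨q₃, q₄, lie_Jw_Jv⟩ := (h.φ_J_eq_zero_iff hG (x := ⁅P.J w, P.J v⁆)).1 (by
    rw [LieDerivation.apply_lie_eq_add, hJv, hJw, lie_v_Jv, lie_zero, zero_add])
  obtain ⟨ζ₁, ζ₂, η₁, η₂, lie_w_Jw⟩ := h.exists_eq_comb hG ⁅w, P.J w⁆
  exact ⟨p₁, p₂, p₃, p₄, q₁, q₂, q₃, q₄, ζ₁, ζ₂, η₁, η₂, h.toIsHyperbolicPair, lie_v_Jv, lie_w_v,
    lie_w_Jv, lie_Jw_v, lie_Jw_Jv, lie_w_Jw⟩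

theorem exists_isBracketNormalForm (hG : Module.finrank ℝ G = 4) :
    ∃ m₁ m₂ ζ₁ ζ₂ : ℝ, IsBracketNormalForm P v w m₁ m₂ ζ₁ ζ₂ := by
  obtain ⟨p₁, p₂, p₃, p₄, q₁, q₂, q₃, q₄, ζ₁, ζ₂, η₁, η₂, hB⟩ := h.exists_hasStructureConstants hG
  have hder := (E.φ (Q.J a)).apply_lie_eq_add w (P.J w)
  rw [hB.lie_w_Jw, h.φ_J_comb, h.φ_J_w, h.φ_J_Jw] at hder
  simp only [add_lie, lie_add, lie_sub, smul_lie, lie_smul, lie_self, hB.lie_w_v, hB.lie_w_Jw,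
    ← lie_skew (P.J v) (P.J w), hB.lie_Jw_Jv] at hder
  obtain ⟨hη₂, hη₁, -, -⟩ := h.comb_eq_zero (p := η₂ - (p₁ - q₃)) (q := η₁ - (p₂ - q₄)) (r := 0)
    (s := 0) (by linear_combination (norm := module) hder)
  exact ⟨_, _, _, _, hB.isBracketNormalForm (sub_eq_zero.1 hη₁) (sub_eq_zero.1 hη₂)⟩

theorem β_mul_eq_zero {m₁ m₂ ζ₁ ζ₂ : ℝ} (hB : IsBracketNormalForm P v w m₁ m₂ ζ₁ ζ₂) :
    β * m₁ = 0 ∧ β * m₂ = 0 := by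
  have hder := (E.φ a).apply_lie_eq_add w (P.J w)
  simp only [hB.lie_w_Jw, map_add, map_smul, h.φ_v, h.φ_Jv, h.φ_w, h.φ_Jw, lie_sub, lie_smul,
    add_lie, sub_lie, smul_lie, hB.lie_w_v, hB.lie_w_Jv, hB.lie_v_Jw, hB.lie_Jv_Jw,
    lie_self] at hder
  obtain ⟨h₁, h₂, -, -⟩ := h.comb_eq_zero (p := 2 * (β * m₁)) (q := 2 * (β * m₂)) (r := 0)
    (s := 0) (by linear_combination (norm := module) hder)
  exact ⟨by linarith, by linarith⟩

end Brackets

variable [FiniteDimensional ℝ H] [IsLieAbelian H] (hG : Module.finrank ℝ G = 4)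
  (hH : Module.finrank ℝ H = 2)

include hG hH

-- The antisymmetric operators commute with the symmetric one, so `β` and `β'` can be discarded.
theorem awRelated_extension_of_sym_eq {m : LieModel 4} {P' : PseudoKahler m.Alg}
    {g J M₁ M₂ : Matrix (Fin 4) (Fin 4) ℝ} {hg hJ hd₁ hd₂ hc hs h₁ h₂} {e : Fin 4 → G} {β β' : ℝ}
    (h : IsExtensionNormalForm E a v w 0 0 0 β β') (he : m.IsAdaptedFrame P g J e)
    (hS₁ : ∀ x, m.frame e (m.vec (M₁.mulVec x)) = E.sym a (m.frame e (m.vec x)))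
    (hS₂ : ∀ x, m.frame e (m.vec (M₂.mulVec x)) = P.J (E.sym a (m.frame e (m.vec x)))) :
    AWRelated E (m.extension P' g J M₁ M₂ hg hJ hd₁ hd₂ hc hs h₁ h₂) := by
  refine PK.awRelated_extension_of_sym_eq E hG hH he h.unit hS₁
    (fun x => (hS₂ x).trans (by rw [E.sym_J, LinearMap.comp_apply])) ?_ ?_ ?_ ?_ ?_ <;>
  intro x <;>
  obtain ⟨p, q, r, s, rfl⟩ := h.exists_eq_comb hG x <;>
  simp only [map_add, map_sub, map_neg, map_smul, E.sym_J_right, E.anti_J_right, h.S_v, h.S_w,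
    h.A_v, h.A_w, h.B_v, h.B_w, P.J_sq] <;>
  module

theorem awRelated_r4NonSemisimple_zero {β β' : ℝ} (h : IsExtensionNormalForm E a v w 0 0 0 β β')
    (hab : ∀ x y : G, ⁅x, y⁆ = 0) : AWRelated E (r4NonSemisimple 1 0 0) := by
  refine h.awRelated_extension_of_sym_eq hG hH
    (isAdaptedFrame_r4Kahler hab h.metric_half_add h.metric_half_sub h.metric_half_add_half_sub
      h.metric_half_add_J_half_sub)
    (forall_four fun _ _ _ _ => ?_) (forall_four fun _ _ _ _ => ?_)
  all_goals
    simp only [LieModel.frame_vec_four, mulVec_four, map_add, map_sub, map_smul, map_neg,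
      E.sym_J_right, h.S_v, h.S_w, P.J_sq]
    module

theorem awRelated_rh3Extension {β β' ζ s : ℝ} (h : IsExtensionNormalForm E a v w 0 0 0 β β')
    (hB : IsBracketNormalForm P v w 0 0 ζ 0) (hs : s ≠ 0) (hsζ : s ^ 3 * ζ = 1) :
    AWRelated E (rh3Extension (s ^ 2)) := by
  have hS : s ^ 2 * s⁻¹ = s := by field_simp
  refine h.awRelated_extension_of_sym_eq hG hH (hB.isAdaptedFrame_rh3Kahler hs hsζ)
    (forall_four fun x y _ _ => ?_) (forall_four fun x y _ _ => ?_)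
  all_goals
    simp only [LieModel.frame_vec_four, mulVec_four, map_add, map_smul, map_neg,
      E.sym_J_right, h.S_v, h.S_w, P.J_sq]
  · linear_combination (norm := module) hS • (x • v - y • P.J v)
  · linear_combination (norm := module) hS • (y • v + x • P.J v)

theorem awRelated_rp2Extension {m ζ₁ ζ₂ μ : ℝ} (h : IsExtensionNormalForm E a v w 0 0 0 0 0)
    (hB : IsBracketNormalForm P v w m 0 ζ₁ ζ₂) (hμ : μ * m = 1)
    (hμ_ne : (0 : ℝ) ^ 2 + (-μ ^ 2) ^ 2 ≠ 0) :
    AWRelated E (rp2Extension (-(μ ^ 3 * ζ₂)) 0 (-μ ^ 2) hμ_ne 1) := by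
  refine awRelated_extension_of_φ_eq E hG hH (hB.isAdaptedFrame_rp2Kahler hμ) h.unit
    (forall_four fun _ _ _ _ => ?_) (forall_four fun _ _ _ _ => ?_)
  all_goals
    simp only [LieModel.frame_vec_four, mulVec_four, map_add, map_neg, map_smul, P.J_sq, h.φ_v,
      h.φ_Jv, h.φ_w, h.φ_Jw, h.φ_J_v, h.φ_J_Jv, h.φ_J_w, h.φ_J_Jw]
    module

end IsExtensionNormalForm

end NilpotentCase

/-! ## The classification -/

section Classification

variable {G H : Type*} [LieRing G] [LieAlgebra ℝ G] [FiniteDimensional ℝ G] [LieRing H]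
  [LieAlgebra ℝ H] [FiniteDimensional ℝ H] [IsLieAbelian H] {P : PseudoKahler G}
  {Q : PseudoKahler H} {E : PKExtension P Q} {a : H} {v w : G}

namespace IsExtensionNormalForm

omit [FiniteDimensional ℝ H] [IsLieAbelian H] in
theorem exists_rotate_β'_eq_zero {β β' : ℝ} (h : IsExtensionNormalForm E a v w 0 0 0 β β') :
    ∃ (a' : H) (v' w' : G) (b : ℝ), IsExtensionNormalForm E a' v' w' 0 0 0 b 0 := by
  obtain ⟨x, y, hxy, -, him⟩ := exists_rotation_onto_ray β β'
  obtain ⟨v', w', h'⟩ := h.exists_rotate hxy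
  simp only [mul_zero, sub_zero, add_zero, him] at h'
  exact ⟨_, v', w', _, h'⟩

variable (hG : Module.finrank ℝ G = 4) (hH : Module.finrank ℝ H = 2)

include hG hH

theorem exists_awRelated_rp2Extension {m₁ m₂ ζ₁ ζ₂ : ℝ}
    (h : IsExtensionNormalForm E a v w 0 0 0 0 0) (hB : IsBracketNormalForm P v w m₁ m₂ ζ₁ ζ₂)
    (hm : m₁ ^ 2 + m₂ ^ 2 ≠ 0) :
    ∃ (p q r : ℝ) (hqr : q ^ 2 + r ^ 2 ≠ 0), AWRelated E (rp2Extension p q r hqr 1) := by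
  obtain ⟨x, y, hxy, hre, him⟩ := exists_rotation_onto_ray m₁ m₂
  have h' := h.rotate hxy rfl rfl
  have hB' := hB.rotate hxy
  simp only [mul_zero, sub_zero, add_zero] at h'
  rw [him, hre] at hB'
  have hm' : √(m₁ ^ 2 + m₂ ^ 2) ≠ 0 := (Real.sqrt_pos.2 (by positivity)).ne'
  have hqr : (0 : ℝ) ^ 2 + (-(√(m₁ ^ 2 + m₂ ^ 2))⁻¹ ^ 2) ^ 2 ≠ 0 := by
    rw [zero_pow two_ne_zero, zero_add]
    exact pow_ne_zero 2 (neg_ne_zero.2 (pow_ne_zero 2 (inv_ne_zero hm')))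
  exact ⟨_, _, _, hqr, h'.awRelated_rp2Extension hG hH hB' (inv_mul_cancel₀ hm') _⟩

theorem exists_awRelated_rh3Extension {β β' ζ₁ ζ₂ : ℝ}
    (h : IsExtensionNormalForm E a v w 0 0 0 β β') (hB : IsBracketNormalForm P v w 0 0 ζ₁ ζ₂)
    (hζ : ζ₁ ^ 2 + ζ₂ ^ 2 ≠ 0) : ∃ t : ℝ, 0 < t ∧ AWRelated E (rh3Extension t) := by
  obtain ⟨x, y, hxy, hre, him⟩ := exists_rotation_onto_ray ζ₁ ζ₂
  have h' := h.rotate hxy rfl rfl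
  have hB' := hB.rotate hxy
  simp only [mul_zero, sub_zero, add_zero] at h' hB'
  rw [him, hre] at hB'
  have hζ' : 0 < √(ζ₁ ^ 2 + ζ₂ ^ 2) := Real.sqrt_pos.2 (by positivity)
  set s := (√(ζ₁ ^ 2 + ζ₂ ^ 2))⁻¹ ^ ((3 : ℕ) : ℝ)⁻¹
  have hs : 0 < s := Real.rpow_pos_of_pos (inv_pos.2 hζ') _
  have hs_pow : s ^ 3 * √(ζ₁ ^ 2 + ζ₂ ^ 2) = 1 := by
    rw [Real.rpow_inv_natCast_pow (inv_pos.2 hζ').le three_ne_zero, inv_mul_cancel₀ hζ'.ne']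
  exact ⟨s ^ 2, by positivity, h'.awRelated_rh3Extension hG hH hB' hs.ne' hs_pow⟩

theorem awRelated_of_nilpotent {β : ℝ} (h : IsExtensionNormalForm E a v w 0 0 0 β 0) :
    AWRelated E (r4NonSemisimple 1 0 0) ∨
    (∃ t : ℝ, 0 < t ∧ AWRelated E (rh3Extension t)) ∨
    (∃ (p q r : ℝ) (hqr : q ^ 2 + r ^ 2 ≠ 0), AWRelated E (rp2Extension p q r hqr 1)) := by
  obtain ⟨m₁, m₂, ζ₁, ζ₂, hB⟩ := h.exists_isBracketNormalForm hG
  obtain ⟨hβ₁, hβ₂⟩ := h.β_mul_eq_zero hB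
  by_cases hm : m₁ ^ 2 + m₂ ^ 2 = 0
  · obtain ⟨rfl, rfl⟩ : m₁ = 0 ∧ m₂ = 0 :=
      mul_self_add_mul_self_eq_zero.1 (by linear_combination hm)
    by_cases hζ : ζ₁ ^ 2 + ζ₂ ^ 2 = 0
    · obtain ⟨rfl, rfl⟩ : ζ₁ = 0 ∧ ζ₂ = 0 :=
        mul_self_add_mul_self_eq_zero.1 (by linear_combination hζ)
      exact Or.inl (h.awRelated_r4NonSemisimple_zero hG hH (hB.lie_eq_zero hG))
    · exact Or.inr (Or.inl (h.exists_awRelated_rh3Extension hG hH hB hζ))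
  · obtain rfl : β = 0 := by
      by_contra hβ
      exact hm (by rw [(mul_eq_zero.1 hβ₁).resolve_left hβ, (mul_eq_zero.1 hβ₂).resolve_left hβ,
        zero_pow two_ne_zero, add_zero])
    exact Or.inr (Or.inr (h.exists_awRelated_rp2Extension hG hH hB hm))

theorem classification {κ α₁ α₂ β β' : ℝ} (h : IsExtensionNormalForm E a v w κ α₁ α₂ β β') :
    (∃ a : ℝ, 0 < a ∧ AWRelated E (r4Semisimple a)) ∨
    (∃ a b c : ℝ, 0 < a ∧ ((b = 0 ∧ c = 0) ∨ c ≠ 0) ∧ AWRelated E (r4NonSemisimple a b c)) ∨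
    (∃ a : ℝ, 0 < a ∧ AWRelated E (rh3Extension a)) ∨
    (∃ (p q r : ℝ) (h : q ^ 2 + r ^ 2 ≠ 0) (a : ℝ),
      0 < a ∧ AWRelated E (rp2Extension p q r h a)) := by
  by_cases hκ : κ = 0
  · subst hκ
    by_cases hα : α₁ ^ 2 + α₂ ^ 2 = 0
    · obtain ⟨rfl, rfl⟩ : α₁ = 0 ∧ α₂ = 0 :=
        mul_self_add_mul_self_eq_zero.1 (by linear_combination hα)
      obtain ⟨_, _, _, _, h'⟩ := h.exists_rotate_β'_eq_zero
      rcases h'.awRelated_of_nilpotent hG hH with hE | hE | ⟨p, q, r, hqr, hE⟩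
      · exact Or.inr (Or.inl ⟨1, 0, 0, one_pos, Or.inl ⟨rfl, rfl⟩, hE⟩)
      · exact Or.inr (Or.inr (Or.inl hE))
      · exact Or.inr (Or.inr (Or.inr ⟨p, q, r, hqr, 1, one_pos, hE⟩))
    · obtain ⟨_, _, _, c, b, hc, h'⟩ := h.exists_rotate_of_α_ne_zero hα
      exact Or.inr (Or.inl ⟨1, b, c, one_pos, Or.inr hc, h'.awRelated_r4NonSemisimple hG hH hc⟩)
  · obtain ⟨_, _, _, t, h'⟩ := h.exists_isSemisimpleForm hκ
    exact Or.inl ⟨t, h'.pos, h'.awRelated hG hH⟩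

end IsExtensionNormalForm

end Classification

theorem exists_isExtensionNormalForm_of_not_isTrivial {G H : Type*} [LieRing G] [LieAlgebra ℝ G]
    [FiniteDimensional ℝ G] [LieRing H] [LieAlgebra ℝ H] [IsLieAbelian H] {P : PseudoKahler G}
    {Q : PseudoKahler H} (E : PKExtension P Q) (hG : Module.finrank ℝ G = 4)
    (hQ : ∀ A : H, A ≠ 0 → 0 < Q.metric A A) (hE : ¬ E.IsTrivial) :
    ∃ (a : H) (v w : G) (κ α₁ α₂ β β' : ℝ), IsExtensionNormalForm E a v w κ α₁ α₂ β β' := by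
  obtain ⟨A, hA⟩ : ∃ A, E.sym A ≠ 0 := by
    by_contra! h
    exact hE (E.isTrivial_of_sym_eq_zero (LinearMap.ext h))
  have hpos : 0 < Q.metric A A := hQ A (by rintro rfl; exact hA (map_zero _))
  have hn : √(Q.metric A A) ^ 2 = Q.metric A A := Real.sq_sqrt hpos.le
  have hn_ne : √(Q.metric A A) ≠ 0 := (Real.sqrt_pos.2 hpos).ne'
  refine ⟨(√(Q.metric A A))⁻¹ • A, exists_isExtensionNormalForm E hG ?_ ?_⟩
  · simp only [map_smul, LinearMap.smul_apply, smul_eq_mul]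
    rw [← mul_assoc, ← sq, inv_pow, hn, inv_mul_cancel₀ hpos.ne']
  · rw [map_smul]
    exact smul_ne_zero (inv_ne_zero hn_ne) hA

theorem classification_of_not_isTrivial {G H : Type*} [LieRing G] [LieAlgebra ℝ G]
    [FiniteDimensional ℝ G] [LieRing H] [LieAlgebra ℝ H] [IsLieAbelian H] {P : PseudoKahler G}
    {Q : PseudoKahler H} (E : PKExtension P Q) (hG : Module.finrank ℝ G = 4)
    (hH : Module.finrank ℝ H = 2) (hQ : ∀ A : H, A ≠ 0 → 0 < Q.metric A A) (hE : ¬ E.IsTrivial) :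
    (∃ a : ℝ, 0 < a ∧ AWRelated E (r4Semisimple a)) ∨
    (∃ a b c : ℝ, 0 < a ∧ ((b = 0 ∧ c = 0) ∨ c ≠ 0) ∧ AWRelated E (r4NonSemisimple a b c)) ∨
    (∃ a : ℝ, 0 < a ∧ AWRelated E (rh3Extension a)) ∨
    (∃ (p q r : ℝ) (h : q ^ 2 + r ^ 2 ≠ 0) (a : ℝ),
      0 < a ∧ AWRelated E (rp2Extension p q r h a)) := by
  have : FiniteDimensional ℝ H := Module.finite_of_finrank_eq_succ hH
  obtain ⟨_, _, _, _, _, _, _, _, h⟩ := exists_isExtensionNormalForm_of_not_isTrivial E hG hQ hE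
  exact h.classification hG hH

/-! ## Non-triviality -/

theorem LieModel.extension_skew_of_isTrivial {m : LieModel 4} {P : PseudoKahler m.Alg}
    {g J M₁ M₂ : Matrix (Fin 4) (Fin 4) ℝ} {hg hJ hd₁ hd₂ hc hs h₁ h₂}
    (h : (m.extension P g J M₁ M₂ hg hJ hd₁ hd₂ hc hs h₁ h₂).IsTrivial) (x y : Fin 4 → ℝ) :
    M₁.mulVec x ⬝ᵥ g.mulVec y + x ⬝ᵥ g.mulVec (M₁.mulVec y) = 0 := by
  have hskew := (P.symPart_eq_zero_iff _).1
    (LinearMap.congr_fun h.sym_eq_zero ((abelian 2).vec ![1, 0])) (m.vec x) (m.vec y)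
  simpa only [LieDerivation.coeFn_coe, LieModel.extension_φ_vec, hg, m.form_vec,
    Matrix.cons_val_zero, Matrix.cons_val_one, one_smul, zero_smul, add_zero] using hskew

theorem not_isTrivial_r4Semisimple {a : ℝ} (ha : 0 < a) : ¬ (r4Semisimple a).IsTrivial := by
  intro h
  have hskew := LieModel.extension_skew_of_isTrivial h ![1, 0, 0, 0] ![1, 0, 0, 0]
  simp only [mulVec_four, dotProduct_four] at hskew
  linarith

theorem not_isTrivial_r4NonSemisimple {a : ℝ} (b c : ℝ) (ha : 0 < a) :
    ¬ (r4NonSemisimple a b c).IsTrivial := by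
  intro h
  have hskew := LieModel.extension_skew_of_isTrivial h ![1, 0, 0, 0] ![1, 0, 0, 0]
  simp only [mulVec_four, dotProduct_four] at hskew
  linarith

theorem not_isTrivial_rh3Extension {a : ℝ} (ha : 0 < a) : ¬ (rh3Extension a).IsTrivial := by
  intro h
  have hskew := LieModel.extension_skew_of_isTrivial h ![1, 0, 0, 0] ![1, 0, 0, 0]
  simp only [mulVec_four, dotProduct_four] at hskew
  linarith

theorem not_isTrivial_rp2Extension {p q r : ℝ} (hqr : q ^ 2 + r ^ 2 ≠ 0) {a : ℝ} (ha : 0 < a) :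
    ¬ (rp2Extension p q r hqr a).IsTrivial := by
  intro h
  have hskew₁ := LieModel.extension_skew_of_isTrivial h ![1, 0, 0, 0] ![1, 0, 0, 0]
  have hskew₂ := LieModel.extension_skew_of_isTrivial h ![1, 0, 0, 0] ![0, 1, 0, 0]
  simp only [mulVec_four, dotProduct_four] at hskew₁ hskew₂
  have hr : r = 0 := (mul_eq_zero.1 (show a * r = 0 by linarith)).resolve_left ha.ne'
  have hq : q = 0 := (mul_eq_zero.1 (show a * q = 0 by linarith)).resolve_left ha.ne'
  exact hqr (by rw [hr, hq, zero_pow two_ne_zero, add_zero])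

section Comap

variable {G G' H : Type*} [LieRing G] [LieAlgebra ℝ G] [LieRing G'] [LieAlgebra ℝ G'] [LieRing H]
  [LieAlgebra ℝ H]

/-- The derivation `f⁻¹ D f`. -/
def derivationComap (f : G ≃ₗ⁅ℝ⁆ G') (D : LieDerivation ℝ G' G') : LieDerivation ℝ G G where
  toLinearMap := (f.symm : G' →ₗ[ℝ] G) ∘ₗ D.toLinearMap ∘ₗ (f : G →ₗ[ℝ] G')
  leibniz' x y := by
    change f.symm (D (f ⁅x, y⁆)) = ⁅x, f.symm (D (f y))⁆ - ⁅y, f.symm (D (f x))⁆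
    rw [LieEquiv.map_lie, D.apply_lie_eq_sub, map_sub, LieEquiv.map_lie, LieEquiv.map_lie,
      LieEquiv.symm_apply_apply, LieEquiv.symm_apply_apply]

theorem derivationComap_apply (f : G ≃ₗ⁅ℝ⁆ G') (D : LieDerivation ℝ G' G') (x : G) :
    derivationComap f D x = f.symm (D (f x)) :=
  rfl

/-- The representation `A ↦ f⁻¹ φ(A) f`. -/
def representationComap (f : G ≃ₗ⁅ℝ⁆ G') (φ : H →ₗ⁅ℝ⁆ LieDerivation ℝ G' G') :
    H →ₗ⁅ℝ⁆ LieDerivation ℝ G G where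
  toFun A := derivationComap f (φ A)
  map_add' A B := by
    ext x
    simp only [derivationComap_apply, map_add, LieDerivation.add_apply]
  map_smul' t A := by
    ext x
    simp only [derivationComap_apply, map_smul, LieDerivation.smul_apply, RingHom.id_apply]
  map_lie' {A B} := by
    ext x
    simp only [LieDerivation.lie_apply, derivationComap_apply, LieHom.map_lie, map_sub,
      LieEquiv.apply_symm_apply]

theorem apply_representationComap_apply (f : G ≃ₗ⁅ℝ⁆ G') (φ : H →ₗ⁅ℝ⁆ LieDerivation ℝ G' G')
    (A : H) (x : G) : f (representationComap f φ A x) = φ A (f x) :=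
  f.apply_symm_apply _

variable {P : PseudoKahler G} {P' : PseudoKahler G'} {Q : PseudoKahler H}
  [FiniteDimensional ℝ G] [FiniteDimensional ℝ G']

/-- The extension of `(G, P)` obtained by transporting an extension of `(G', P')` along an
equivalence. -/
def PKExtension.comap (f : PseudoKahlerEquiv P P') (E : PKExtension P' Q) : PKExtension P Q where
  φ := representationComap f.toLieEquiv E.φ
  isExtension := by
    have h := (isExtension_iff P' Q E.φ).1 E.isExtension
    rw [semidirect_integrable_iff, semidirect_omegaClosed_iff] at h
    rw [isExtension_iff, semidirect_integrable_iff, semidirect_omegaClosed_iff]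
    have hinj (x y : G) : f.toLieEquiv x = f.toLieEquiv y → x = y := fun h => f.injective h
    refine ⟨fun A x => hinj _ _ ?_, fun A x y => ?_⟩
    · simp only [map_add, map_neg, map_zero, apply_representationComap_apply, f.map_J]
      exact h.1 A (f.toLieEquiv x)
    · simp only [← f.map_metric, f.map_J, apply_representationComap_apply]
      exact h.2 A (f.toLieEquiv x) (f.toLieEquiv y)

theorem PKExtension.IsTrivial.of_comap {f : PseudoKahlerEquiv P P'} {E : PKExtension P' Q}
    (h : (E.comap f).IsTrivial) : E.IsTrivial := by
  refine E.isTrivial_of_sym_eq_zero (LinearMap.ext fun A =>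
    (P'.symPart_eq_zero_iff _).2 fun x y => ?_)
  obtain ⟨x, rfl⟩ := f.surjective x
  obtain ⟨y, rfl⟩ := f.surjective y
  have hskew := (P.symPart_eq_zero_iff _).1 (LinearMap.congr_fun h.sym_eq_zero A) x y
  simpa only [← f.map_metric, LieDerivation.coeFn_coe, PKExtension.comap,
    apply_representationComap_apply] using hskew

end Comap

theorem planeKahler_metric_pos (A : (abelian 2).Alg) (hA : A ≠ 0) :
    0 < planeKahler.metric A A := by
  obtain ⟨v, rfl⟩ := (abelian 2).vec.surjective A
  have hmetric : planeKahler.metric ((abelian 2).vec v) ((abelian 2).vec v) = v ⬝ᵥ v :=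
    ((abelian 2).form_vec 1 v v).trans (by rw [Matrix.one_mulVec])
  have hv : v ⬝ᵥ v ≠ 0 := fun h => hA (by rw [dotProduct_self_eq_zero.1 h, map_zero])
  rw [hmetric]
  exact lt_of_le_of_ne (Finset.sum_nonneg fun i _ => mul_self_nonneg (v i)) hv.symm

instance isLieAbelian_abelian (n : ℕ) : IsLieAbelian (abelian n).Alg := ⟨fun _ _ => rfl⟩

theorem exists_not_isTrivial_iff {G : Type*} [LieRing G] [LieAlgebra ℝ G] [FiniteDimensional ℝ G]
    (P : PseudoKahler G) (hG : Module.finrank ℝ G = 4) :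
    (∃ E : PKExtension P planeKahler, ¬ E.IsTrivial) ↔
      (Nonempty (PseudoKahlerEquiv P r4Kahler) ∨ Nonempty (PseudoKahlerEquiv P rh3Kahler) ∨
        ∃ (p q r : ℝ) (h : q ^ 2 + r ^ 2 ≠ 0),
          Nonempty (PseudoKahlerEquiv P (rp2Kahler p q r h))) := by
  constructor
  · rintro ⟨E, hE⟩
    rcases classification_of_not_isTrivial E hG (abelian 2).finrank_alg planeKahler_metric_pos hE
      with ⟨-, -, f, -⟩ | ⟨-, -, -, -, -, f, -⟩ | ⟨-, -, f, -⟩ | ⟨p, q, r, h, -, -, f, -⟩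
    · exact Or.inl ⟨f⟩
    · exact Or.inl ⟨f⟩
    · exact Or.inr (Or.inl ⟨f⟩)
    · exact Or.inr (Or.inr ⟨p, q, r, h, ⟨f⟩⟩)
  · rintro (⟨⟨f⟩⟩ | ⟨⟨f⟩⟩ | ⟨p, q, r, h, ⟨f⟩⟩)
    · exact ⟨(r4Semisimple 1).comap f, mt .of_comap (not_isTrivial_r4Semisimple one_pos)⟩
    · exact ⟨(rh3Extension 1).comap f, mt .of_comap (not_isTrivial_rh3Extension one_pos)⟩
    · exact ⟨(rp2Extension p q r h 1).comap f, mt .of_comap (not_isTrivial_rp2Extension h one_pos)⟩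

end PK

end

theorem mainTheorem2 :
    -- every non-trivial extension is AW-related to one in the list
    (∀ (G : Type*) [LieRing G] [LieAlgebra ℝ G] [FiniteDimensional ℝ G]
      (H : Type*) [LieRing H] [LieAlgebra ℝ H] [IsLieAbelian H]
      (P : PseudoKahler G) (Q : PseudoKahler H) (E : PKExtension P Q),
      Module.finrank ℝ G = 4 → Module.finrank ℝ H = 2 →
      (∀ A : H, A ≠ 0 → 0 < Q.metric A A) → ¬ E.IsTrivial →
      (∃ a : ℝ, 0 < a ∧ AWRelated E (r4Semisimple a)) ∨
      (∃ a b c : ℝ, 0 < a ∧ ((b = 0 ∧ c = 0) ∨ c ≠ 0) ∧ AWRelated E (r4NonSemisimple a b c)) ∨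
      (∃ a : ℝ, 0 < a ∧ AWRelated E (rh3Extension a)) ∨
      (∃ (p q r : ℝ) (h : q ^ 2 + r ^ 2 ≠ 0) (a : ℝ),
        0 < a ∧ AWRelated E (rp2Extension p q r h a))) ∧
    -- the extensions in the list are non-trivial
    (∀ a : ℝ, 0 < a → ¬ (r4Semisimple a).IsTrivial) ∧
    (∀ a b c : ℝ, 0 < a → ¬ (r4NonSemisimple a b c).IsTrivial) ∧
    (∀ a : ℝ, 0 < a → ¬ (rh3Extension a).IsTrivial) ∧
    (∀ (p q r : ℝ) (h : q ^ 2 + r ^ 2 ≠ 0) (a : ℝ),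
      0 < a → ¬ (rp2Extension p q r h a).IsTrivial) ∧
    -- the pseudo-Kähler Lie algebras that admit non-trivial extensions
    (∀ (G : Type*) [LieRing G] [LieAlgebra ℝ G] [FiniteDimensional ℝ G] (P : PseudoKahler G),
      Module.finrank ℝ G = 4 →
      ((∃ E : PKExtension P planeKahler, ¬ E.IsTrivial) ↔
        (Nonempty (PseudoKahlerEquiv P r4Kahler) ∨ Nonempty (PseudoKahlerEquiv P rh3Kahler) ∨
          ∃ (p q r : ℝ) (h : q ^ 2 + r ^ 2 ≠ 0),
            Nonempty (PseudoKahlerEquiv P (rp2Kahler p q r h))))) := by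
  exact ⟨fun G _ _ _ H _ _ _ P Q E hG hH hQ hE => classification_of_not_isTrivial E hG hH hQ hE,
    fun _ ha => not_isTrivial_r4Semisimple ha, fun _ b c ha => not_isTrivial_r4NonSemisimple b c ha,
    fun _ ha => not_isTrivial_rh3Extension ha,
    fun _ _ _ h _ ha => not_isTrivial_rp2Extension h ha,
    fun G _ _ _ P hG => exists_not_isTrivial_iff P hG⟩
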